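/- Let $p$ be a prime, $\mathbb C_p$ the completion of an algebraic closure of $\mathbb Q_p$, $\Delta([x,y],[x',y'])=\frac{|xy'-x'y|}{\max\{|x|,|y|\}\max\{|x'|,|y'|\}}$ the chordal metric on $\mathbb P(\mathbb C_p)=\mathbb C_p\cup\{\infty\}$, and $K\subset\mathbb C_p$ a finite extension of $\mathbb Q_p$. Let $B\subset\mathbb C_p$ be a ball and let $(R,c)$ be a one parameter family of rational maps with marked critical point over $B$: the $R_t$ ($t\in B$) are rational maps of degree independent of $t$ whose coefficients are holomorphic on $B$ (given by a power series converging on $B$), and $c:B\to\mathbb P(\mathbb C_p)$ is holomorphic with $c_t$ a critical point of $R_t$ for all $t\in B$. $(R,c)$ is defined over $K$ if these power series can be taken centred at a point of $B\cap K$ with coefficients in $K$. A point $c$ is unramified for a rational map $R$ if there are infinitely many points $z$ which are unramified preimages of $c$, i.e. $R^n(z)=c$ and $\deg_{R^n}(z)=1$ for some $n\ge 1$. $(R,c)$ has a Misiurewicz bifurcation at $t_0\in B$ if, for some integer $\ell\ge1$: (M1) $R_{t_0}^\ell(c_{t_0})$ is a repelling fixed point of $R_{t_0}$; (M2) $c_{t_0}$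 is unramified for $R_{t_0}$; (M3) for some $t\in B$, $R_t^\ell(c_t)$ is not a fixed point of $R_t$; (M4) the local degree $\deg_{R_t^\ell}(c_t)$ is constant for $t$ close to $t_0$. In that case let $\ell\ge1$ be the least integer such that $a_{t_0}=R_{t_0}^\ell(c_{t_0})$ is a repelling fixed point of $R_{t_0}$, let $\lambda$ be its multiplier, and let $a_t$ be the fixed point of $R_t$ continuing $a_{t_0}$ holomorphically for $t$ near $t_0$. Use the standard coordinate $w$ at finite points and $1/w$ at $\infty$. The bifurcation is transversal if $t\mapsto R_t^\ell(c_t)-a_t$ has non-zero derivative at $t_0$. Write $$R_{t_0}^\ell(w)=a_{t_0}+\rho(w-c_{t_0})^d+\cdots,\qquad R_t^\ell(c_t)-a_t=\rho'(t-t_0)^{d'}+\cdots,\qquad \rho,\rho'\neq0.$$ A $K$-admissible homoclinic orbit at $t_0$ is a sequence $(z_i)_{i\in\mathbb Z}$ in $\mathbb P(K)=K\cup\{\infty\}$ with $R_{t_0}(z_i)=z_{i+1}$ for all $i$, $z_i\to a_{t_0}$ as $|i|\to\infty$, $z_0=c_{t_0}$, each $z_j$ with $j<0$ an unramified preimage of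 $c_{t_0}$, and such that for some $m_0\in\mathbb Z$ $$-\lambda^{m_0}\zeta/\rho\in K^d\quad\text{and}\quad \lambda^{m_0}\zeta/\rho'\in K^{d'},\qquad\text{where } \zeta=\lim_{i\to\infty}\lambda^i(z_{-i}-a_{t_0})$$ and $K^n$ denotes the set of $n$-th powers of elements of $K$. **Proposition A.** Suppose that $(R,c)$ is defined over $K$, has a Misiurewicz bifurcation at $t=0$, and has a $K$-admissible homoclinic orbit at $t=0$. Then there is a sequence of parameters $t_r\in K\cap B$ converging to $0$ such that for every $r$, $(R,c)$ has a transversal Misiurewicz bifurcation at $t=t_r$ and admits a $K$-admissible homoclinic orbit at $t=t_r$. Moreover, if $\ell_r\ge1$ is the least integer such that $R_{t_r}^{\ell_r}(c_{t_r})$ is a repelling fixed point of $R_{t_r}$, then $$\lim_{r\to\infty}\ \min_{1\le i\le \ell_r}\Delta\big(c_{t_r},R_{t_r}^i(c_{t_r})\big)=0.$$ -/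

import Mathlib

open Filter Topology

noncomputable section

namespace MisBif

section Projective

variable {F : Type*} [NontriviallyNormedField F]

/-- The chordal metric on the projective line, identified with `OnePoint F`, the disjoint union of
`F` and the point at infinity. (The topology of `OnePoint F` as a one-point compactification is
never used: all limits in the projective line are taken with respect to `chordal`.) -/
def chordal : OnePoint F → OnePoint F → ℝ
  | OnePoint.infty, OnePoint.infty => 0
  | OnePoint.infty, OnePoint.some y => 1 / max 1 ‖y‖
  | OnePoint.some x, OnePoint.infty => 1 / max 1 ‖x‖
  | OnePoint.some x, OnePoint.some y => ‖x - y‖ / (max 1 ‖x‖ * max 1 ‖y‖)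

/-- The map of the projective line defined by the quotient `P / Q`, where `P` and `Q` are coprime
polynomials and `N` is the maximum of their degrees. -/
def ratEval (N : ℕ) (P Q : Polynomial F) : OnePoint F → OnePoint F
  | OnePoint.infty =>
      open Classical in
      if Q.coeff N = 0 then OnePoint.infty else OnePoint.some (P.coeff N / Q.coeff N)
  | OnePoint.some z =>
      open Classical in
      if Q.eval z = 0 then OnePoint.infty else OnePoint.some (P.eval z / Q.eval z)

/-- A coordinate of the projective line that is finite near the point `a`: the standard coordinate
`w` if `a` is finite, and `1 / w` if `a` is the point at infinity. (The value `0` at the point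
where the coordinate is infinite is immaterial.) -/
def coord : OnePoint F → OnePoint F → F
  | OnePoint.infty, OnePoint.infty => 0
  | OnePoint.infty, OnePoint.some w => w⁻¹
  | OnePoint.some _, OnePoint.infty => 0
  | OnePoint.some _, OnePoint.some w => w

/-- The inverse of the coordinate `coord a`. -/
def param : OnePoint F → F → OnePoint F
  | OnePoint.infty, u =>
      open Classical in if u = 0 then OnePoint.infty else OnePoint.some u⁻¹
  | OnePoint.some _, u => OnePoint.some u

/-- The expression of `f` near `z` in the coordinates of the source at `z` and of the target at
`f z`. -/
def chartMap (f : OnePoint F → OnePoint F) (z : OnePoint F) : F → F :=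
  fun u => coord (f z) (f (param z u))

/-- The local degree of `f` at `z`. -/
def localDegree (f : OnePoint F → OnePoint F) (z : OnePoint F) : ℕ∞ :=
  analyticOrderAt (fun u => chartMap f z u - coord (f z) (f z)) (coord z z)

/-- `z` is a critical point of `f`. -/
def IsCriticalPt (f : OnePoint F → OnePoint F) (z : OnePoint F) : Prop :=
  1 < localDegree f z

/-- The multiplier of `f` at a fixed point `a`. -/
def multiplier (f : OnePoint F → OnePoint F) (a : OnePoint F) : F :=
  deriv (chartMap f a) (coord a a)

def IsRepellingFixedPt (f : OnePoint F → OnePoint F) (a : OnePoint F) : Prop :=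
  f a = a ∧ 1 < ‖multiplier f a‖

/-- Some iterate of `f` maps `z` to `w`, with local degree one. -/
def IsUnramifiedPreimage (f : OnePoint F → OnePoint F) (w z : OnePoint F) : Prop :=
  ∃ n : ℕ, 1 ≤ n ∧ f^[n] z = w ∧ localDegree f^[n] z = 1

def IsUnramified (f : OnePoint F → OnePoint F) (w : OnePoint F) : Prop :=
  {z | IsUnramifiedPreimage f w z}.Infinite

/-- `g u = ρ (u - u₀) ^ d + (higher order terms)` near `u₀`, with `ρ ≠ 0`. -/
def HasLeadingTerm (g : F → F) (u₀ : F) (d : ℕ) (ρ : F) : Prop :=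
  ρ ≠ 0 ∧ ∃ h : F → F, AnalyticAt F h u₀ ∧ h u₀ = ρ ∧
    ∀ᶠ u in 𝓝 u₀, g u = (u - u₀) ^ d * h u

/-- A homoclinic orbit of `f` with respect to the fixed point `a`: a bi-infinite orbit converging
to `a` in both directions (the filter `cofinite` on `ℤ` expresses `|i| → ∞`). -/
def IsHomoclinic (f : OnePoint F → OnePoint F) (a : OnePoint F) (z : ℤ → OnePoint F) : Prop :=
  (∀ i, f (z i) = z (i + 1)) ∧ Tendsto (fun i => chordal (z i) a) cofinite (𝓝 0)

/-- A homoclinic orbit through `c` at time `0`, such that all earlier points are unramified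
preimages of `c`. -/
def IsCriticalHomoclinic (f : OnePoint F → OnePoint F) (a c : OnePoint F)
    (z : ℤ → OnePoint F) : Prop :=
  IsHomoclinic f a z ∧ z 0 = c ∧ ∀ j < 0, IsUnramifiedPreimage f c (z j)

/-- `ζ` is the limit of `λ ^ i * (z (-i) - a)` as `i → ∞`, where `λ` is the multiplier of `f` at
`a`. -/
def IsAsymptoticPosition (f : OnePoint F → OnePoint F) (a : OnePoint F) (z : ℤ → OnePoint F)
    (ζ : F) : Prop :=
  Tendsto (fun i : ℕ => multiplier f a ^ i * (coord a (z (-(i : ℤ))) - coord a a)) atTop (𝓝 ζ)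

end Projective

section Families

variable {p : ℕ} [Fact p.Prime]

/-- Balls, with or without the boundary sphere, and of arbitrary positive radius. -/
def IsBall (B : Set ℂ_[p]) : Prop :=
  ∃ (a : ℂ_[p]) (r : ℝ), 0 < r ∧ (B = Metric.closedBall a r ∨ B = Metric.ball a r)

/-- `f` is given on the ball `B` by one convergent power series. -/
def HolomorphicOnBall (f : ℂ_[p] → ℂ_[p]) (B : Set ℂ_[p]) : Prop :=
  ∃ ξ ∈ B, ∃ a : ℕ → ℂ_[p], ∀ z ∈ B, HasSum (fun n => a n * (z - ξ) ^ n) (f z)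

/-- `f` is given on the ball `B` by a convergent power series, centred at a point of `K` and with
coefficients in `K`. -/
def HolomorphicOnBallOver (K : IntermediateField ℚ_[p] ℂ_[p]) (f : ℂ_[p] → ℂ_[p])
    (B : Set ℂ_[p]) : Prop :=
  ∃ ξ ∈ B, ξ ∈ K ∧ ∃ a : ℕ → ℂ_[p], (∀ n, a n ∈ K) ∧
    ∀ z ∈ B, HasSum (fun n => a n * (z - ξ) ^ n) (f z)

/-- The polynomial with coefficients `a 0, …, a N`. -/
def polyOfCoeffs {N : ℕ} (a : Fin (N + 1) → ℂ_[p]) : Polynomial ℂ_[p] :=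
  ∑ i, Polynomial.C (a i) * Polynomial.X ^ (i : ℕ)

variable (p) in
/-- A one parameter family of rational maps, of degree `N` independent of the parameter, with
coefficients holomorphic on a ball `B`. -/
structure RatFamily where
  B : Set ℂ_[p]
  isBall : IsBall B
  N : ℕ
  numCoeff : Fin (N + 1) → ℂ_[p] → ℂ_[p]
  denCoeff : Fin (N + 1) → ℂ_[p] → ℂ_[p]
  holomorphic_num : ∀ i, HolomorphicOnBall (numCoeff i) B
  holomorphic_den : ∀ i, HolomorphicOnBall (denCoeff i) B
  coprime : ∀ t ∈ B,
    IsCoprime (polyOfCoeffs fun i => numCoeff i t) (polyOfCoeffs fun i => denCoeff i t)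
  degree_eq : ∀ t ∈ B,
    max (polyOfCoeffs fun i => numCoeff i t).natDegree
      (polyOfCoeffs fun i => denCoeff i t).natDegree = N

/-- The rational map `R_t` of the family. -/
def RatFamily.map (R : RatFamily p) (t : ℂ_[p]) : OnePoint ℂ_[p] → OnePoint ℂ_[p] :=
  ratEval R.N (polyOfCoeffs fun i => R.numCoeff i t) (polyOfCoeffs fun i => R.denCoeff i t)

/-- The point `[x : y]` of the projective line. -/
def ofHomogeneous (x y : ℂ_[p]) : OnePoint ℂ_[p] :=
  open Classical in if y = 0 then OnePoint.infty else OnePoint.some (x / y)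

variable (p) in
/-- A one parameter family of rational maps with a marked critical point
`c_t = [critX t : critY t]`, that is a holomorphic function of `t`, with values in the projective
line. -/
structure MarkedFamily extends RatFamily p where
  critX : ℂ_[p] → ℂ_[p]
  critY : ℂ_[p] → ℂ_[p]
  holomorphic_critX : HolomorphicOnBall critX B
  holomorphic_critY : HolomorphicOnBall critY B
  crit_ne : ∀ t ∈ B, critX t ≠ 0 ∨ critY t ≠ 0
  isCritical : ∀ t ∈ B, IsCriticalPt (toRatFamily.map t) (ofHomogeneous (critX t) (critY t))

namespace MarkedFamily

/-- The marked critical point `c_t`. -/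
def crit (R : MarkedFamily p) (t : ℂ_[p]) : OnePoint ℂ_[p] :=
  ofHomogeneous (R.critX t) (R.critY t)

/-- The family and its marked critical point are defined over `K`. -/
def DefinedOver (R : MarkedFamily p) (K : IntermediateField ℚ_[p] ℂ_[p]) : Prop :=
  (∀ i, HolomorphicOnBallOver K (R.numCoeff i) R.B) ∧
  (∀ i, HolomorphicOnBallOver K (R.denCoeff i) R.B) ∧
  HolomorphicOnBallOver K R.critX R.B ∧ HolomorphicOnBallOver K R.critY R.B

/-- `(R, c)` has a Misiurewicz bifurcation at the parameter `t₀`. -/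
def HasMisiurewiczBifurcation (R : MarkedFamily p) (t₀ : ℂ_[p]) : Prop :=
  t₀ ∈ R.B ∧
  ∃ ℓ : ℕ, 1 ≤ ℓ ∧
    IsRepellingFixedPt (R.map t₀) ((R.map t₀)^[ℓ] (R.crit t₀)) ∧
    IsUnramified (R.map t₀) (R.crit t₀) ∧
    (∃ t ∈ R.B, R.map t ((R.map t)^[ℓ] (R.crit t)) ≠ (R.map t)^[ℓ] (R.crit t)) ∧
    ∃ d : ℕ, ∀ᶠ t in 𝓝 t₀, localDegree (R.map t)^[ℓ] (R.crit t) = d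

/-- The least `ℓ ≥ 1` such that `R_t^ℓ(c_t)` is a repelling fixed point of `R_t` (it exists
whenever there is a Misiurewicz bifurcation at `t`). -/
def landingTime (R : MarkedFamily p) (t : ℂ_[p]) : ℕ :=
  sInf {ℓ : ℕ | 1 ≤ ℓ ∧ IsRepellingFixedPt (R.map t) ((R.map t)^[ℓ] (R.crit t))}

/-- The repelling fixed point on which the critical point lands. -/
def landingPt (R : MarkedFamily p) (t : ℂ_[p]) : OnePoint ℂ_[p] :=
  (R.map t)^[R.landingTime t] (R.crit t)

/-- In the coordinate at the fixed point `a₀` of `R_{t₀}`, the function `a` is the holomorphic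
continuation of `a₀` as a fixed point of `R_t`, for `t` close to `t₀`. -/
def IsContinuation (R : MarkedFamily p) (t₀ : ℂ_[p]) (a₀ : OnePoint ℂ_[p])
    (a : ℂ_[p] → ℂ_[p]) : Prop :=
  AnalyticAt ℂ_[p] a t₀ ∧ a t₀ = coord a₀ a₀ ∧
    ∀ᶠ t in 𝓝 t₀, R.map t (param a₀ (a t)) = param a₀ (a t)

/-- The function `t ↦ R_t^ℓ(c_t) - a_t` near `t₀`, in the coordinate at `a_{t₀}`, where `ℓ` is the
landing time at `t₀`. -/
def gap (R : MarkedFamily p) (t₀ : ℂ_[p]) (a : ℂ_[p] → ℂ_[p]) (t : ℂ_[p]) : ℂ_[p] :=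
  coord (R.landingPt t₀) ((R.map t)^[R.landingTime t₀] (R.crit t)) - a t

/-- `(R, c)` has a transversal Misiurewicz bifurcation at `t₀`. -/
def HasTransversalMisiurewiczBifurcation (R : MarkedFamily p) (t₀ : ℂ_[p]) : Prop :=
  R.HasMisiurewiczBifurcation t₀ ∧
  ∃ a, R.IsContinuation t₀ (R.landingPt t₀) a ∧ deriv (R.gap t₀ a) t₀ ≠ 0

/-- `z` is a `K`-admissible homoclinic orbit of `(R, c)` at the parameter `t₀`. The numbers
`ζ`, `d`, `ρ`, `d'`, `ρ'` are the asymptotic position of `z` and the exponents and coefficients of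
`R_{t₀}^ℓ(w) = a_{t₀} + ρ (w - c_{t₀}) ^ d + …` and
`R_t^ℓ(c_t) - a_t = ρ' (t - t₀) ^ d' + …`; all of them are uniquely determined. -/
def IsAdmissibleHomoclinic (R : MarkedFamily p) (K : IntermediateField ℚ_[p] ℂ_[p])
    (t₀ : ℂ_[p]) (z : ℤ → OnePoint ℂ_[p]) : Prop :=
  IsCriticalHomoclinic (R.map t₀) (R.landingPt t₀) (R.crit t₀) z ∧
  (∀ i, z i = OnePoint.infty ∨ ∃ x ∈ K, z i = OnePoint.some x) ∧
  ∃ (ζ ρ ρ' : ℂ_[p]) (d d' : ℕ) (a : ℂ_[p] → ℂ_[p]),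
    IsAsymptoticPosition (R.map t₀) (R.landingPt t₀) z ζ ∧
    HasLeadingTerm
      (fun u => chartMap (R.map t₀)^[R.landingTime t₀] (R.crit t₀) u
        - coord (R.landingPt t₀) (R.landingPt t₀))
      (coord (R.crit t₀) (R.crit t₀)) d ρ ∧
    R.IsContinuation t₀ (R.landingPt t₀) a ∧
    HasLeadingTerm (R.gap t₀ a) t₀ d' ρ' ∧
    ∃ m₀ : ℤ,
      (∃ x ∈ K, x ^ d = -(multiplier (R.map t₀) (R.landingPt t₀) ^ m₀ * ζ / ρ)) ∧
      (∃ y ∈ K, y ^ d' = multiplier (R.map t₀) (R.landingPt t₀) ^ m₀ * ζ / ρ')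

end MarkedFamily

end Families

end MisBif

end

/-!
The bifurcation is studied in coordinates centred at the fixed point `a_t` and at the critical
point `c_t`. There `R_t ^ ℓ` maps the point with coordinate `v` near `c_t` to the point near `a_t`
with coordinate `Λ_t(v) = t ^ d' * G(t) + v ^ d * E(t, v)`, where `G(0) = ρ'` and `E(0, 0) = ρ`.
The homoclinic orbit persists: for `i` large there is an inverse branch `S_i(t, v)` of `R_t ^ i`,
defined for all small `t` and `v`, with `S_i(t, v) ≈ λ ^ (-i) ζ`. Here `≈` means that the quotient
is close to `1`. Since the norm is ultrametric, such relative errors do not accumulate in products,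
so the estimates are uniform in `i`; this is what makes the argument work. These data form a
`LocalModel`, and a `DynamicalModel` when their relation to the maps `R_t` is included. They are
obtained from the hypotheses in `exists_dynamicalModel_of_homoclinic`.

The new parameters are those at which the critical point follows the homoclinic orbit back to a
neighbourhood of itself `d` times before it lands on the fixed point. If `ω_{d-1}, …, ω_0` are the
coordinates of these returns, this means
`Λ_t(0) = S_n(t, ω_{d-1})`, `Λ_t(ω_{j+1}) = S_{2n}(t, ω_j)`, `Λ_t(ω_0) = 0`.
To leading order the equations are
`t ^ d' = λ ^ (-n) ζ / ρ'`, `ω_j ^ d = -λ ^ (-n) ζ / ρ`.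
For `n = r d d' - m₀`, admissibility says that these have solutions in `K`. A form of Hensel's
lemma (`exists_eq_of_relClose`) turns them into exact solutions in `K`, as close to `0` as desired
(`LocalModel.nonempty_solution`).

At such a parameter, if `ω_{d-1}` is the function of `t` determined by all equations but the first
one, then `Λ_t(0) - S_n(t, ω_{d-1}(t))` grows linearly with the distance to the parameter, which
gives transversality (`LocalModel.Solution.exists_landing_curve`), so that the new exponent `d'` is
`1` and the second condition of admissibility is void. The returns take place at points close to,
but different from, the critical point, so that the exponent `d` does not change, and the new
leading coefficient is, up to a factor close to `1`, the old one multiplied by the derivatives of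
the `d` passages from one return to the next (`LocalModel.Solution.exists_hasLeadingTerm`). These
derivatives are all equal up to powers of the multiplier and factors close to `1`, and there are
`d` of them; hence they contribute a `d`-th power, and the first condition of admissibility
persists (`LocalModel.Solution.exists_pow_eq`). The homoclinic orbit at the new parameter is the
continuation of the old one. Finally, the first return is at time `n + ℓ` and at a distance of
order `|ω_{d-1}|` from the critical point, which tends to `0`.

Local degrees are handled through the metric notion `HasDeg`, which does not refer to coordinates
and is therefore multiplicative under composition without further ado.
-/

set_option linter.unusedSectionVars false

namespace MisBif

/-! ### Relative distance and Hensel's lemma -/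

section Ultrametric

variable {F : Type*} [NontriviallyNormedField F] [IsUltrametricDist F]

theorem norm_add_le_of_le_of_le {x y : F} {C : ℝ} (hx : ‖x‖ ≤ C) (hy : ‖y‖ ≤ C) : ‖x + y‖ ≤ C :=
  (IsUltrametricDist.norm_add_le_max x y).trans (max_le hx hy)

theorem norm_sub_le_of_le_of_le {x y : F} {C : ℝ} (hx : ‖x‖ ≤ C) (hy : ‖y‖ ≤ C) : ‖x - y‖ ≤ C := by
  rw [sub_eq_add_neg]
  exact norm_add_le_of_le_of_le hx (by rwa [norm_neg])

theorem norm_sub_le_of_triangle {x y z : F} {C : ℝ} (hx : ‖x - y‖ ≤ C) (hy : ‖y - z‖ ≤ C) :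
    ‖x - z‖ ≤ C := by
  rw [← sub_add_sub_cancel x y z]
  exact norm_add_le_of_le_of_le hx hy

/-- `x` is close to `y` with relative error at most `ε`. For `ε < 1` this is an equivalence relation
compatible with products: for nonzero `x` and `y` it says that `x / y` lies in the multiplicative
group `{u | ‖u - 1‖ ≤ ε}`. -/
def RelClose (ε : ℝ) (x y : F) : Prop := ‖x - y‖ ≤ ε * ‖y‖

namespace RelClose

variable {ε : ℝ} {x y z x' y' : F}

theorem refl (hε : 0 ≤ ε) (x : F) : RelClose ε x x := by
  simp only [RelClose, sub_self, norm_zero]; positivity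

theorem mono {ε' : ℝ} (h : RelClose ε x y) (hε : ε ≤ ε') : RelClose ε' x y :=
  h.trans (mul_le_mul_of_nonneg_right hε (norm_nonneg _))

theorem norm_eq (h : RelClose ε x y) (hε : ε < 1) : ‖x‖ = ‖y‖ := by
  unfold RelClose at h
  by_cases hy : y = 0
  · subst hy; simpa using h
  · have hlt : ‖x - y‖ < ‖y‖ := by
      have : 0 < ‖y‖ := norm_pos_iff.mpr hy
      nlinarith
    have h2 := IsUltrametricDist.norm_add_eq_max_of_norm_ne_norm hlt.ne
    rw [sub_add_cancel] at h2
    rw [h2, max_eq_right hlt.le]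

theorem ne_zero (h : RelClose ε x y) (hε : ε < 1) (hy : y ≠ 0) : x ≠ 0 := by
  rw [← norm_pos_iff, h.norm_eq hε]; exact norm_pos_iff.mpr hy

theorem symm (h : RelClose ε x y) (hε : ε < 1) : RelClose ε y x := by
  have := h.norm_eq hε
  unfold RelClose at *
  rwa [norm_sub_rev, this]

theorem trans (h : RelClose ε x y) (h' : RelClose ε y z) (hε : ε < 1) : RelClose ε x z := by
  refine norm_sub_le_of_triangle (y := y) ?_ h'
  have := h'.norm_eq hε
  unfold RelClose at h
  rwa [← this]

theorem mul (h : RelClose ε x y) (h' : RelClose ε x' y') (hε : ε < 1) :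
    RelClose ε (x * x') (y * y') := by
  have h1 := h.norm_eq hε
  unfold RelClose at *
  have : x * x' - y * y' = x * (x' - y') + (x - y) * y' := by ring
  rw [this, norm_mul]
  apply norm_add_le_of_le_of_le
  · rw [norm_mul, h1]
    nlinarith [norm_nonneg y]
  · rw [norm_mul]
    nlinarith [norm_nonneg y']

theorem mul_left (h : RelClose ε x y) (c : F) : RelClose ε (c * x) (c * y) := by
  unfold RelClose at *
  rw [← mul_sub, norm_mul, norm_mul]
  nlinarith [norm_nonneg c]

theorem neg (h : RelClose ε x y) : RelClose ε (-x) (-y) := by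
  simpa using h.mul_left (-1)

theorem inv (h : RelClose ε x y) (hε : ε < 1) : RelClose ε x⁻¹ y⁻¹ := by
  by_cases hy : y = 0
  · subst hy
    have := h.norm_eq hε
    rw [norm_zero, norm_eq_zero] at this
    subst this
    simp [RelClose]
  have hx := h.ne_zero hε hy
  have h2 := (h.symm hε).mul_left (x⁻¹ * y⁻¹)
  rwa [mul_assoc, inv_mul_cancel₀ hy, mul_one, mul_right_comm, inv_mul_cancel₀ hx, one_mul] at h2

theorem div (h : RelClose ε x y) (h' : RelClose ε x' y') (hε : ε < 1) :
    RelClose ε (x / x') (y / y') := by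
  rw [div_eq_mul_inv, div_eq_mul_inv]
  exact h.mul (h'.inv hε) hε

theorem pow (h : RelClose ε x y) (hε₀ : 0 ≤ ε) (hε : ε < 1) (n : ℕ) :
    RelClose ε (x ^ n) (y ^ n) := by
  induction n with
  | zero => simpa using refl hε₀ (1 : F)
  | succ n ih => rw [pow_succ, pow_succ]; exact ih.mul h hε

theorem of_frequently {ι : Type*} {l : Filter ι} {f : ι → F} (hf : Tendsto f l (𝓝 x))
    (h : ∃ᶠ i in l, RelClose ε (f i) y) : RelClose ε x y := by
  have hc : IsClosed {w : F | RelClose ε w y} :=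
    isClosed_le (by fun_prop) continuous_const
  have hfr : ∃ᶠ w in 𝓝 x, RelClose ε w y := hf.frequently h
  exact hc.mem_of_frequently_of_tendsto hfr tendsto_id

theorem one_add_iff {s : F} : RelClose ε (1 + s) 1 ↔ ‖s‖ ≤ ε := by simp [RelClose]

theorem div_right_iff (hy : y ≠ 0) : RelClose ε (x / y) 1 ↔ RelClose ε x y := by
  constructor
  · intro h
    have := h.mul_left y
    rwa [mul_div_cancel₀ _ hy, mul_one] at this
  · intro h
    have := h.mul_left y⁻¹
    rwa [inv_mul_cancel₀ hy, mul_comm, ← div_eq_mul_inv] at this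

end RelClose

/-- Near `1`, the difference quotients of the `d`-th power are close to `d`. -/
theorem norm_one_add_pow_sub_le {s s' : F} {r : ℝ} (hr : r < 1) (hs : ‖s‖ ≤ r) (hs' : ‖s'‖ ≤ r)
    (d : ℕ) : ‖(1 + s) ^ d - (1 + s') ^ d - d * (s - s')‖ ≤ r * ‖s - s'‖ := by
  have hr0 : 0 ≤ r := (norm_nonneg s).trans hs
  have h1 : (1 + s) ^ d - (1 + s') ^ d - d * (s - s')
      = (∑ i ∈ Finset.range d, ((1 + s) ^ i * (1 + s') ^ (d - 1 - i) - 1)) * (s - s') := by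
    have := geom_sum₂_mul (1 + s) (1 + s') d
    rw [Finset.sum_sub_distrib, sub_mul, Finset.sum_const, Finset.card_range, nsmul_eq_mul, mul_one]
    rw [← this]; ring
  rw [h1, norm_mul]
  gcongr
  refine IsUltrametricDist.norm_sum_le_of_forall_le_of_nonneg hr0 fun i _ => ?_
  have h2 := ((RelClose.one_add_iff.mpr hs).pow hr0 hr i).mul
    ((RelClose.one_add_iff.mpr hs').pow hr0 hr (d - 1 - i)) hr
  simpa [RelClose] using h2

variable [CompleteSpace F]

/-- Hensel's lemma, in the form of an inverse function theorem in a closed subfield `K`: a function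
whose difference quotients are all close to `α` maps the ball of radius `r` onto the ball of radius
`‖α‖ * r`. The points of `K` are reached from points of `K`. -/
theorem exists_eq_of_relClose {K : Subfield F} (hK : IsClosed (K : Set F)) {φ : F → F}
    {x₀ α y : F} {r θ : ℝ} (hθ : θ < 1) (hα : α ≠ 0) (hαK : α ∈ K) (hx₀ : x₀ ∈ K)
    (hφK : ∀ x ∈ K, ‖x - x₀‖ ≤ r → φ x ∈ K)
    (hφ : ∀ x ∈ K, ∀ x' ∈ K, ‖x - x₀‖ ≤ r → ‖x' - x₀‖ ≤ r →
      RelClose θ (φ x - φ x') (α * (x - x')))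
    (hy : y ∈ K) (hyr : ‖y - φ x₀‖ ≤ ‖α‖ * r) :
    ∃ x ∈ K, ‖x - x₀‖ ≤ r ∧ φ x = y := by
  have hα' : 0 < ‖α‖ := norm_pos_iff.mpr hα
  have hr : 0 ≤ r := by
    by_contra h
    have := (norm_nonneg _).trans hyr
    nlinarith
  set T : F → F := fun x => x - (φ x - y) / α with hT
  let s : Set F := {x | x ∈ K ∧ ‖x - x₀‖ ≤ r}
  have hs : IsClosed s :=
    hK.inter (isClosed_le (continuous_id.sub continuous_const).norm continuous_const)
  have hx₀s : x₀ ∈ s := ⟨hx₀, by simpa using hr⟩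
  have hmaps : Set.MapsTo T s s := by
    rintro x ⟨hxK, hxr⟩
    refine ⟨sub_mem hxK (div_mem (sub_mem (hφK x hxK hxr) hy) hαK), ?_⟩
    have h1 : ‖φ x - y‖ ≤ ‖α‖ * r := by
      refine norm_sub_le_of_triangle (y := φ x₀) ?_ (by rwa [norm_sub_rev])
      rw [(hφ x hxK x₀ hx₀ hxr hx₀s.2).norm_eq hθ, norm_mul]
      gcongr
    have : T x - x₀ = (x - x₀) - (φ x - y) / α := by simp only [hT]; ring
    rw [this]
    refine norm_sub_le_of_le_of_le hxr ?_
    rw [norm_div, div_le_iff₀ hα', mul_comm]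
    exact h1
  have hcontr : ∀ x ∈ s, ∀ x' ∈ s, ‖T x - T x'‖ ≤ θ * ‖x - x'‖ := by
    rintro x ⟨hxK, hxr⟩ x' ⟨hxK', hxr'⟩
    have h1 := hφ x hxK x' hxK' hxr hxr'
    have : T x - T x' = -((φ x - φ x' - α * (x - x')) / α) := by
      simp only [hT]; field_simp; ring
    rw [this, norm_neg, norm_div, div_le_iff₀ hα']
    refine (le_of_le_of_eq h1 ?_)
    rw [norm_mul]; ring
  have hcw : ContractingWith (Real.toNNReal θ) (hmaps.restrict T s s) := by
    refine ⟨by rw [← NNReal.coe_lt_coe, Real.coe_toNNReal']; simpa using hθ,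
      LipschitzWith.of_dist_le_mul fun x x' => ?_⟩
    rw [Subtype.dist_eq, Subtype.dist_eq, dist_eq_norm, dist_eq_norm]
    refine (hcontr x x.2 x' x'.2).trans ?_
    gcongr
    exact Real.le_coe_toNNReal θ
  obtain ⟨x, hxs, hfix, -⟩ := hcw.exists_fixedPoint' hs.isComplete hmaps hx₀s (edist_ne_top _ _)
  refine ⟨x, hxs.1, hxs.2, ?_⟩
  have h2 : (φ x - y) / α = 0 := by
    have : T x = x := hfix
    simpa [hT] using this
  rw [div_eq_zero_iff, or_iff_left hα, sub_eq_zero] at h2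
  exact h2

/-- Elements of `K` close enough to `1` have a `d`-th root in `K`. -/
theorem exists_pow_eq_of_relClose_one {K : Subfield F} (hK : IsClosed (K : Set F)) {d : ℕ}
    {ε : ℝ} (hd : (d : F) ≠ 0) (hε : ε ≤ ‖(d : F)‖ ^ 2 / 2) {y : F} (hy : y ∈ K)
    (h : RelClose ε y 1) : ∃ x ∈ K, x ^ d = y := by
  have hd0 : 0 < ‖(d : F)‖ := norm_pos_iff.mpr hd
  have hd1 : ‖(d : F)‖ ≤ 1 := IsUltrametricDist.norm_natCast_le_one F d
  have H : ∃ x ∈ K, ‖x - 0‖ ≤ ‖(d : F)‖ / 2 ∧ (1 + x) ^ d = y := by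
    refine exists_eq_of_relClose hK (φ := fun s => (1 + s) ^ d) (α := d) (θ := 1 / 2) (by norm_num)
      hd (natCast_mem K d) (zero_mem K)
      (fun x hx _ => pow_mem (add_mem (one_mem K) hx) d) ?_ hy ?_
    · intro x _ x' _ hxr hxr'
      rw [sub_zero] at hxr hxr'
      have := norm_one_add_pow_sub_le (by linarith) hxr hxr' d
      refine this.trans (le_of_eq ?_)
      rw [norm_mul]; ring
    · simp only [add_zero, one_pow]
      refine le_trans h ?_
      rw [norm_one, mul_one]
      refine hε.trans (le_of_eq ?_)
      ring
  obtain ⟨x, hxK, -, hx⟩ := H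
  exact ⟨1 + x, add_mem (one_mem K) hxK, hx⟩

end Ultrametric

/-! ### Perturbed power equations -/

section Solve

variable {F : Type*} [NontriviallyNormedField F] [IsUltrametricDist F]

/-- The difference quotients of the `d`-th power remain close to `d` if the power is multiplied by a
factor `1 + e x` with `e` small and with a small Lipschitz constant. -/
theorem norm_perturbed_pow_sub_le {e : F → F} {x x' : F} {κ r : ℝ} (hr : r < 1) (hκ : κ ≤ r)
    (hx : ‖x‖ ≤ r) (hx' : ‖x'‖ ≤ r) (he : ‖e x‖ ≤ κ)
    (hee : ‖e x - e x'‖ ≤ κ * ‖x - x'‖) (d : ℕ) :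
    ‖(1 + x) ^ d * (1 + e x) - (1 + x') ^ d * (1 + e x') - d * (x - x')‖ ≤ r * ‖x - x'‖ := by
  have hr0 : 0 ≤ r := (norm_nonneg x).trans hx
  have hκ0 : 0 ≤ κ := (norm_nonneg _).trans he
  have h1 := norm_one_add_pow_sub_le hr hx hx' d
  have hd1 : ‖(d : F)‖ ≤ 1 := IsUltrametricDist.norm_natCast_le_one F d
  have heq : (1 + x) ^ d * (1 + e x) - (1 + x') ^ d * (1 + e x') - d * (x - x')
      = ((1 + x) ^ d - (1 + x') ^ d - d * (x - x')) * (1 + e x) + d * (x - x') * e x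
        + (1 + x') ^ d * (e x - e x') := by ring
  have h3 : ‖(1 : F) + e x‖ ≤ 1 := by
    have : ‖e x‖ ≤ 1 := by linarith
    exact norm_add_le_of_le_of_le (by simp) this
  have h4 : ‖(1 + x') ^ d‖ = 1 := by
    have := ((RelClose.one_add_iff.mpr hx').pow hr0 hr d).norm_eq hr
    simpa using this
  have hxx := norm_nonneg (x - x')
  rw [heq]
  refine norm_add_le_of_le_of_le (norm_add_le_of_le_of_le ?_ ?_) ?_
  · rw [norm_mul]
    nlinarith [norm_nonneg ((1 + x) ^ d - (1 + x') ^ d - d * (x - x'))]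
  · rw [norm_mul, norm_mul]
    have : ‖(d : F)‖ * ‖x - x'‖ ≤ ‖x - x'‖ := by nlinarith
    calc ‖(d : F)‖ * ‖x - x'‖ * ‖e x‖ ≤ ‖x - x'‖ * κ := by gcongr
      _ ≤ r * ‖x - x'‖ := by nlinarith
  · rw [norm_mul, h4, one_mul]
    nlinarith

/-- Functions on `D` with values in the ball of radius `r` of `K`, with Lipschitz constant `C`. -/
structure LipOn (K : Subfield F) (D : Set F) (r C : ℝ) (X : F → F) : Prop where
  mem : ∀ s ∈ D, X s ∈ K
  norm_le : ∀ s ∈ D, ‖X s‖ ≤ r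
  lip : ∀ s ∈ D, ∀ s' ∈ D, ‖X s - X s'‖ ≤ C * ‖s - s'‖

/-- Functions of two variables `s ∈ D` and `x ∈ K`, `‖x‖ ≤ r`, with values in `K`, bounded by `κ'`
and separately Lipschitz with constant `κ`. -/
structure LipOn₂ (K : Subfield F) (D : Set F) (r κ' κ : ℝ) (e : F → F → F) : Prop where
  mem : ∀ s ∈ D, ∀ x ∈ K, ‖x‖ ≤ r → e s x ∈ K
  norm_le : ∀ s ∈ D, ∀ x ∈ K, ‖x‖ ≤ r → ‖e s x‖ ≤ κ'
  lip : ∀ s ∈ D, ∀ x ∈ K, ∀ x' ∈ K, ‖x‖ ≤ r → ‖x'‖ ≤ r → ‖e s x - e s x'‖ ≤ κ * ‖x - x'‖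
  lip' : ∀ s ∈ D, ∀ s' ∈ D, ∀ x ∈ K, ‖x‖ ≤ r → ‖e s x - e s' x‖ ≤ κ * ‖s - s'‖

variable {K : Subfield F} {D : Set F} {r r' κ κ' C : ℝ} {d d' : ℕ}

theorem LipOn₂.comp_norm_le {e : F → F → F} {X : F → F} (he : LipOn₂ K D r κ' κ e)
    (hX : LipOn K D r C X) (hκ : 0 ≤ κ) {s s' : F} (hs : s ∈ D) (hs' : s' ∈ D) :
    ‖e s (X s) - e s' (X s')‖ ≤ κ * max 1 C * ‖s - s'‖ := by
  have h0 := norm_nonneg (s - s')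
  refine norm_sub_le_of_triangle (y := e s (X s')) ?_ ?_
  · refine (he.lip s hs _ (hX.mem s hs) _ (hX.mem s' hs') (hX.norm_le s hs)
      (hX.norm_le s' hs')).trans ?_
    rw [mul_assoc]
    refine mul_le_mul_of_nonneg_left ((hX.lip s hs s' hs').trans ?_) hκ
    gcongr
    exact le_max_right _ _
  · refine (he.lip' s hs s' hs' _ (hX.mem s' hs') (hX.norm_le s' hs')).trans ?_
    have := le_max_left 1 C
    gcongr
    nlinarith

variable [CompleteSpace F]

/-- The equation `(1 + x) ^ d * (1 + e s x) = τ s` has a solution `x` depending on `s` in a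
Lipschitz way, when `e` is small and `τ` is close to `1`. -/
theorem exists_lipOn_perturbed_pow_eq (hK : IsClosed (K : Set F))
    (hd : (d : F) ≠ 0) (hr : 0 < r) (hr2 : r ≤ ‖(d : F)‖ / 2) (hκ : κ ≤ ‖(d : F)‖ * r)
    {e : F → F → F} (he : LipOn₂ K D r κ κ e) {τ : F → F} (hτK : ∀ s ∈ D, τ s ∈ K)
    (hτ1 : ∀ s ∈ D, ‖τ s - 1‖ ≤ ‖(d : F)‖ * r)
    (hτ : ∀ s ∈ D, ∀ s' ∈ D, ‖τ s - τ s'‖ ≤ ‖s - s'‖) :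
    ∃ X : F → F, LipOn K D r ‖(d : F)‖⁻¹ X ∧
      ∀ s ∈ D, (1 + X s) ^ d * (1 + e s (X s)) = τ s := by
  have hd0 : 0 < ‖(d : F)‖ := norm_pos_iff.mpr hd
  have hd1 : ‖(d : F)‖ ≤ 1 := IsUltrametricDist.norm_natCast_le_one F d
  have hκr : κ ≤ r := by nlinarith
  have hr1 : r < 1 := by linarith
  have hclose : ∀ s ∈ D, ∀ x ∈ K, ∀ x' ∈ K, ‖x‖ ≤ r → ‖x'‖ ≤ r →
      RelClose (1 / 2) ((1 + x) ^ d * (1 + e s x) - (1 + x') ^ d * (1 + e s x'))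
        (d * (x - x')) := by
    intro s hs x hx x' hx' hxr hxr'
    refine (norm_perturbed_pow_sub_le hr1 hκr hxr hxr' (he.norm_le s hs x hx hxr)
      (he.lip s hs x hx x' hx' hxr hxr') d).trans ?_
    rw [norm_mul, ← mul_assoc]
    gcongr
    linarith
  have hex : ∀ s ∈ D, ∃ x ∈ K, ‖x - 0‖ ≤ r ∧ (1 + x) ^ d * (1 + e s x) = τ s := by
    intro s hs
    refine exists_eq_of_relClose hK (φ := fun x => (1 + x) ^ d * (1 + e s x)) (α := d)
      (θ := 1 / 2) (by norm_num) hd (natCast_mem K d) (zero_mem K) ?_ ?_ (hτK s hs) ?_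
    · intro x hx hxr
      rw [sub_zero] at hxr
      exact mul_mem (pow_mem (add_mem (one_mem K) hx) d)
        (add_mem (one_mem K) (he.mem s hs x hx hxr))
    · intro x hx x' hx' hxr hxr'
      rw [sub_zero] at hxr hxr'
      exact hclose s hs x hx x' hx' hxr hxr'
    · simp only [add_zero, one_pow, one_mul]
      have := he.norm_le s hs 0 (zero_mem K) (by simpa using hr.le)
      rw [← sub_sub]
      exact norm_sub_le_of_le_of_le (hτ1 s hs) (this.trans hκ)
  choose! X hXK hXr hX using hex
  simp only [sub_zero] at hXr
  refine ⟨X, ⟨hXK, hXr, fun s hs s' hs' => ?_⟩, hX⟩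
  have h1 := hclose s hs _ (hXK s hs) _ (hXK s' hs') (hXr s hs) (hXr s' hs')
  have h2 := h1.norm_eq (by norm_num)
  rw [norm_mul] at h2
  rw [inv_mul_eq_div, le_div_iff₀ hd0, mul_comm, ← h2, hX s hs]
  refine norm_sub_le_of_triangle (y := τ s') (hτ s hs s' hs') ?_
  rw [← hX s' hs']
  have h3 : (1 + X s') ^ d * (1 + e s' (X s')) - (1 + X s') ^ d * (1 + e s (X s'))
      = (1 + X s') ^ d * (e s' (X s') - e s (X s')) := by ring
  have h4 : ‖(1 + X s') ^ d‖ = 1 := by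
    have := ((RelClose.one_add_iff.mpr (hXr s' hs')).pow hr.le hr1 d).norm_eq hr1
    simpa using this
  rw [h3, norm_mul, h4, one_mul, norm_sub_rev]
  refine (he.lip' s hs s' hs' _ (hXK s' hs') (hXr s' hs')).trans ?_
  nlinarith [norm_nonneg (s - s')]

/-- The `d`-th power equations of the returns, solved one after the other: the right hand side of
each of them depends on the solution of the preceding one through the small term `σ`. All solutions
are Lipschitz functions of the parameter `s`, with the same constant. -/
theorem exists_seq_lipOn_perturbed_pow_eq (hK : IsClosed (K : Set F))
    (hd : (d : F) ≠ 0) (hr : 0 < r) (hr2 : r ≤ ‖(d : F)‖ / 2) (hκ0 : 0 ≤ κ)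
    (hκ : κ ≤ ‖(d : F)‖ * r)
    {e σ : F → F → F} (he : LipOn₂ K D r κ κ e) (hσ : LipOn₂ K D r κ κ σ) {g : F → F}
    (hgK : ∀ s ∈ D, g s ∈ K) (hg1 : ∀ s ∈ D, ‖g s - 1‖ ≤ ‖(d : F)‖ * r)
    (hg : ∀ s ∈ D, ∀ s' ∈ D, ‖g s - g s'‖ ≤ ‖s - s'‖) :
    ∃ X : ℕ → F → F, (∀ j, LipOn K D r ‖(d : F)‖⁻¹ (X j)) ∧
      (∀ s ∈ D, (1 + X 0 s) ^ d * (1 + e s (X 0 s)) = g s) ∧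
      ∀ j, ∀ s ∈ D, (1 + X (j + 1) s) ^ d * (1 + e s (X (j + 1) s)) = g s - σ s (X j s) := by
  have hd0 : 0 < ‖(d : F)‖ := norm_pos_iff.mpr hd
  have hd1 : ‖(d : F)‖ ≤ 1 := IsUltrametricDist.norm_natCast_le_one F d
  obtain ⟨X₀, hX₀, hX₀eq⟩ := exists_lipOn_perturbed_pow_eq hK hd hr hr2 hκ he hgK hg1 hg
  have hstep : ∀ X, LipOn K D r ‖(d : F)‖⁻¹ X → ∃ Y, LipOn K D r ‖(d : F)‖⁻¹ Y ∧
      ∀ s ∈ D, (1 + Y s) ^ d * (1 + e s (Y s)) = g s - σ s (X s) := by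
    intro X hX
    refine exists_lipOn_perturbed_pow_eq hK hd hr hr2 hκ he
      (τ := fun s => g s - σ s (X s)) ?_ ?_ ?_
    · exact fun s hs => sub_mem (hgK s hs) (hσ.mem s hs _ (hX.mem s hs) (hX.norm_le s hs))
    · intro s hs
      rw [sub_right_comm]
      exact norm_sub_le_of_le_of_le (hg1 s hs)
        ((hσ.norm_le s hs _ (hX.mem s hs) (hX.norm_le s hs)).trans hκ)
    · intro s hs s' hs'
      rw [sub_sub_sub_comm]
      refine norm_sub_le_of_le_of_le (hg s hs s' hs') ?_
      refine (hσ.comp_norm_le hX hκ0 hs hs').trans ?_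
      rw [max_eq_right (one_le_inv_iff₀.mpr ⟨hd0, hd1⟩)]
      refine mul_le_of_le_one_left (norm_nonneg _) ?_
      rw [← div_eq_mul_inv, div_le_one hd0]
      nlinarith
  choose! next hnext hnexteq using hstep
  let X : ℕ → F → F := fun j => Nat.rec X₀ (fun _ Y => next Y) j
  have hX : ∀ j, LipOn K D r ‖(d : F)‖⁻¹ (X j) := by
    intro j
    induction j with
    | zero => exact hX₀
    | succ j ih => exact hnext _ ih
  exact ⟨X, hX, hX₀eq, fun j => hnexteq _ (hX j)⟩

/-- The normalized form of the equations satisfied by the parameter and the returns. The unknowns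
are `s`, where `t = t₀ * (1 + s)`, and `X j`, where `ω j = v₀ * (1 + X j)`, with `t₀` and `v₀` the
solutions of the equations without error terms. The system is triangular: all `X j` are functions of
`s`, and the last equation, whose difference quotients with respect to `s` are close to `d'`,
determines `s`. -/
theorem exists_seq_and_parameter (hK : IsClosed (K : Set F))
    (hd : (d : F) ≠ 0) (hd' : (d' : F) ≠ 0) (hr : 0 < r) (hr2 : r ≤ ‖(d : F)‖ / 2) (hκ0 : 0 ≤ κ)
    (hr0' : 0 < r') (hr'1 : r' ≤ ‖(d' : F)‖ / 2) (hr'2 : r' ≤ ‖(d : F)‖ * r)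
    (hκ : κ ≤ ‖(d : F)‖ * r) (hκr' : κ ≤ ‖(d' : F)‖ * r') (hκ' : κ ≤ ‖(d : F)‖ * ‖(d' : F)‖ / 2)
    {e σ σ₀ : F → F → F} {e₁ : F → F} (hDef : D = {s | s ∈ K ∧ ‖s‖ ≤ r'})
    (he : LipOn₂ K D r κ κ e) (hσ : LipOn₂ K D r κ κ σ)
    (hσ₀ : LipOn₂ K D r (‖(d' : F)‖ * r') κ σ₀) (he₁ : LipOn K D κ κ e₁) (J : ℕ) :
    ∃ X : ℕ → F → F, (∀ j, LipOn K D r ‖(d : F)‖⁻¹ (X j)) ∧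
      (∀ s ∈ D, (1 + X 0 s) ^ d * (1 + e s (X 0 s)) = (1 + s) ^ d' * (1 + e₁ s)) ∧
      (∀ j, ∀ s ∈ D, (1 + X (j + 1) s) ^ d * (1 + e s (X (j + 1) s)) =
        (1 + s) ^ d' * (1 + e₁ s) - σ s (X j s)) ∧
      (∀ s ∈ D, ∀ s' ∈ D, RelClose (1 / 2)
        (((1 + s) ^ d' * (1 + e₁ s) - σ₀ s (X J s))
          - ((1 + s') ^ d' * (1 + e₁ s') - σ₀ s' (X J s'))) (d' * (s - s'))) ∧
      ∃ s ∈ D, (1 + s) ^ d' * (1 + e₁ s) - σ₀ s (X J s) = 1 := by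
  have hd0 : 0 < ‖(d : F)‖ := norm_pos_iff.mpr hd
  have hd1 : ‖(d : F)‖ ≤ 1 := IsUltrametricDist.norm_natCast_le_one F d
  have hd0' : 0 < ‖(d' : F)‖ := norm_pos_iff.mpr hd'
  have hd1' : ‖(d' : F)‖ ≤ 1 := IsUltrametricDist.norm_natCast_le_one F d'
  have hr'lt : r' < 1 := by linarith
  have hκr'' : κ ≤ r' := by nlinarith
  have hDK : D ⊆ K := by subst hDef; exact fun s hs => hs.1
  have hDr : ∀ s ∈ D, ‖s‖ ≤ r' := by subst hDef; exact fun s hs => hs.2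
  have hdiff : ∀ s ∈ D, ∀ s' ∈ D,
      ‖(1 + s) ^ d' * (1 + e₁ s) - (1 + s') ^ d' * (1 + e₁ s') - d' * (s - s')‖
        ≤ r' * ‖s - s'‖ := fun s hs s' hs' =>
    norm_perturbed_pow_sub_le hr'lt hκr'' (hDr s hs) (hDr s' hs') (he₁.norm_le s hs)
      (he₁.lip s hs s' hs') d'
  obtain ⟨X, hX, hX0, hXsucc⟩ := exists_seq_lipOn_perturbed_pow_eq hK hd hr hr2 hκ0 hκ he hσ
    (g := fun s => (1 + s) ^ d' * (1 + e₁ s)) (fun s hs => mul_mem (pow_mem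
      (add_mem (one_mem K) (hDK hs)) d') (add_mem (one_mem K) (he₁.mem s hs)))
    (by
      intro s hs
      have h1 := ((RelClose.one_add_iff.mpr (hDr s hs)).pow hr0'.le hr'lt d').mul
        (RelClose.one_add_iff.mpr ((he₁.norm_le s hs).trans hκr'')) hr'lt
      rw [one_pow, mul_one] at h1
      have h2 : ‖(1 + s) ^ d' * (1 + e₁ s) - 1‖ ≤ r' := by simpa [RelClose] using h1
      exact h2.trans hr'2)
    (by
      intro s hs s' hs'
      have h1 := hdiff s hs s' hs'
      have h0 := norm_nonneg (s - s')
      rw [← sub_add_cancel ((1 + s) ^ d' * (1 + e₁ s) - (1 + s') ^ d' * (1 + e₁ s'))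
        (d' * (s - s'))]
      refine norm_add_le_of_le_of_le (h1.trans ?_) ?_
      · nlinarith
      · rw [norm_mul]; nlinarith)
  have hrel : ∀ s ∈ D, ∀ s' ∈ D, RelClose (1 / 2)
        (((1 + s) ^ d' * (1 + e₁ s) - σ₀ s (X J s))
          - ((1 + s') ^ d' * (1 + e₁ s') - σ₀ s' (X J s'))) (d' * (s - s')) := by
    intro s hs s' hs'
    have h0 := norm_nonneg (s - s')
    have h1 := hdiff s hs s' hs'
    have h2 := hσ₀.comp_norm_le (hX J) hκ0 hs hs'
    rw [max_eq_right (one_le_inv_iff₀.mpr ⟨hd0, hd1⟩), ← div_eq_mul_inv] at h2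
    unfold RelClose
    have heq : (1 + s) ^ d' * (1 + e₁ s) - σ₀ s (X J s)
        - ((1 + s') ^ d' * (1 + e₁ s') - σ₀ s' (X J s')) - d' * (s - s')
        = (1 + s) ^ d' * (1 + e₁ s) - (1 + s') ^ d' * (1 + e₁ s') - d' * (s - s')
          - (σ₀ s (X J s) - σ₀ s' (X J s')) := by ring
    rw [heq, norm_mul, ← mul_assoc]
    refine norm_sub_le_of_le_of_le (h1.trans ?_) (h2.trans ?_)
    · gcongr; linarith
    · gcongr
      rw [div_le_iff₀ hd0]
      linarith
  refine ⟨X, hX, hX0, hXsucc, hrel, ?_⟩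
  have h0D : (0 : F) ∈ D := by rw [hDef]; exact ⟨zero_mem K, by simpa using hr0'.le⟩
  -- the error terms enter at `s = 0` with size at most `‖d'‖ * r'`, as Hensel's lemma requires
  have H : ∃ s ∈ K, ‖s - 0‖ ≤ r' ∧ (1 + s) ^ d' * (1 + e₁ s) - σ₀ s (X J s) = 1 := by
    refine exists_eq_of_relClose hK (φ := fun s => (1 + s) ^ d' * (1 + e₁ s) - σ₀ s (X J s))
      (α := d') (θ := 1 / 2) (by norm_num) hd' (natCast_mem K d') (zero_mem K) ?_ ?_ (one_mem K) ?_
    · intro s hs hsr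
      rw [sub_zero] at hsr
      have hsD : s ∈ D := by rw [hDef]; exact ⟨hs, hsr⟩
      exact sub_mem (mul_mem (pow_mem (add_mem (one_mem K) hs) d')
        (add_mem (one_mem K) (he₁.mem s hsD)))
        (hσ₀.mem s hsD _ ((hX J).mem s hsD) ((hX J).norm_le s hsD))
    · intro s hs s' hs' hsr hsr'
      rw [sub_zero] at hsr hsr'
      exact hrel s (by rw [hDef]; exact ⟨hs, hsr⟩) s' (by rw [hDef]; exact ⟨hs', hsr'⟩)
    · simp only [add_zero, one_pow, one_mul]
      have : (1 : F) - (1 + e₁ 0 - σ₀ 0 (X J 0)) = σ₀ 0 (X J 0) - e₁ 0 := by ring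
      rw [this]
      exact norm_sub_le_of_le_of_le
        (hσ₀.norm_le 0 h0D _ ((hX J).mem 0 h0D) ((hX J).norm_le 0 h0D))
        ((he₁.norm_le 0 h0D).trans hκr')
  obtain ⟨s, hsK, hsr, hs⟩ := H
  exact ⟨s, by rw [hDef]; exact ⟨hsK, by simpa using hsr⟩, hs⟩

end Solve

/-! ### The local model and its solutions -/

section LocalModel

variable {F : Type*} [NontriviallyNormedField F] [IsUltrametricDist F]

/-- The local data of the bifurcation, in coordinates centred at the fixed point `a_t` and at the
critical point `c_t`, for parameters `t` near `0`. The map `R_t ^ ℓ` sends the point with coordinate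
`v` near `c_t` to the one with coordinate `t ^ d' * G t + v ^ d * E t v` near `a_t`, and
`v ↦ S i t v` is, for large `i`, the inverse branch of `R_t ^ i` following the homoclinic orbit. The
constants `lam`, `zeta`, `rho`, `rho'` are `λ`, `ζ`, `ρ`, `ρ'`, and `lam ^ (-i) * eta` approximates
the derivative of `S i t`. The relative error `‖d‖ ^ 4 * ‖d'‖ ^ 2 / 2` is small enough for all
applications of Hensel's lemma; any other positive number could take its place, at the cost of a
smaller radius `δ`. The bounds on `S` are only required over `K`, where the branches are
constructed. -/
structure LocalModel (K : Subfield F) where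
  (lam zeta eta rho rho' : F)
  (d d' : ℕ)
  (G : F → F) (E : F → F → F) (S : ℕ → F → F → F)
  (δ M : ℝ) (i₀ : ℕ)
  lam_mem : lam ∈ K
  one_lt : 1 < ‖lam‖
  zeta_mem : zeta ∈ K
  zeta_ne : zeta ≠ 0
  eta_mem : eta ∈ K
  eta_ne : eta ≠ 0
  rho_mem : rho ∈ K
  rho_ne : rho ≠ 0
  rho'_mem : rho' ∈ K
  rho'_ne : rho' ≠ 0
  d_ne : (d : F) ≠ 0
  d'_ne : (d' : F) ≠ 0
  δ_pos : 0 < δ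
  M_nonneg : 0 ≤ M
  G_mem : ∀ t ∈ K, ‖t‖ ≤ δ → G t ∈ K
  G_zero : G 0 = rho'
  G_lip : ∀ t t', ‖t‖ ≤ δ → ‖t'‖ ≤ δ → ‖G t - G t'‖ ≤ M * ‖t - t'‖
  E_mem : ∀ t ∈ K, ∀ v ∈ K, ‖t‖ ≤ δ → ‖v‖ ≤ δ → E t v ∈ K
  E_zero : E 0 0 = rho
  E_lip : ∀ t t' v v', ‖t‖ ≤ δ → ‖t'‖ ≤ δ → ‖v‖ ≤ δ → ‖v'‖ ≤ δ →
    ‖E t v - E t' v'‖ ≤ M * max ‖t - t'‖ ‖v - v'‖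
  S_mem : ∀ i, i₀ ≤ i → ∀ t ∈ K, ∀ v ∈ K, ‖t‖ ≤ δ → ‖v‖ ≤ δ → S i t v ∈ K
  S_close : ∀ i, i₀ ≤ i → ∀ t ∈ K, ∀ v ∈ K, ‖t‖ ≤ δ → ‖v‖ ≤ δ →
    RelClose (‖(d : F)‖ ^ 4 * ‖(d' : F)‖ ^ 2 / 2) (S i t v) ((lam ^ i)⁻¹ * zeta)
  S_sub : ∀ i, i₀ ≤ i → ∀ t ∈ K, ∀ v ∈ K, ∀ v' ∈ K, ‖t‖ ≤ δ → ‖v‖ ≤ δ → ‖v'‖ ≤ δ →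
    RelClose (‖(d : F)‖ ^ 4 * ‖(d' : F)‖ ^ 2 / 2) (S i t v - S i t v')
      ((lam ^ i)⁻¹ * eta * (v - v'))
  S_lip : ∀ i, i₀ ≤ i → ∀ t ∈ K, ∀ t' ∈ K, ∀ v ∈ K, ‖t‖ ≤ δ → ‖t'‖ ≤ δ → ‖v‖ ≤ δ →
    ‖S i t v - S i t' v‖ ≤ M * (‖lam‖ ^ i)⁻¹ * ‖t - t'‖

namespace LocalModel

variable {K : Subfield F} (L : LocalModel K)

/-- The coordinate at `a_t` of the image under `R_t ^ ℓ` of the point with coordinate `v` at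
`c_t`. -/
def Lam (t v : F) : F := t ^ L.d' * L.G t + v ^ L.d * L.E t v

theorem norm_d_pos : 0 < ‖(L.d : F)‖ := norm_pos_iff.mpr L.d_ne
theorem norm_d_le : ‖(L.d : F)‖ ≤ 1 := IsUltrametricDist.norm_natCast_le_one F L.d
theorem norm_d'_pos : 0 < ‖(L.d' : F)‖ := norm_pos_iff.mpr L.d'_ne
theorem norm_d'_le : ‖(L.d' : F)‖ ≤ 1 := IsUltrametricDist.norm_natCast_le_one F L.d'
theorem lam_ne : L.lam ≠ 0 := norm_pos_iff.mp (one_pos.trans L.one_lt)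
theorem d_ne_zero : L.d ≠ 0 := fun h => L.d_ne (by simp [h])
theorem d'_ne_zero : L.d' ≠ 0 := fun h => L.d'_ne (by simp [h])

/-- A parameter `t` at which the critical point makes `J + 1` returns close to itself, with
coordinates `ω J t, …, ω 0 t`, before it lands on the fixed point. The first passage near the fixed
point takes `n` iterations; the later ones take `2 * n`, which makes the terms `S (2 * n)`
negligible in the equations for `ω j`, so that all returns are close to the same point `v₀`, the
solution of the equation of leading order. The functions `ω j` are defined for all parameters in `K`
at distance at most `s` from `t`, and solve all equations except `landing`, which only holds at `t`:
by `expand` its error grows at least linearly with the distance to `t`. -/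
structure Solution (J : ℕ) (μ : ℝ) where
  (n : ℕ) (t v₀ : F) (ω : ℕ → F → F) (c s C : ℝ)
  le_n : L.i₀ ≤ n
  t_mem : t ∈ K
  v₀_mem : v₀ ∈ K
  v₀_ne : v₀ ≠ 0
  v₀_pow : v₀ ^ L.d = -((L.lam ^ n)⁻¹ * L.zeta / L.rho)
  c_pos : 0 < c
  s_pos : 0 < s
  norm_t : ‖t‖ ≤ μ
  norm_v₀ : ‖v₀‖ ≤ μ
  norm_le : ∀ t' ∈ K, ‖t' - t‖ ≤ s → ‖t'‖ ≤ μ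
  ω_mem : ∀ j, ∀ t' ∈ K, ‖t' - t‖ ≤ s → ω j t' ∈ K
  ω_close : ∀ j, ∀ t' ∈ K, ‖t' - t‖ ≤ s → RelClose (‖(L.d : F)‖ ^ 3 / 2) (ω j t') v₀
  ω_lip : ∀ j, ∀ t' ∈ K, ‖t' - t‖ ≤ s → ‖ω j t' - ω j t‖ ≤ C * ‖t' - t‖
  ω_zero : ∀ t' ∈ K, ‖t' - t‖ ≤ s → L.Lam t' (ω 0 t') = 0
  ω_succ : ∀ j, ∀ t' ∈ K, ‖t' - t‖ ≤ s → L.Lam t' (ω (j + 1) t') = L.S (2 * n) t' (ω j t')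
  landing : L.Lam t 0 = L.S n t (ω J t)
  expand : ∀ t' ∈ K, ‖t' - t‖ ≤ s → c * ‖t' - t‖ ≤ ‖L.Lam t' 0 - L.S n t' (ω J t')‖
  Lam_sub : ∀ v v', RelClose (‖(L.d : F)‖ ^ 3 / 2) v v₀ → RelClose (‖(L.d : F)‖ ^ 3 / 2) v' v₀ →
    RelClose (‖(L.d : F)‖ ^ 2 / 2) (L.Lam t v - L.Lam t v')
      (L.d * L.rho * v₀ ^ (L.d - 1) * (v - v'))

theorem Lam_zero (t : F) : L.Lam t 0 = t ^ L.d' * L.G t := by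
  simp [Lam, L.d_ne_zero]

variable [CompleteSpace F]

set_option maxHeartbeats 1600000 in
/-- From exact solutions `t₀` and `v₀` of the equations of leading order to a solution. Divided by
`lam ^ (-n) * zeta`, the size of all terms of leading order, the equations take the form of
`exists_seq_and_parameter`, with error terms that are bounded by a multiple of `μ` except for the
relative error of `S n`, which is bounded by the definition of a local model. -/
theorem nonempty_solution_of_small (hK : IsClosed (K : Set F)) (J n : ℕ) {t₀ v₀ : F}
    (ht₀K : t₀ ∈ K) (hv₀K : v₀ ∈ K) (ht₀ : t₀ ≠ 0) (hv₀ : v₀ ≠ 0)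
    (htd : t₀ ^ L.d' = (L.lam ^ n)⁻¹ * L.zeta / L.rho')
    (hvd : v₀ ^ L.d = -((L.lam ^ n)⁻¹ * L.zeta / L.rho))
    {A κ μ : ℝ} (hμδ : μ ≤ L.δ) (htμ : ‖t₀‖ ≤ μ) (hvμ : ‖v₀‖ ≤ μ)
    (hnμ : (‖L.lam‖ ^ n)⁻¹ ≤ μ) (hn : L.i₀ ≤ n)
    (hA1 : 1 ≤ A) (hA2 : L.M / ‖L.rho‖ ≤ A) (hA3 : L.M / ‖L.rho'‖ ≤ A)
    (hA4 : L.M / ‖L.zeta‖ ≤ A) (hA5 : ‖L.eta‖ / ‖L.zeta‖ ≤ A)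
    (hκ : κ = ‖(L.d : F)‖ ^ 5 * ‖(L.d' : F)‖ ^ 2 / 2) (hAμ : A * μ ≤ κ) :
    Nonempty (L.Solution J μ) := by
  have hb0 := L.norm_d_pos
  have hb1 := L.norm_d_le
  have hb0' := L.norm_d'_pos
  have hb1' := L.norm_d'_le
  have hρ0 : 0 < ‖L.rho‖ := norm_pos_iff.mpr L.rho_ne
  have hρ0' : 0 < ‖L.rho'‖ := norm_pos_iff.mpr L.rho'_ne
  have hζ0 : 0 < ‖L.zeta‖ := norm_pos_iff.mpr L.zeta_ne
  have hM0 := L.M_nonneg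
  have hlam0 : 0 < ‖L.lam‖ := one_pos.trans L.one_lt
  set b := ‖(L.d : F)‖ with hb
  set b' := ‖(L.d' : F)‖ with hb'
  -- the radii of the balls in which the normalized unknowns are sought
  set r : ℝ := b ^ 3 / 2 with hr
  set r' : ℝ := b' * b ^ 4 / 2 with hr'
  set D : Set F := {s | s ∈ K ∧ ‖s‖ ≤ r'} with hD
  set τ : F := (L.lam ^ n)⁻¹ * L.zeta with hτdef
  have hτ0 : τ ≠ 0 := mul_ne_zero (inv_ne_zero (pow_ne_zero _ L.lam_ne)) L.zeta_ne
  have hτK : τ ∈ K := mul_mem (inv_mem (pow_mem L.lam_mem n)) L.zeta_mem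
  have hτn : ‖τ‖ = (‖L.lam‖ ^ n)⁻¹ * ‖L.zeta‖ := by rw [hτdef, norm_mul, norm_inv, norm_pow]
  have hbp : ∀ m, b ^ m ≤ 1 := fun m => pow_le_one₀ hb0.le hb1
  have hbp' : ∀ m, b' ^ m ≤ 1 := fun m => pow_le_one₀ hb0'.le hb1'
  have hr0 : 0 < r := by positivity
  have hr0' : 0 < r' := by positivity
  have hrb : r ≤ b / 2 := by
    have : b ^ 3 = b * b ^ 2 := by ring
    rw [hr, this]; nlinarith [hbp 2]
  have hr1 : r < 1 := by linarith
  have hr'b : r' ≤ b' / 2 := by rw [hr']; nlinarith [hbp 4]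
  have hr'1 : r' < 1 := by linarith
  have hr'r : r' ≤ b * r := by
    have : b * r = b ^ 4 / 2 := by rw [hr]; ring
    rw [this, hr']
    nlinarith [pow_pos hb0 4]
  have hκ0 : 0 ≤ κ := by rw [hκ]; positivity
  have hκ1 : κ ≤ b' * r' := by
    have h5 : κ = b * (b' * r') := by rw [hκ, hr']; ring
    rw [h5]
    exact mul_le_of_le_one_left (by positivity) hb1
  have hκ2 : κ ≤ b * r := by nlinarith
  have hκ3 : κ ≤ b * b' / 2 := by
    have : κ = b * b' / 2 * (b ^ 4 * b') := by rw [hκ]; ring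
    rw [this]
    refine mul_le_of_le_one_right (by positivity) (mul_le_one₀ (hbp 4) hb0'.le hb1')
  have hκr : κ ≤ r := by nlinarith
  have hn1 : ∀ {s : F}, ‖s‖ ≤ r' → ‖t₀ * (1 + s)‖ = ‖t₀‖ := fun {s} hs => by
    rw [norm_mul, (RelClose.one_add_iff.mpr hs).norm_eq hr'1]; simp
  have hn2 : ∀ {x : F}, ‖x‖ ≤ r → ‖v₀ * (1 + x)‖ = ‖v₀‖ := fun {x} hx => by
    rw [norm_mul, (RelClose.one_add_iff.mpr hx).norm_eq hr1]; simp
  have htδ : ∀ {s : F}, ‖s‖ ≤ r' → ‖t₀ * (1 + s)‖ ≤ L.δ := fun hs => by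
    rw [hn1 hs]; exact htμ.trans hμδ
  have hvδ : ∀ {x : F}, ‖x‖ ≤ r → ‖v₀ * (1 + x)‖ ≤ L.δ := fun hx => by
    rw [hn2 hx]; exact hvμ.trans hμδ
  have htK : ∀ {s : F}, s ∈ K → t₀ * (1 + s) ∈ K := fun hs => mul_mem ht₀K (add_mem (one_mem K) hs)
  have hvK : ∀ {s : F}, s ∈ K → v₀ * (1 + s) ∈ K := fun hs => mul_mem hv₀K (add_mem (one_mem K) hs)
  have hsmall : ∀ {m q : ℝ}, m ≤ A → 0 ≤ q → q ≤ μ → m * q ≤ κ := fun {m q} hm hq0 hq =>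
    (mul_le_mul hm hq hq0 (by linarith)).trans hAμ
  have hn0 : 0 ≤ (‖L.lam‖ ^ n)⁻¹ := by positivity
  -- the normalized error terms
  let e₁ : F → F := fun s => L.G (t₀ * (1 + s)) / L.rho' - 1
  let e : F → F → F := fun s x => L.E (t₀ * (1 + s)) (v₀ * (1 + x)) / L.rho - 1
  let σ : F → F → F := fun s x => L.S (2 * n) (t₀ * (1 + s)) (v₀ * (1 + x)) / τ
  let σ₀ : F → F → F := fun s x => L.S n (t₀ * (1 + s)) (v₀ * (1 + x)) / τ - 1
  have hzero : ‖(0 : F)‖ ≤ L.δ := by rw [norm_zero]; exact L.δ_pos.le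
  have he₁ : LipOn K D κ κ e₁ := by
    have hlip : ∀ t t', ‖t‖ ≤ L.δ → ‖t'‖ ≤ L.δ → ‖L.G t / L.rho' - L.G t' / L.rho'‖ ≤
        L.M / ‖L.rho'‖ * ‖t - t'‖ := fun t t' ht ht' => by
      rw [← sub_div, norm_div, div_le_iff₀ hρ0', mul_right_comm, div_mul_cancel₀ _ hρ0'.ne']
      exact L.G_lip t t' ht ht'
    refine ⟨fun s hs => sub_mem (div_mem (L.G_mem _ (htK hs.1) (htδ hs.2)) L.rho'_mem) (one_mem K),
      fun s hs => ?_, fun s hs s' hs' => ?_⟩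
    · have h := hlip _ 0 (htδ hs.2) hzero
      rw [L.G_zero, div_self L.rho'_ne, sub_zero, hn1 hs.2] at h
      exact h.trans (hsmall hA3 (norm_nonneg _) htμ)
    · have h := hlip _ _ (htδ hs.2) (htδ hs'.2)
      have h2 : e₁ s - e₁ s' = L.G (t₀ * (1 + s)) / L.rho' - L.G (t₀ * (1 + s')) / L.rho' := by
        simp only [e₁]; ring
      rw [h2]
      refine h.trans ?_
      rw [← mul_sub, add_sub_add_left_eq_sub, norm_mul, ← mul_assoc]
      gcongr
      exact hsmall hA3 (norm_nonneg _) htμ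
  have helip : ∀ t t' v v', ‖t‖ ≤ L.δ → ‖t'‖ ≤ L.δ → ‖v‖ ≤ L.δ → ‖v'‖ ≤ L.δ →
      ‖(L.E t v / L.rho - 1) - (L.E t' v' / L.rho - 1)‖ ≤
        L.M / ‖L.rho‖ * max ‖t - t'‖ ‖v - v'‖ := fun t t' v v' ht ht' hv hv' => by
    rw [sub_sub_sub_cancel_right, ← sub_div, norm_div, div_le_iff₀ hρ0, mul_right_comm,
      div_mul_cancel₀ _ hρ0.ne']
    exact L.E_lip t t' v v' ht ht' hv hv'
  have heb : ∀ s ∈ D, ∀ x, ‖x‖ ≤ r → ‖e s x‖ ≤ κ := by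
    intro s hs x hxr
    have h := helip _ 0 _ 0 (htδ hs.2) hzero (hvδ hxr) hzero
    rw [L.E_zero, div_self L.rho_ne, sub_self, sub_zero, sub_zero, sub_zero, hn1 hs.2,
      hn2 hxr] at h
    exact h.trans (hsmall hA2 (by positivity) (max_le htμ hvμ))
  have hel : ∀ s ∈ D, ∀ x x', ‖x‖ ≤ r → ‖x'‖ ≤ r → ‖e s x - e s x'‖ ≤ κ * ‖x - x'‖ := by
    intro s hs x x' hxr hxr'
    have h := helip _ _ _ _ (htδ hs.2) (htδ hs.2) (hvδ hxr) (hvδ hxr')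
    refine h.trans ?_
    rw [sub_self, norm_zero, max_eq_right (norm_nonneg _), ← mul_sub, add_sub_add_left_eq_sub,
      norm_mul, ← mul_assoc]
    gcongr
    exact hsmall hA2 (norm_nonneg _) hvμ
  have he : LipOn₂ K D r κ κ e := by
    refine ⟨fun s hs x hx hxr => sub_mem (div_mem (L.E_mem _ (htK hs.1) _ (hvK hx) (htδ hs.2)
      (hvδ hxr)) L.rho_mem) (one_mem K), fun s hs x hx hxr => heb s hs x hxr,
      fun s hs x hx x' hx' hxr hxr' => hel s hs x x' hxr hxr', fun s hs s' hs' x hx hxr => ?_⟩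
    have h := helip _ _ _ _ (htδ hs.2) (htδ hs'.2) (hvδ hxr) (hvδ hxr)
    refine h.trans ?_
    rw [sub_self, norm_zero, max_eq_left (norm_nonneg _), ← mul_sub, add_sub_add_left_eq_sub,
      norm_mul, ← mul_assoc]
    gcongr
    exact hsmall hA2 (norm_nonneg _) htμ
  have hε : b ^ 4 * b' ^ 2 / 2 = b' * r' := by rw [hr']; ring
  have hε1 : b ^ 4 * b' ^ 2 / 2 < 1 := by rw [hε]; nlinarith
  have h2n : L.i₀ ≤ 2 * n := by omega
  -- the bounds that the branches `S i` satisfy after division by `τ`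
  have hSx : ∀ i, n ≤ i → ∀ s ∈ D, ∀ x ∈ K, ∀ x' ∈ K, ‖x‖ ≤ r → ‖x'‖ ≤ r →
      ‖L.S i (t₀ * (1 + s)) (v₀ * (1 + x)) / τ - L.S i (t₀ * (1 + s)) (v₀ * (1 + x')) / τ‖
        ≤ κ * ‖x - x'‖ := by
    intro i hi s hs x hx x' hx' hxr hxr'
    have h := (L.S_sub i (hn.trans hi) _ (htK hs.1) _ (hvK hx) _ (hvK hx') (htδ hs.2) (hvδ hxr)
      (hvδ hxr')).norm_eq hε1
    rw [← sub_div, norm_div, h, norm_mul, norm_mul, norm_inv, norm_pow, ← mul_sub,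
      add_sub_add_left_eq_sub, norm_mul, div_le_iff₀ (norm_pos_iff.mpr hτ0), hτn]
    have h2 : (‖L.lam‖ ^ i)⁻¹ ≤ (‖L.lam‖ ^ n)⁻¹ :=
      inv_anti₀ (by positivity) (pow_le_pow_right₀ L.one_lt.le hi)
    have h3 := hsmall hA5 (norm_nonneg _) hvμ
    rw [div_mul_eq_mul_div, div_le_iff₀ hζ0] at h3
    calc (‖L.lam‖ ^ i)⁻¹ * ‖L.eta‖ * (‖v₀‖ * ‖x - x'‖)
        = (‖L.lam‖ ^ i)⁻¹ * ((‖L.eta‖ * ‖v₀‖) * ‖x - x'‖) := by ring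
      _ ≤ (‖L.lam‖ ^ n)⁻¹ * ((κ * ‖L.zeta‖) * ‖x - x'‖) := by gcongr
      _ = κ * ‖x - x'‖ * ((‖L.lam‖ ^ n)⁻¹ * ‖L.zeta‖) := by ring
  have hSs : ∀ i, n ≤ i → ∀ s ∈ D, ∀ s' ∈ D, ∀ x ∈ K, ‖x‖ ≤ r →
      ‖L.S i (t₀ * (1 + s)) (v₀ * (1 + x)) / τ - L.S i (t₀ * (1 + s')) (v₀ * (1 + x)) / τ‖
        ≤ κ * ‖s - s'‖ := by
    intro i hi s hs s' hs' x hx hxr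
    have h := L.S_lip i (hn.trans hi) _ (htK hs.1) _ (htK hs'.1) _ (hvK hx) (htδ hs.2) (htδ hs'.2)
      (hvδ hxr)
    rw [← sub_div, norm_div, div_le_iff₀ (norm_pos_iff.mpr hτ0), hτn]
    refine h.trans ?_
    rw [← mul_sub, add_sub_add_left_eq_sub, norm_mul]
    have h2 : (‖L.lam‖ ^ i)⁻¹ ≤ (‖L.lam‖ ^ n)⁻¹ :=
      inv_anti₀ (by positivity) (pow_le_pow_right₀ L.one_lt.le hi)
    have h3 := hsmall hA4 (norm_nonneg _) htμ
    rw [div_mul_eq_mul_div, div_le_iff₀ hζ0] at h3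
    calc L.M * (‖L.lam‖ ^ i)⁻¹ * (‖t₀‖ * ‖s - s'‖)
        = (‖L.lam‖ ^ i)⁻¹ * ((L.M * ‖t₀‖) * ‖s - s'‖) := by ring
      _ ≤ (‖L.lam‖ ^ n)⁻¹ * ((κ * ‖L.zeta‖) * ‖s - s'‖) := by gcongr
      _ = κ * ‖s - s'‖ * ((‖L.lam‖ ^ n)⁻¹ * ‖L.zeta‖) := by ring
  have hσ : LipOn₂ K D r κ κ σ := by
    refine ⟨fun s hs x hx hxr => div_mem (L.S_mem _ h2n _ (htK hs.1) _ (hvK hx) (htδ hs.2)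
      (hvδ hxr)) hτK, fun s hs x hx hxr => ?_,
      fun s hs x hx x' hx' hxr hxr' => hSx _ (by omega) s hs x hx x' hx' hxr hxr',
      fun s hs s' hs' x hx hxr => hSs _ (by omega) s hs s' hs' x hx hxr⟩
    have h := (L.S_close _ h2n _ (htK hs.1) _ (hvK hx) (htδ hs.2) (hvδ hxr)).norm_eq hε1
    have h2 : ‖σ s x‖ = (‖L.lam‖ ^ n)⁻¹ := by
      simp only [σ]
      rw [norm_div, h, hτn, norm_mul, norm_inv, norm_pow, two_mul, pow_add]
      field_simp
    rw [h2, ← one_mul (‖L.lam‖ ^ n)⁻¹]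
    exact hsmall hA1 hn0 hnμ
  have hσ₀ : LipOn₂ K D r (b' * r') κ σ₀ := by
    refine ⟨fun s hs x hx hxr => sub_mem (div_mem (L.S_mem _ hn _ (htK hs.1) _ (hvK hx) (htδ hs.2)
      (hvδ hxr)) hτK) (one_mem K), fun s hs x hx hxr => ?_,
      fun s hs x hx x' hx' hxr hxr' => ?_, fun s hs s' hs' x hx hxr => ?_⟩
    · have h := L.S_close _ hn _ (htK hs.1) _ (hvK hx) (htδ hs.2) (hvδ hxr)
      rw [← RelClose.div_right_iff hτ0] at h
      simpa [RelClose, ← hb, ← hb', hε] using h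
    · simp only [σ₀, sub_sub_sub_cancel_right]
      exact hSx _ le_rfl s hs x hx x' hx' hxr hxr'
    · simp only [σ₀, sub_sub_sub_cancel_right]
      exact hSs _ le_rfl s hs s' hs' x hx hxr
  obtain ⟨X, hX, hX0, hXs, hexp, s₀, hs₀, hs₀eq⟩ := exists_seq_and_parameter hK L.d_ne L.d'_ne hr0
    hrb hκ0 hr0' hr'b hr'r hκ2 hκ1 hκ3 hD he hσ hσ₀ he₁ J
  have hLam : ∀ s x, L.Lam (t₀ * (1 + s)) (v₀ * (1 + x))
      = τ * ((1 + s) ^ L.d' * (1 + e₁ s) - (1 + x) ^ L.d * (1 + e s x)) := by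
    intro s x
    simp only [Lam, e₁, e, mul_pow, htd, hvd, add_sub_cancel]
    have h1 := L.rho_ne
    have h2 := L.rho'_ne
    field_simp
    ring
  have hLam0 : ∀ s, L.Lam (t₀ * (1 + s)) 0 = τ * ((1 + s) ^ L.d' * (1 + e₁ s)) := by
    intro s
    simp only [Lam_zero, e₁, mul_pow, htd, add_sub_cancel]
    have h2 := L.rho'_ne
    field_simp
  have ht₀n : 0 < ‖t₀‖ := norm_pos_iff.mpr ht₀
  have hback : ∀ t', t₀ * (1 + (t' / t₀ - 1)) = t' := fun t' => by field_simp; ring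
  have hbackD : ∀ t' ∈ K, ‖t' - t₀ * (1 + s₀)‖ ≤ ‖t₀‖ * r' → t' / t₀ - 1 ∈ D := by
    intro t' ht' h
    refine ⟨sub_mem (div_mem ht' ht₀K) (one_mem K), ?_⟩
    have h1 : t' / t₀ - 1 = (t' - t₀ * (1 + s₀)) / t₀ + s₀ := by field_simp; ring
    rw [h1]
    refine norm_add_le_of_le_of_le ?_ hs₀.2
    rw [norm_div, div_le_iff₀ ht₀n]
    exact h.trans_eq (mul_comm _ _)
  have hdiffs : ∀ t', t' / t₀ - 1 - s₀ = (t' - t₀ * (1 + s₀)) / t₀ := fun t' => by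
    field_simp; ring
  have hs₀back : t₀ * (1 + s₀) / t₀ - 1 = s₀ := by field_simp; ring
  refine ⟨{ n := n, t := t₀ * (1 + s₀), v₀ := v₀, ω := fun j t' => v₀ * (1 + X j (t' / t₀ - 1)),
            c := ‖τ‖ * b' / ‖t₀‖, s := ‖t₀‖ * r', C := ‖v₀‖ * b⁻¹ / ‖t₀‖, le_n := hn
            t_mem := htK hs₀.1, v₀_mem := hv₀K, v₀_ne := hv₀, v₀_pow := hvd
            c_pos := ?_, s_pos := ?_, norm_t := ?_, norm_v₀ := hvμ, norm_le := ?_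
            ω_mem := ?_, ω_close := ?_, ω_lip := ?_
            ω_zero := ?_, ω_succ := ?_, landing := ?_, expand := ?_, Lam_sub := ?_ }⟩
  · have := norm_pos_iff.mpr hτ0
    positivity
  · positivity
  · rw [hn1 hs₀.2]; exact htμ
  · intro t' ht' h
    rw [← hback t', hn1 (hbackD t' ht' h).2]; exact htμ
  · exact fun j t' ht' h => hvK ((hX j).mem _ (hbackD t' ht' h))
  · intro j t' ht' h
    have := (RelClose.one_add_iff.mpr ((hX j).norm_le _ (hbackD t' ht' h))).mul_left v₀
    rwa [mul_one] at this
  · intro j t' ht' h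
    have h1 := (hX j).lip _ (hbackD t' ht' h) _ hs₀
    rw [hdiffs, norm_div] at h1
    rw [← mul_sub, add_sub_add_left_eq_sub, norm_mul, hs₀back]
    calc ‖v₀‖ * ‖X j (t' / t₀ - 1) - X j s₀‖
        ≤ ‖v₀‖ * (b⁻¹ * (‖t' - t₀ * (1 + s₀)‖ / ‖t₀‖)) := by gcongr
      _ = _ := by ring
  · intro t' ht' h
    have h1 := hLam (t' / t₀ - 1) (X 0 (t' / t₀ - 1))
    rw [hback, hX0 _ (hbackD t' ht' h), sub_self, mul_zero] at h1
    exact h1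
  · intro j t' ht' h
    have h1 := hLam (t' / t₀ - 1) (X (j + 1) (t' / t₀ - 1))
    rw [hback, hXs j _ (hbackD t' ht' h), sub_sub_cancel] at h1
    rw [h1]
    simp only [σ]
    rw [hback, mul_div_cancel₀ _ hτ0]
  · rw [hLam0, hs₀back]
    have h1 : (1 + s₀) ^ L.d' * (1 + e₁ s₀) = 1 + σ₀ s₀ (X J s₀) := by linear_combination hs₀eq
    rw [h1]
    simp only [σ₀, add_sub_cancel]
    rw [mul_div_cancel₀ _ hτ0]
  · intro t' ht' h
    have h1 := (hexp _ (hbackD t' ht' h) _ hs₀).norm_eq (by norm_num)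
    have h2 := hLam0 (t' / t₀ - 1)
    have h3 : L.S n t' (v₀ * (1 + X J (t' / t₀ - 1)))
        = τ * (1 + σ₀ (t' / t₀ - 1) (X J (t' / t₀ - 1))) := by
      simp only [σ₀]
      rw [hback, add_sub_cancel, mul_div_cancel₀ _ hτ0]
    rw [hback] at h2
    rw [hs₀eq, norm_mul, hdiffs, norm_div] at h1
    have h4 : L.Lam t' 0 - L.S n t' (v₀ * (1 + X J (t' / t₀ - 1)))
        = τ * ((1 + (t' / t₀ - 1)) ^ L.d' * (1 + e₁ (t' / t₀ - 1))
          - σ₀ (t' / t₀ - 1) (X J (t' / t₀ - 1)) - 1) := by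
      rw [h2, h3]; ring
    rw [h4, norm_mul τ, h1]
    apply le_of_eq
    rw [← hb']
    ring
  · intro v v' hv hv'
    have hx : ∀ {v}, RelClose r v v₀ → ‖v / v₀ - 1‖ ≤ r := fun {v} h => by
      have := (RelClose.div_right_iff hv₀).mpr h
      simpa [RelClose] using this
    have hbv : ∀ v, v₀ * (1 + (v / v₀ - 1)) = v := fun v => by field_simp; ring
    have h1 := norm_perturbed_pow_sub_le hr1 hκr (hx hv) (hx hv') (heb s₀ hs₀ _ (hx hv))
      (hel s₀ hs₀ _ _ (hx hv) (hx hv')) L.d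
    have h2 : RelClose (b ^ 2 / 2) ((1 + (v / v₀ - 1)) ^ L.d * (1 + e s₀ (v / v₀ - 1))
        - (1 + (v' / v₀ - 1)) ^ L.d * (1 + e s₀ (v' / v₀ - 1)))
        (L.d * ((v / v₀ - 1) - (v' / v₀ - 1))) := by
      refine h1.trans (le_of_eq ?_)
      rw [norm_mul, ← hb, hr]; ring
    have h3 := h2.mul_left (-τ)
    have h4 := hLam s₀ (v / v₀ - 1)
    have h5 := hLam s₀ (v' / v₀ - 1)
    rw [hbv] at h4 h5
    rw [h4, h5]
    have hpow : v₀ ^ (L.d - 1) = v₀ ^ L.d / v₀ := by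
      rw [eq_div_iff hv₀, ← pow_succ, Nat.sub_add_cancel (Nat.pos_of_ne_zero L.d_ne_zero)]
    convert h3 using 1
    · ring
    · rw [hpow, hvd]
      have := L.rho_ne
      field_simp
      ring

/-- If `x` and `y` are the roots that admissibility provides, then `n = r * d * d' - m₀` is, for a
large `r`, the time of the first passage of a solution, because the solutions `x / lam ^ (r * d')`
and `y / lam ^ (r * d)` of the equations of leading order lie in `K`. -/
theorem nonempty_solution (hK : IsClosed (K : Set F)) (J : ℕ) {x y : F} (hx : x ∈ K)
    (hy : y ∈ K) {m₀ : ℤ} (hxd : x ^ L.d = -(L.lam ^ m₀ * L.zeta / L.rho))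
    (hyd : y ^ L.d' = L.lam ^ m₀ * L.zeta / L.rho') {μ : ℝ} (hμ : 0 < μ) :
    Nonempty (L.Solution J μ) := by
  have hlam := L.lam_ne
  have hlam0 : 0 < ‖L.lam‖ := one_pos.trans L.one_lt
  set A : ℝ := max 1 (max (L.M / ‖L.rho‖) (max (L.M / ‖L.rho'‖)
    (max (L.M / ‖L.zeta‖) (‖L.eta‖ / ‖L.zeta‖)))) with hA
  have hA0 : 1 ≤ A := le_max_left _ _
  have hA0' : 0 < A := one_pos.trans_le hA0
  set κ : ℝ := ‖(L.d : F)‖ ^ 5 * ‖(L.d' : F)‖ ^ 2 / 2 with hκ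
  have hκ0 : 0 < κ := by
    have := L.norm_d_pos
    have := L.norm_d'_pos
    positivity
  set ν : ℝ := min μ (min L.δ (κ / A)) with hν
  have hν0 : 0 < ν := lt_min hμ (lt_min L.δ_pos (by positivity))
  have hd := Nat.pos_of_ne_zero L.d_ne_zero
  have hd' := Nat.pos_of_ne_zero L.d'_ne_zero
  have hinv1 : ‖L.lam‖⁻¹ < 1 := inv_lt_one_of_one_lt₀ L.one_lt
  have htend : ∀ (k : ℕ) (C : ℝ), 0 < k → ∀ᶠ r : ℕ in atTop, C * (‖L.lam‖ ^ (r * k))⁻¹ ≤ ν := by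
    intro k C hk
    have h1 : Tendsto (fun r : ℕ => C * (‖L.lam‖⁻¹ ^ (r * k))) atTop (𝓝 (C * 0)) :=
      ((tendsto_pow_atTop_nhds_zero_of_lt_one (by positivity) hinv1).comp
        (tendsto_atTop_mono (fun r => Nat.le_mul_of_pos_right r hk) tendsto_id)).const_mul C
    rw [mul_zero] at h1
    filter_upwards [h1.eventually_le_const hν0] with r hr
    rwa [inv_pow] at hr
  obtain ⟨r, hr1, hr2, hr3, hr4⟩ := ((htend L.d ‖y‖ hd).and ((htend L.d' ‖x‖ hd').and
    ((htend (L.d * L.d') (‖L.lam‖ ^ m₀) (by positivity)).and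
    (eventually_ge_atTop (m₀.toNat + L.i₀))))).exists
  obtain ⟨n, hn⟩ : ∃ n : ℕ, (n : ℤ) = r * (L.d * L.d') - m₀ := by
    refine ⟨(r * (L.d * L.d') - m₀ : ℤ).toNat, Int.toNat_of_nonneg ?_⟩
    have h1 : (r : ℤ) * 1 ≤ r * (L.d * L.d') := by gcongr; norm_cast; nlinarith
    omega
  have hn0 : L.i₀ ≤ n := by
    have h1 : (r : ℤ) * 1 ≤ r * (L.d * L.d') := by gcongr; norm_cast; nlinarith
    omega
  have hln : (L.lam ^ n)⁻¹ = L.lam ^ m₀ * (L.lam ^ (r * (L.d * L.d')))⁻¹ := by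
    rw [← zpow_natCast, hn, ← zpow_natCast, ← zpow_neg, ← zpow_neg, ← zpow_add₀ hlam]
    congr 1; push_cast; ring
  have hx0 : x ≠ 0 := by
    rintro rfl
    rw [zero_pow L.d_ne_zero] at hxd
    exact neg_ne_zero.mpr (div_ne_zero (mul_ne_zero (zpow_ne_zero _ hlam) L.zeta_ne) L.rho_ne)
      hxd.symm
  have hy0 : y ≠ 0 := by
    rintro rfl
    rw [zero_pow L.d'_ne_zero] at hyd
    exact (div_ne_zero (mul_ne_zero (zpow_ne_zero _ hlam) L.zeta_ne) L.rho'_ne) hyd.symm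
  have hsol := L.nonempty_solution_of_small hK J n (t₀ := y * (L.lam ^ (r * L.d))⁻¹)
    (v₀ := x * (L.lam ^ (r * L.d'))⁻¹) (A := A) (κ := κ) (μ := ν)
    (mul_mem hy (inv_mem (pow_mem L.lam_mem _)))
    (mul_mem hx (inv_mem (pow_mem L.lam_mem _)))
    (mul_ne_zero hy0 (inv_ne_zero (pow_ne_zero _ hlam)))
    (mul_ne_zero hx0 (inv_ne_zero (pow_ne_zero _ hlam)))
    (by
      rw [mul_pow, hyd, hln, inv_pow, ← pow_mul]
      ring_nf)
    (by
      rw [mul_pow, hxd, hln, inv_pow, ← pow_mul]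
      ring_nf)
    ((min_le_right _ _).trans (min_le_left _ _))
    (by rwa [norm_mul, norm_inv, norm_pow]) (by rwa [norm_mul, norm_inv, norm_pow])
    (by rw [← norm_pow, ← norm_inv, hln, norm_mul, norm_inv, norm_zpow, norm_pow]; exact hr3)
    hn0 hA0 (by simp [hA]) (by simp [hA]) (by simp [hA]) (by simp [hA]) hκ
    (by
      have : ν ≤ κ / A := (min_le_right _ _).trans (min_le_right _ _)
      rwa [le_div_iff₀ hA0', mul_comm] at this)
  obtain ⟨s⟩ := hsol
  have hνμ : ν ≤ μ := min_le_left _ _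
  exact ⟨{ s with
    norm_t := s.norm_t.trans hνμ
    norm_v₀ := s.norm_v₀.trans hνμ
    norm_le := fun t' ht' h => (s.norm_le t' ht' h).trans hνμ }⟩

end LocalModel

end LocalModel

/-! ### Charts of the projective line and local degrees -/

section Charts

variable {F : Type*} [NontriviallyNormedField F]

/-- The point `[x : y]` of the projective line. -/
noncomputable def homPt (x y : F) : OnePoint F :=
  open Classical in if y = 0 then OnePoint.infty else OnePoint.some (x / y)

/-- The numerator of the coordinate `coord b` of the point `[x : y]`. -/
def chartNum : OnePoint F → F → F → F
  | OnePoint.infty, _, y => y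
  | OnePoint.some _, x, _ => x

/-- The denominator of the coordinate `coord b` of the point `[x : y]`. -/
def chartDen : OnePoint F → F → F → F
  | OnePoint.infty, x, _ => x
  | OnePoint.some _, _, y => y

theorem coord_homPt (b : OnePoint F) (x y : F) :
    coord b (homPt x y) = chartNum b x y / chartDen b x y := by
  induction b using OnePoint.rec with
  | infty => by_cases hy : y = 0 <;> simp [homPt, coord, chartNum, chartDen, hy]
  | coe a => by_cases hy : y = 0 <;> simp [homPt, coord, chartNum, chartDen, hy]

theorem homPt_eq_param {b : OnePoint F} {x y : F} (h : chartDen b x y ≠ 0) :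
    homPt x y = param b (chartNum b x y / chartDen b x y) := by
  induction b using OnePoint.rec with
  | infty =>
    simp only [chartDen] at h
    by_cases hy : y = 0 <;> simp [homPt, param, chartNum, chartDen, hy, h]
  | coe a =>
    simp only [chartDen] at h
    simp [homPt, param, chartNum, chartDen, h]

/-- A point that is the value of a chart has a finite coordinate in this chart. The hypothesis `hxy`
excludes `[0 : 0]`, for which `homPt` has the value `∞`. -/
theorem chartDen_ne_zero {b : OnePoint F} {x y u : F} (hxy : x ≠ 0 ∨ y ≠ 0)
    (h : homPt x y = param b u) : chartDen b x y ≠ 0 := by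
  induction b using OnePoint.rec with
  | infty =>
    simp only [chartDen]
    rintro rfl
    simp only [ne_eq, not_true_eq_false, false_or] at hxy
    by_cases hu : u = 0 <;> simp [homPt, param, hxy, hu, eq_comm] at h
  | coe a =>
    simp only [chartDen]
    rintro rfl
    simp [homPt, param] at h

theorem coord_param (b : OnePoint F) (u : F) : coord b (param b u) = u := by
  induction b using OnePoint.rec with
  | infty => by_cases hu : u = 0 <;> simp [param, coord, hu]
  | coe a => simp [param, coord]

theorem param_coord_self (b : OnePoint F) : param b (coord b b) = b := by
  induction b using OnePoint.rec with
  | infty => simp [param, coord]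
  | coe a => simp [param, coord]

theorem param_injective (b : OnePoint F) : Function.Injective (param b) :=
  Function.LeftInverse.injective (coord_param b)

theorem max_one_norm_inv {x : F} (hx : x ≠ 0) : max 1 ‖x⁻¹‖ = max 1 ‖x‖ / ‖x‖ := by
  have hx' : 0 < ‖x‖ := norm_pos_iff.mpr hx
  rw [← max_div_div_right hx'.le, div_self hx'.ne', norm_inv, one_div, max_comm]

/-- The chordal distance is given by the same formula in both charts. -/
theorem chordal_param (b : OnePoint F) (u w : F) :
    chordal (param b u) (param b w) = ‖u - w‖ / (max 1 ‖u‖ * max 1 ‖w‖) := by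
  induction b using OnePoint.rec with
  | infty =>
    by_cases hu : u = 0 <;> by_cases hw : w = 0
    · simp [param, chordal, hu, hw]
    · have hw' : ‖w‖ ≠ 0 := norm_ne_zero_iff.mpr hw
      simp only [param, chordal, hu, hw, if_true, if_false, max_one_norm_inv hw, zero_sub,
        norm_neg, norm_zero]
      simp
    · have hu' : ‖u‖ ≠ 0 := norm_ne_zero_iff.mpr hu
      simp only [param, chordal, hu, hw, if_true, if_false, max_one_norm_inv hu, sub_zero,
        norm_zero]
      simp
    · have hw' : ‖w‖ ≠ 0 := norm_ne_zero_iff.mpr hw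
      have hu' : ‖u‖ ≠ 0 := norm_ne_zero_iff.mpr hu
      have h1 : u⁻¹ - w⁻¹ = -(u - w) * (u⁻¹ * w⁻¹) := by field_simp; ring
      simp only [param, chordal, hu, hw, if_false, max_one_norm_inv hu, max_one_norm_inv hw, h1,
        norm_mul, norm_neg]
      rw [norm_inv, norm_inv]
      field_simp
  | coe a => simp [param, chordal]

theorem chordal_nonneg (x y : OnePoint F) : 0 ≤ chordal x y := by
  induction x using OnePoint.rec with
  | infty => induction y using OnePoint.rec with
    | infty => exact le_rfl
    | coe y => simp only [chordal]; positivity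
  | coe x => induction y using OnePoint.rec with
    | infty => simp only [chordal]; positivity
    | coe y => simp only [chordal]; positivity

theorem chordal_param_le (b : OnePoint F) (u w : F) :
    chordal (param b u) (param b w) ≤ ‖u - w‖ := by
  rw [chordal_param]
  refine div_le_self (norm_nonneg _) ?_
  have h1 := le_max_left 1 ‖u‖
  have h2 := le_max_left 1 ‖w‖
  nlinarith

/-- Only one point of the projective line is missed by a chart. -/
theorem eq_param_coord_of_chordal_lt {b x : OnePoint F} {u : F}
    (h : chordal x (param b u) < 1 / max 1 ‖u‖) : x = param b (coord b x) := by
  induction b using OnePoint.rec with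
  | infty =>
    induction x using OnePoint.rec with
    | infty => simp [param, coord]
    | coe x =>
      by_cases hx : x = 0
      · subst hx
        exfalso
        by_cases hu : u = 0
        · simp [param, chordal, hu] at h
        · have hu' : ‖u‖ ≠ 0 := norm_ne_zero_iff.mpr hu
          have hu0 : 0 < ‖u‖ := norm_pos_iff.mpr hu
          simp only [param, chordal, hu, if_false, zero_sub, norm_neg, norm_zero,
            max_one_norm_inv hu] at h
          refine h.ne ?_
          rw [norm_inv]
          simp only [zero_le_one, sup_of_le_left, one_mul]
          field_simp
      · simp [param, coord, hx]
  | coe a =>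
    induction x using OnePoint.rec with
    | infty => exact absurd h (lt_irrefl _)
    | coe x => simp [param, coord]

/-- The filter of chordal neighbourhoods of a point of the projective line. -/
noncomputable def pnhds (z : OnePoint F) : Filter (OnePoint F) := comap (fun x => chordal x z) (𝓝 0)

theorem tendsto_pnhds {ι : Type*} {l : Filter ι} {f : ι → OnePoint F} {z : OnePoint F} :
    Tendsto f l (pnhds z) ↔ Tendsto (fun i => chordal (f i) z) l (𝓝 0) := tendsto_comap_iff

/-- The charts are homeomorphisms onto their images, for the chordal metric. -/
theorem pnhds_param (b : OnePoint F) (u : F) : pnhds (param b u) = map (param b) (𝓝 u) := by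
  refine le_antisymm ?_ ?_
  · intro s hs
    rw [mem_map, Metric.mem_nhds_iff] at hs
    obtain ⟨ε, hε, hs⟩ := hs
    set A := max 1 ‖u‖ with hA
    have hA1 : 1 ≤ A := le_max_left _ _
    have hA0 : 0 < A := by linarith
    refine ⟨Metric.ball 0 (min (1 / (2 * A)) (ε / (2 * A ^ 2))),
      Metric.ball_mem_nhds _ (lt_min (by positivity) (by positivity)), ?_⟩
    intro x hx
    simp only [Set.mem_preimage, Metric.mem_ball, dist_zero_right, Real.norm_eq_abs,
      abs_of_nonneg (chordal_nonneg _ _), lt_min_iff] at hx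
    have hx1 : x = param b (coord b x) := by
      refine eq_param_coord_of_chordal_lt (hx.1.trans_le ?_)
      rw [← hA]
      gcongr
      linarith
    rw [hx1]
    refine hs ?_
    show dist _ _ < ε
    set w := coord b x
    rw [hx1, chordal_param, ← hA] at hx
    have hw0 : 0 < max 1 ‖w‖ := by positivity
    rw [div_lt_div_iff₀ (by positivity) (by positivity),
      div_lt_div_iff₀ (by positivity) (by positivity)] at hx
    have hw : max 1 ‖w‖ ≤ A + ‖w - u‖ := by
      refine max_le (by linarith [norm_nonneg (w - u)]) ?_
      have h1 : ‖w‖ ≤ ‖u‖ + ‖w - u‖ := by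
        have := norm_add_le u (w - u); rwa [add_sub_cancel] at this
      linarith [le_max_right 1 ‖u‖]
    rw [dist_eq_norm]
    have h0 := norm_nonneg (w - u)
    have hx1' : ‖w - u‖ * 2 < max 1 ‖w‖ := by
      have : ‖w - u‖ * 2 * A < max 1 ‖w‖ * A := by linarith [hx.1]
      exact lt_of_mul_lt_mul_right this hA0.le
    have hx2' : ‖w - u‖ * (2 * A) < ε * max 1 ‖w‖ := by
      have : ‖w - u‖ * (2 * A) * A < ε * max 1 ‖w‖ * A := by nlinarith [hx.2]
      exact lt_of_mul_lt_mul_right this hA0.le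
    have h2 : max 1 ‖w‖ < 2 * A := by linarith
    have h3 : ‖w - u‖ * (2 * A) < ε * (2 * A) := hx2'.trans (by gcongr)
    exact lt_of_mul_lt_mul_right h3 (by positivity)
  · show Tendsto (param b) (𝓝 u) (pnhds (param b u))
    rw [tendsto_pnhds]
    refine squeeze_zero (fun w => chordal_nonneg _ _) (fun w => chordal_param_le b w u) ?_
    have : Tendsto (fun w => ‖w - u‖) (𝓝 u) (𝓝 ‖u - u‖) :=
      (continuous_id.sub continuous_const).norm.tendsto u
    simpa using this

theorem pnhds_eq_map (z : OnePoint F) : pnhds z = map (param z) (𝓝 (coord z z)) := by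
  conv_lhs => rw [← param_coord_self z]
  exact pnhds_param _ _

theorem disjoint_pnhds {y z : OnePoint F} (h : y ≠ z) : Disjoint (pnhds y) (pnhds z) := by
  have hinf : ∀ b : F, Disjoint (pnhds OnePoint.infty) (pnhds (OnePoint.some b)) := by
    intro b
    have h1 : ContinuousAt (fun w : F => 1 / max 1 ‖w‖) b :=
      continuousAt_const.div (by fun_prop) (by positivity)
    have h2 : 0 < 1 / max 1 ‖b‖ := by positivity
    refine Filter.disjoint_iff.mpr ⟨{x | chordal x OnePoint.infty < 1 / max 1 ‖b‖ / 2},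
      preimage_mem_comap (Iio_mem_nhds (half_pos h2)),
      {x | 1 / max 1 ‖b‖ / 2 < chordal x OnePoint.infty}, ?_,
      Set.disjoint_left.mpr fun x h3 h4 => ?_⟩
    · rw [pnhds_eq_map]
      exact h1.tendsto.eventually_const_lt (half_lt_self h2)
    · rw [Set.mem_ofPred_eq] at h3 h4
      exact lt_asymm h3 h4
  induction y using OnePoint.rec with
  | infty => induction z using OnePoint.rec with
    | infty => exact absurd rfl h
    | coe z => exact hinf z
  | coe y => induction z using OnePoint.rec with
    | infty => exact (hinf y).symm
    | coe z =>
      rw [pnhds_eq_map, pnhds_eq_map]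
      exact (Filter.disjoint_map (OnePoint.coe_injective)).mpr
        (disjoint_nhds_nhds.mpr fun h1 => h (congrArg _ h1))

theorem tendsto_param (b : OnePoint F) (u : F) : Tendsto (param b) (𝓝 u) (pnhds (param b u)) :=
  (pnhds_param b u).ge

theorem eventually_pnhds_param {b : OnePoint F} {u : F} {P : OnePoint F → Prop} :
    (∀ᶠ x in pnhds (param b u), P x) ↔ ∀ᶠ w in 𝓝 u, P (param b w) := by
  rw [pnhds_param, eventually_map]

theorem tendsto_param_iff {ι : Type*} {l : Filter ι} {g : ι → F} {b : OnePoint F} {u : F} :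
    Tendsto (fun i => param b (g i)) l (pnhds (param b u)) ↔ Tendsto g l (𝓝 u) := by
  rw [pnhds_param]
  constructor
  · intro h
    have h1 : Tendsto (coord b) (map (param b) (𝓝 u)) (𝓝 u) := by
      rw [tendsto_map'_iff]
      refine Tendsto.congr (fun w => (coord_param b w).symm) tendsto_id
    exact (h1.comp h).congr fun i => coord_param b _
  · exact fun h => tendsto_map.comp h

theorem tendsto_coord_of_tendsto_pnhds {ι : Type*} {l : Filter ι} {g : ι → OnePoint F}
    {b : OnePoint F} {u : F} (h : Tendsto g l (pnhds (param b u))) :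
    Tendsto (fun i => coord b (g i)) l (𝓝 u) ∧ ∀ᶠ i in l, g i = param b (coord b (g i)) := by
  have h1 : ∀ᶠ x in pnhds (param b u), x = param b (coord b x) := by
    rw [eventually_pnhds_param]
    exact Eventually.of_forall fun w => by rw [coord_param]
  have h2 := h.eventually h1
  exact ⟨tendsto_param_iff.mp (h.congr' h2), h2⟩

/-- Near a point, the chordal distance is bounded below by a multiple of the distance of the
coordinates; `chordal_param_le` is the upper bound. -/
theorem chordal_param_asymp (b : OnePoint F) (u : F) : ∃ c : ℝ, 0 < c ∧
    ∀ᶠ w in 𝓝 u, c * ‖w - u‖ ≤ chordal (param b w) (param b u) := by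
  set A := max 1 ‖u‖ with hA
  have hA0 : 0 < A := by positivity
  refine ⟨1 / ((A + 1) * A), by positivity, ?_⟩
  have h1 : ∀ᶠ w in 𝓝 u, ‖w‖ < A + 1 :=
    (continuous_norm.tendsto u).eventually_lt_const (by linarith [le_max_right 1 ‖u‖])
  filter_upwards [h1] with w hw
  rw [chordal_param, ← hA, one_div, inv_mul_eq_div]
  gcongr
  exact max_le (by linarith [le_max_left 1 ‖u‖]) hw.le

/-- The local degree of `f` at `z` in metric terms: the distance to `f z` of the image of a point
near `z` is comparable to the `n`-th power of its distance to `z`. In contrast with `localDegree`,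
no coordinates are involved. -/
def HasDeg (f : OnePoint F → OnePoint F) (z : OnePoint F) (n : ℕ) : Prop :=
  ∃ c C : ℝ, 0 < c ∧ ∀ᶠ x in pnhds z,
    c * chordal x z ^ n ≤ chordal (f x) (f z) ∧ chordal (f x) (f z) ≤ C * chordal x z ^ n

namespace HasDeg

variable {f g : OnePoint F → OnePoint F} {z : OnePoint F} {m n : ℕ}

theorem tendsto (h : HasDeg f z n) (hn : n ≠ 0) : Tendsto f (pnhds z) (pnhds (f z)) := by
  obtain ⟨c, C, -, h⟩ := h
  rw [tendsto_pnhds]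
  have h1 : Tendsto (fun x => C * chordal x z ^ n) (pnhds z) (𝓝 (C * 0 ^ n)) :=
    ((tendsto_comap (f := fun x => chordal x z)).pow n).const_mul C
  rw [zero_pow hn, mul_zero] at h1
  exact squeeze_zero' (Eventually.of_forall fun x => chordal_nonneg _ _)
    (h.mono fun x hx => hx.2) h1

theorem comp (hg : HasDeg g (f z) n) (hf : HasDeg f z m) (hm : m ≠ 0) :
    HasDeg (g ∘ f) z (m * n) := by
  have ht := hf.tendsto hm
  obtain ⟨c, C, hc, h⟩ := hf
  obtain ⟨c', C', hc', h'⟩ := hg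
  refine ⟨c' * c ^ n, max C' 0 * C ^ n, by positivity, ?_⟩
  filter_upwards [h, ht.eventually h'] with x hx hx'
  have h0 := chordal_nonneg x z
  have h1 := chordal_nonneg (f x) (f z)
  constructor
  · calc c' * c ^ n * chordal x z ^ (m * n) = c' * (c * chordal x z ^ m) ^ n := by ring
      _ ≤ c' * chordal (f x) (f z) ^ n := by gcongr; exact hx.1
      _ ≤ _ := hx'.1
  · calc chordal (g (f x)) (g (f z)) ≤ C' * chordal (f x) (f z) ^ n := hx'.2
      _ ≤ max C' 0 * chordal (f x) (f z) ^ n := by gcongr; exact le_max_left _ _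
      _ ≤ max C' 0 * (C * chordal x z ^ m) ^ n := by gcongr; exact hx.2
      _ = _ := by ring

/-- If a map becomes a map of degree `n` after composition with a map of degree one, then it has
degree `n` itself. -/
theorem of_comp (hgf : HasDeg (g ∘ f) z n) (hg : HasDeg g (f z) 1)
    (hf : Tendsto f (pnhds z) (pnhds (f z))) : HasDeg f z n := by
  obtain ⟨c, C, hc, h⟩ := hgf
  obtain ⟨c', C', hc', h'⟩ := hg
  refine ⟨c / (max C' 1), C / c', by positivity, ?_⟩
  filter_upwards [h, hf.eventually h'] with x hx hx'
  simp only [pow_one, Function.comp_apply] at hx hx'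
  have h1 := chordal_nonneg (f x) (f z)
  constructor
  · rw [div_mul_eq_mul_div, div_le_iff₀ (by positivity)]
    calc c * chordal x z ^ n ≤ C' * chordal (f x) (f z) := hx.1.trans hx'.2
      _ ≤ max C' 1 * chordal (f x) (f z) := by gcongr; exact le_max_left _ _
      _ = _ := mul_comm _ _
  · rw [div_mul_eq_mul_div, le_div_iff₀ hc', mul_comm]
    exact hx'.1.trans hx.2

end HasDeg

section ChartDegree

variable {f : OnePoint F → OnePoint F} {b e : OnePoint F} {u : F} {Φ : F → F} {n m : ℕ}

/-- The metric degree can be computed in any two charts. -/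
theorem hasDeg_param_iff (hΦ : ContinuousAt Φ u) (hf : ∀ᶠ w in 𝓝 u, f (param b w) = param e (Φ w)) :
    HasDeg f (param b u) n ↔ ∃ c C : ℝ, 0 < c ∧ ∀ᶠ w in 𝓝 u,
      c * ‖w - u‖ ^ n ≤ ‖Φ w - Φ u‖ ∧ ‖Φ w - Φ u‖ ≤ C * ‖w - u‖ ^ n := by
  obtain ⟨c₁, hc₁, h₁⟩ := chordal_param_asymp b u
  obtain ⟨c₂, hc₂, h₂⟩ := chordal_param_asymp e (Φ u)
  have hfu := hf.self_of_nhds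
  constructor
  · rintro ⟨c, C, hc, h⟩
    rw [eventually_pnhds_param] at h
    refine ⟨c * c₁ ^ n, max C 0 / c₂, by positivity, ?_⟩
    filter_upwards [h, hf, h₁, hΦ.tendsto.eventually h₂] with w hw hfw h1 h2
    rw [hfu, hfw] at hw
    have h0 := chordal_nonneg (param b w) (param b u)
    constructor
    · calc c * c₁ ^ n * ‖w - u‖ ^ n = c * (c₁ * ‖w - u‖) ^ n := by ring
        _ ≤ c * chordal (param b w) (param b u) ^ n := by gcongr
        _ ≤ _ := hw.1
        _ ≤ _ := chordal_param_le _ _ _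
    · rw [div_mul_eq_mul_div, le_div_iff₀ hc₂, mul_comm]
      calc _ ≤ _ := h2
        _ ≤ C * chordal (param b w) (param b u) ^ n := hw.2
        _ ≤ max C 0 * chordal (param b w) (param b u) ^ n := by gcongr; exact le_max_left _ _
        _ ≤ _ := by gcongr; exact chordal_param_le _ _ _
  · rintro ⟨c, C, hc, h⟩
    refine ⟨c₂ * c, max C 0 / c₁ ^ n, by positivity, ?_⟩
    rw [eventually_pnhds_param]
    filter_upwards [h, hf, h₁, hΦ.tendsto.eventually h₂] with w hw hfw h1 h2
    rw [hfu, hfw]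
    have h0 := chordal_nonneg (param b w) (param b u)
    constructor
    · calc c₂ * c * chordal (param b w) (param b u) ^ n ≤ c₂ * c * ‖w - u‖ ^ n := by
            gcongr; exact chordal_param_le _ _ _
        _ = c₂ * (c * ‖w - u‖ ^ n) := by ring
        _ ≤ c₂ * ‖Φ w - Φ u‖ := by gcongr; exact hw.1
        _ ≤ _ := h2
    · rw [div_mul_eq_mul_div, le_div_iff₀ (by positivity)]
      calc chordal (param e (Φ w)) (param e (Φ u)) * c₁ ^ n ≤ ‖Φ w - Φ u‖ * c₁ ^ n := by
            gcongr; exact chordal_param_le _ _ _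
        _ ≤ (max C 0 * ‖w - u‖ ^ n) * c₁ ^ n := by
            gcongr
            exact hw.2.trans (by gcongr; exact le_max_left _ _)
        _ = max C 0 * (c₁ * ‖w - u‖) ^ n := by ring
        _ ≤ _ := by gcongr

theorem norm_asymp_unique {ψ : F → ℝ} {c C c' C' : ℝ} (hc : 0 < c) (hc' : 0 < c')
    (h : ∀ᶠ w in 𝓝 u, c * ‖w - u‖ ^ n ≤ ψ w ∧ ψ w ≤ C * ‖w - u‖ ^ n)
    (h' : ∀ᶠ w in 𝓝 u, c' * ‖w - u‖ ^ m ≤ ψ w ∧ ψ w ≤ C' * ‖w - u‖ ^ m) : n = m := by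
  have aux : ∀ {n m : ℕ} {c C c' C' : ℝ}, 0 < c → 0 < c' →
    (∀ᶠ w in 𝓝 u, c * ‖w - u‖ ^ n ≤ ψ w ∧ ψ w ≤ C * ‖w - u‖ ^ n) →
    (∀ᶠ w in 𝓝 u, c' * ‖w - u‖ ^ m ≤ ψ w ∧ ψ w ≤ C' * ‖w - u‖ ^ m) → ¬ n < m := by
    intro n m c C c' C' hc hc' h h' hlt
    have h1 : Tendsto (fun w => C' * ‖w - u‖ ^ (m - n)) (𝓝[≠] u) (𝓝 (C' * ‖u - u‖ ^ (m - n))) :=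
      ((((continuous_id.sub continuous_const).norm.pow _).const_mul C').tendsto u).mono_left
        nhdsWithin_le_nhds
    rw [sub_self, norm_zero, zero_pow (by omega), mul_zero] at h1
    obtain ⟨w, hw, hw1, hw2, hw3⟩ := ((h1.eventually_lt_const hc).and
      ((h.filter_mono nhdsWithin_le_nhds).and ((h'.filter_mono nhdsWithin_le_nhds).and
        self_mem_nhdsWithin))).exists
    have hpos : 0 < ‖w - u‖ := norm_pos_iff.mpr (sub_ne_zero.mpr hw3)
    have h2 := hw1.1.trans hw2.2
    have h3 : ‖w - u‖ ^ m = ‖w - u‖ ^ (m - n) * ‖w - u‖ ^ n := by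
      rw [← pow_add]; congr 1; omega
    rw [h3, ← mul_assoc] at h2
    exact absurd (le_of_mul_le_mul_right h2 (by positivity)) (not_le.mpr hw)
  have h1 := aux hc hc' h h'
  have h2 := aux hc' hc h' h
  omega

theorem norm_asymp_of_analyticOrderAt {ψ : F → F} (hψ : AnalyticAt F ψ u)
    (h : analyticOrderAt ψ u = n) : ∃ c C : ℝ, 0 < c ∧ ∀ᶠ w in 𝓝 u,
      c * ‖w - u‖ ^ n ≤ ‖ψ w‖ ∧ ‖ψ w‖ ≤ C * ‖w - u‖ ^ n := by
  obtain ⟨g, hg, hg0, hgψ⟩ := hψ.analyticOrderAt_eq_natCast.mp h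
  have hpos : 0 < ‖g u‖ := norm_pos_iff.mpr hg0
  refine ⟨‖g u‖ / 2, ‖g u‖ + 1, by positivity, ?_⟩
  have hc := hg.continuousAt.norm.tendsto
  filter_upwards [hgψ, hc.eventually_const_le (show ‖g u‖ / 2 < ‖g u‖ by linarith),
    hc.eventually_le_const (show ‖g u‖ < ‖g u‖ + 1 by linarith)] with w h1 h2 h3
  rw [h1, smul_eq_mul, norm_mul, norm_pow, mul_comm (‖w - u‖ ^ n)]
  exact ⟨by gcongr, by gcongr⟩

theorem analyticOrderAt_of_norm_asymp {ψ : F → F} (hψ : AnalyticAt F ψ u) {c C : ℝ} (hc : 0 < c)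
    (h : ∀ᶠ w in 𝓝 u, c * ‖w - u‖ ^ n ≤ ‖ψ w‖ ∧ ‖ψ w‖ ≤ C * ‖w - u‖ ^ n) :
    analyticOrderAt ψ u = n := by
  cases hm : analyticOrderAt ψ u with
  | top =>
    exfalso
    rw [analyticOrderAt_eq_top] at hm
    obtain ⟨w, hw1, hw2, hw3⟩ := ((h.filter_mono nhdsWithin_le_nhds).and
      ((hm.filter_mono nhdsWithin_le_nhds).and (self_mem_nhdsWithin (a := u) (s := {u}ᶜ)))).exists
    have hpos : 0 < ‖w - u‖ := norm_pos_iff.mpr (sub_ne_zero.mpr hw3)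
    rw [hw2, norm_zero] at hw1
    have : 0 < c * ‖w - u‖ ^ n := by positivity
    linarith [hw1.1]
  | coe m =>
    obtain ⟨c', C', hc', h'⟩ := norm_asymp_of_analyticOrderAt hψ hm
    rw [norm_asymp_unique hc' hc h' h]

theorem hasDeg_iff_order (hΦ : AnalyticAt F Φ u)
    (hf : ∀ᶠ w in 𝓝 u, f (param b w) = param e (Φ w)) :
    HasDeg f (param b u) n ↔ analyticOrderAt (fun w => Φ w - Φ u) u = n := by
  rw [hasDeg_param_iff hΦ.continuousAt hf]
  constructor
  · rintro ⟨c, C, hc, h⟩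
    exact analyticOrderAt_of_norm_asymp (hΦ.sub analyticAt_const) hc h
  · exact fun h => norm_asymp_of_analyticOrderAt (hΦ.sub analyticAt_const) h

/-- `f` is analytic at `z` in the coordinates at `z` and `f z`. -/
def ChartAnalyticAt (f : OnePoint F → OnePoint F) (z : OnePoint F) : Prop :=
  AnalyticAt F (chartMap f z) (coord z z) ∧
    ∀ᶠ w in 𝓝 (coord z z), f (param z w) = param (f z) (chartMap f z w)

theorem chartMap_coord_self (f : OnePoint F → OnePoint F) (z : OnePoint F) :
    chartMap f z (coord z z) = coord (f z) (f z) := by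
  rw [chartMap, param_coord_self]

theorem ChartAnalyticAt.localDegree_eq_iff {z : OnePoint F} (h : ChartAnalyticAt f z) :
    localDegree f z = n ↔ HasDeg f z n := by
  have := hasDeg_iff_order (n := n) h.1 h.2
  rw [param_coord_self, chartMap_coord_self] at this
  exact this.symm

theorem ChartAnalyticAt.tendsto {z : OnePoint F} (h : ChartAnalyticAt f z) :
    Tendsto f (pnhds z) (pnhds (f z)) := by
  rw [pnhds_eq_map z, tendsto_map'_iff, pnhds_eq_map, ← chartMap_coord_self]
  refine (tendsto_map.comp h.1.continuousAt.tendsto).congr' ?_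
  filter_upwards [h.2] with w hw using hw.symm

theorem ChartAnalyticAt.unique {z : OnePoint F} (h : ChartAnalyticAt f z) (hn : HasDeg f z n)
    (hm : HasDeg f z m) : n = m := by
  rw [← h.localDegree_eq_iff] at hn hm
  rw [hn] at hm
  exact_mod_cast hm

/-- The degree of a rational map at a point is a positive integer, unless the map is locally
constant. -/
theorem ChartAnalyticAt.exists_hasDeg {z : OnePoint F} (h : ChartAnalyticAt f z) :
    (∃ n, n ≠ 0 ∧ HasDeg f z n) ∨ ∀ᶠ x in pnhds z, f x = f z := by
  cases hm : localDegree f z with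
  | top =>
    right
    rw [localDegree, analyticOrderAt_eq_top] at hm
    rw [pnhds_eq_map, eventually_map]
    filter_upwards [h.2, hm] with w hw h1
    rw [hw, sub_eq_zero.mp h1, param_coord_self]
  | coe n =>
    left
    refine ⟨n, ?_, h.localDegree_eq_iff.mp hm⟩
    rintro rfl
    rw [localDegree, Nat.cast_zero, analyticOrderAt_eq_zero] at hm
    rcases hm with hm | hm
    · exact hm (h.1.sub analyticAt_const)
    · exact hm (by rw [chartMap_coord_self, sub_self])

/-- If the composition of two maps has degree one, then so do both. -/
theorem HasDeg.one_of_comp {g : OnePoint F → OnePoint F} {z : OnePoint F}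
    (h : HasDeg (g ∘ f) z 1) (hf : ChartAnalyticAt f z) (hg : ChartAnalyticAt g (f z))
    (hgf : ChartAnalyticAt (g ∘ f) z) : HasDeg f z 1 ∧ HasDeg g (f z) 1 := by
  have hconst : ¬ ∀ᶠ x in pnhds z, (g ∘ f) x = (g ∘ f) z := by
    intro hc
    obtain ⟨c, C, hc0, h⟩ := h
    have h1 := (h.and hc)
    have hz := param_coord_self z
    rw [pnhds_eq_map, eventually_map] at h1
    obtain ⟨c₁, hc₁, h₁⟩ := chordal_param_asymp z (coord z z)
    obtain ⟨w, ⟨hw1, hw2⟩, hw3, hw4⟩ := ((h1.filter_mono nhdsWithin_le_nhds).and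
      ((h₁.filter_mono nhdsWithin_le_nhds).and
        (self_mem_nhdsWithin (a := coord z z) (s := {coord z z}ᶜ)))).exists
    have hpos : 0 < ‖w - coord z z‖ := norm_pos_iff.mpr (sub_ne_zero.mpr hw4)
    have h0 : chordal ((g ∘ f) z) ((g ∘ f) z) = 0 := by
      rw [← param_coord_self ((g ∘ f) z), chordal_param]; simp
    rw [hw2, h0, pow_one] at hw1
    rw [hz] at hw3
    have : 0 < c * (c₁ * ‖w - coord z z‖) := by positivity
    have h2 : c * (c₁ * ‖w - coord z z‖) ≤ c * chordal (param z w) z := by gcongr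
    linarith [hw1.1]
  rcases hf.exists_hasDeg with ⟨m, hm0, hm⟩ | hfc
  · rcases hg.exists_hasDeg with ⟨n, hn0, hn⟩ | hgc
    · have hmn := hgf.unique (hn.comp hm hm0) h
      rw [mul_eq_one] at hmn
      obtain ⟨rfl, rfl⟩ := hmn
      exact ⟨hm, hn⟩
    · exact absurd (hf.tendsto.eventually hgc) hconst
  · exact absurd (hfc.mono fun x hx => by simp [hx]) hconst

end ChartDegree

end Charts

/-! ### Analytic functions and polynomials over a subfield -/

section PolyFamily

open Polynomial

variable {F : Type*} [NontriviallyNormedField F] {K : Subfield F} {t₁ : F}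

/-- A function of one variable that is analytic at `t₁` and takes values in `K` at the points of `K`
close to `t₁`. -/
structure AnalyticOver (K : Subfield F) (t₁ : F) (g : F → F) : Prop where
  analyticAt : AnalyticAt F g t₁
  mem : ∀ᶠ t in 𝓝 t₁, t ∈ K → g t ∈ K

/-- A function of two variables that is analytic at a point and takes values in `K` at the points
of `K × K` close to this point. -/
structure AnalyticOver₂ (K : Subfield F) (z₁ : F × F) (g : F × F → F) : Prop where
  analyticAt : AnalyticAt F g z₁
  mem : ∀ᶠ z in 𝓝 z₁, z.1 ∈ K → z.2 ∈ K → g z ∈ K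

/-- A family of polynomials of bounded degree whose coefficients are analytic functions of the
parameter near `t₁`, with values in `K` at the parameters in `K`. -/
structure PolyFamily (K : Subfield F) (t₁ : F) (P : F → F[X]) : Prop where
  bdd : ∃ D, ∀ t, (P t).natDegree ≤ D
  coeff : ∀ k, AnalyticOver K t₁ fun t => (P t).coeff k

namespace AnalyticOver

variable {g h : F → F}

theorem const {c : F} (hc : c ∈ K) : AnalyticOver K t₁ fun _ => c :=
  ⟨analyticAt_const, Eventually.of_forall fun _ _ => hc⟩

theorem add (hg : AnalyticOver K t₁ g) (hh : AnalyticOver K t₁ h) :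
    AnalyticOver K t₁ fun t => g t + h t :=
  ⟨hg.1.add hh.1, by filter_upwards [hg.2, hh.2] with t h1 h2 ht using add_mem (h1 ht) (h2 ht)⟩

theorem sub (hg : AnalyticOver K t₁ g) (hh : AnalyticOver K t₁ h) :
    AnalyticOver K t₁ fun t => g t - h t :=
  ⟨hg.1.sub hh.1, by filter_upwards [hg.2, hh.2] with t h1 h2 ht using sub_mem (h1 ht) (h2 ht)⟩

theorem mul (hg : AnalyticOver K t₁ g) (hh : AnalyticOver K t₁ h) :
    AnalyticOver K t₁ fun t => g t * h t :=
  ⟨hg.1.mul hh.1, by filter_upwards [hg.2, hh.2] with t h1 h2 ht using mul_mem (h1 ht) (h2 ht)⟩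

theorem sum {ι : Type*} {s : Finset ι} {g : ι → F → F} (hg : ∀ i ∈ s, AnalyticOver K t₁ (g i)) :
    AnalyticOver K t₁ fun t => ∑ i ∈ s, g i t := by
  classical
  induction s using Finset.induction_on with
  | empty => simpa using const (zero_mem K)
  | insert a s ha ih =>
    simp only [Finset.sum_insert ha]
    exact (hg a (Finset.mem_insert_self _ _)).add
      (ih fun i hi => hg i (Finset.mem_insert_of_mem hi))

end AnalyticOver

namespace AnalyticOver₂

variable {g h : F × F → F} {z₁ : F × F}

theorem snd : AnalyticOver₂ K z₁ Prod.snd :=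
  ⟨analyticAt_snd, Eventually.of_forall fun _ _ h => h⟩

theorem add (hg : AnalyticOver₂ K z₁ g) (hh : AnalyticOver₂ K z₁ h) :
    AnalyticOver₂ K z₁ fun t => g t + h t :=
  ⟨hg.1.add hh.1, by
    filter_upwards [hg.2, hh.2] with t h1 h2 ht ht' using add_mem (h1 ht ht') (h2 ht ht')⟩

theorem sub (hg : AnalyticOver₂ K z₁ g) (hh : AnalyticOver₂ K z₁ h) :
    AnalyticOver₂ K z₁ fun t => g t - h t :=
  ⟨hg.1.sub hh.1, by
    filter_upwards [hg.2, hh.2] with t h1 h2 ht ht' using sub_mem (h1 ht ht') (h2 ht ht')⟩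

theorem mul (hg : AnalyticOver₂ K z₁ g) (hh : AnalyticOver₂ K z₁ h) :
    AnalyticOver₂ K z₁ fun t => g t * h t :=
  ⟨hg.1.mul hh.1, by
    filter_upwards [hg.2, hh.2] with t h1 h2 ht ht' using mul_mem (h1 ht ht') (h2 ht ht')⟩

theorem div (hg : AnalyticOver₂ K z₁ g) (hh : AnalyticOver₂ K z₁ h) (h0 : h z₁ ≠ 0) :
    AnalyticOver₂ K z₁ fun t => g t / h t :=
  ⟨hg.1.div hh.1 h0, by
    filter_upwards [hg.2, hh.2] with t h1 h2 ht ht' using div_mem (h1 ht ht') (h2 ht ht')⟩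

theorem pow (hg : AnalyticOver₂ K z₁ g) (n : ℕ) : AnalyticOver₂ K z₁ fun t => g t ^ n :=
  ⟨hg.1.pow n, by
    filter_upwards [hg.2] with t h1 ht ht' using pow_mem (h1 ht ht') n⟩

theorem const {c : F} (hc : c ∈ K) : AnalyticOver₂ K z₁ fun _ => c :=
  ⟨analyticAt_const, Eventually.of_forall fun _ _ _ => hc⟩

theorem of_fst {g : F → F} (hg : AnalyticOver K z₁.1 g) : AnalyticOver₂ K z₁ fun z => g z.1 :=
  ⟨hg.1.comp analyticAt_fst, by
    filter_upwards [(continuous_fst.tendsto z₁).eventually hg.2] with z hz h _ using hz h⟩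

theorem sum {ι : Type*} {s : Finset ι} {g : ι → F × F → F}
    (hg : ∀ i ∈ s, AnalyticOver₂ K z₁ (g i)) : AnalyticOver₂ K z₁ fun t => ∑ i ∈ s, g i t := by
  classical
  induction s using Finset.induction_on with
  | empty => simpa using const (zero_mem K)
  | insert a s ha ih =>
    simp only [Finset.sum_insert ha]
    exact (hg a (Finset.mem_insert_self _ _)).add
      (ih fun i hi => hg i (Finset.mem_insert_of_mem hi))

/-- Restriction of a function of two variables to a curve. -/
theorem comp_curve {σ : F → F} (hg : AnalyticOver₂ K (t₁, σ t₁) g) (hσ : AnalyticOver K t₁ σ) :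
    AnalyticOver K t₁ fun t => g (t, σ t) := by
  have h1 : AnalyticAt F (fun t => (t, σ t)) t₁ := AnalyticAt.prod analyticAt_id hσ.1
  refine ⟨AnalyticAt.comp (g := g) hg.1 h1, ?_⟩
  filter_upwards [h1.continuousAt.tendsto.eventually hg.2, hσ.2] with t h2 h3 ht using h2 ht (h3 ht)

end AnalyticOver₂

namespace PolyFamily

variable {P Q : F → F[X]}

theorem const {p : F[X]} (hp : ∀ k, p.coeff k ∈ K) : PolyFamily K t₁ fun _ => p :=
  ⟨⟨p.natDegree, fun _ => le_rfl⟩, fun k => .const (hp k)⟩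

theorem one : PolyFamily K t₁ fun _ => (1 : F[X]) := const fun k => by
  rw [coeff_one]; split_ifs; exacts [one_mem K, zero_mem K]

theorem X : PolyFamily K t₁ fun _ => (Polynomial.X : F[X]) := const fun k => by
  rw [coeff_X]; split_ifs; exacts [one_mem K, zero_mem K]

theorem C {g : F → F} (hg : AnalyticOver K t₁ g) : PolyFamily K t₁ fun t => Polynomial.C (g t) := by
  refine ⟨⟨0, fun t => by simp⟩, fun k => ?_⟩
  by_cases hk : k = 0
  · simpa [hk] using hg
  · simpa [coeff_C, hk] using AnalyticOver.const (zero_mem K)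

theorem add (hP : PolyFamily K t₁ P) (hQ : PolyFamily K t₁ Q) :
    PolyFamily K t₁ fun t => P t + Q t := by
  obtain ⟨D, hD⟩ := hP.bdd
  obtain ⟨D', hD'⟩ := hQ.bdd
  refine ⟨⟨max D D', fun t => (natDegree_add_le _ _).trans (max_le_max (hD t) (hD' t))⟩,
    fun k => ?_⟩
  simpa only [coeff_add] using (hP.coeff k).add (hQ.coeff k)

theorem sub (hP : PolyFamily K t₁ P) (hQ : PolyFamily K t₁ Q) :
    PolyFamily K t₁ fun t => P t - Q t := by
  obtain ⟨D, hD⟩ := hP.bdd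
  obtain ⟨D', hD'⟩ := hQ.bdd
  refine ⟨⟨max D D', fun t => (natDegree_sub_le _ _).trans (max_le_max (hD t) (hD' t))⟩,
    fun k => ?_⟩
  simpa only [coeff_sub] using (hP.coeff k).sub (hQ.coeff k)

theorem mul (hP : PolyFamily K t₁ P) (hQ : PolyFamily K t₁ Q) :
    PolyFamily K t₁ fun t => P t * Q t := by
  obtain ⟨D, hD⟩ := hP.bdd
  obtain ⟨D', hD'⟩ := hQ.bdd
  refine ⟨⟨D + D', fun t => natDegree_mul_le.trans (add_le_add (hD t) (hD' t))⟩, fun k => ?_⟩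
  simp only [coeff_mul]
  exact AnalyticOver.sum fun i _ => (hP.coeff _).mul (hQ.coeff _)

theorem pow (hP : PolyFamily K t₁ P) (n : ℕ) : PolyFamily K t₁ fun t => P t ^ n := by
  induction n with
  | zero => simpa using one
  | succ n ih => simpa only [pow_succ] using ih.mul hP

theorem sum {ι : Type*} {s : Finset ι} {P : ι → F → F[X]} (hP : ∀ i ∈ s, PolyFamily K t₁ (P i)) :
    PolyFamily K t₁ fun t => ∑ i ∈ s, P i t := by
  classical
  induction s using Finset.induction_on with
  | empty => simpa using const (p := 0) fun k => by simp [zero_mem]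
  | insert a s ha ih =>
    simp only [Finset.sum_insert ha]
    exact (hP a (Finset.mem_insert_self _ _)).add
      (ih fun i hi => hP i (Finset.mem_insert_of_mem hi))

theorem divX (hP : PolyFamily K t₁ P) : PolyFamily K t₁ fun t => (P t).divX := by
  obtain ⟨D, hD⟩ := hP.bdd
  refine ⟨⟨D, fun t => ?_⟩, fun k => by simpa only [coeff_divX] using hP.coeff (k + 1)⟩
  rw [natDegree_divX_eq_natDegree_tsub_one]
  exact (Nat.sub_le _ _).trans (hD t)

theorem eval (hP : PolyFamily K t₁ P) (v₁ : F) :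
    AnalyticOver₂ K (t₁, v₁) fun z => (P z.1).eval z.2 := by
  obtain ⟨D, hD⟩ := hP.bdd
  have h : ∀ z : F × F, (P z.1).eval z.2 = ∑ i ∈ Finset.range (D + 1), (P z.1).coeff i * z.2 ^ i :=
    fun z => eval_eq_sum_range' (Nat.lt_succ_of_le (hD z.1)) z.2
  simp only [h]
  refine AnalyticOver₂.sum fun i _ => ?_
  exact (AnalyticOver₂.of_fst (z₁ := (t₁, v₁)) (hP.coeff i)).mul (AnalyticOver₂.snd.pow i)

/-- Division of a family of polynomials by the power of the variable that divides all its
members. -/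
theorem exists_eq_pow_mul (hP : PolyFamily K t₁ P) (d : ℕ)
    (h : ∀ᶠ t in 𝓝 t₁, ∀ k < d, (P t).coeff k = 0) :
    ∃ Q : F → F[X], PolyFamily K t₁ Q ∧ ∀ᶠ t in 𝓝 t₁, P t = Polynomial.X ^ d * Q t := by
  induction d with
  | zero => exact ⟨P, hP, Eventually.of_forall fun t => by simp⟩
  | succ d ih =>
    obtain ⟨Q, hQ, hPQ⟩ := ih (h.mono fun t ht k hk => ht k (by omega))
    refine ⟨fun t => (Q t).divX, hQ.divX, ?_⟩
    filter_upwards [hPQ, h] with t ht ht'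
    have h0 : (Q t).coeff 0 = 0 := by
      have := ht' d (Nat.lt_succ_self d)
      rw [ht] at this
      simpa [coeff_X_pow_mul'] using this
    rw [ht, pow_succ, mul_assoc]
    congr 1
    conv_lhs => rw [← divX_mul_X_add (Q t), h0]
    simp [mul_comm]

end PolyFamily

/-- A polynomial of order at least `d` at the origin is divisible by the `d`-th power of the
variable. -/
theorem coeff_eq_zero_of_norm_eval_le {P : F[X]} {d : ℕ} {C : ℝ}
    (h : ∀ᶠ v in 𝓝 (0 : F), ‖P.eval v‖ ≤ C * ‖v‖ ^ d) : ∀ k < d, P.coeff k = 0 := by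
  intro k
  induction k using Nat.strong_induction_on with
  | _ k ih =>
    intro hk
    have hdvd : Polynomial.X ^ k ∣ P := X_pow_dvd_iff.mpr fun j hj => ih j hj (by omega)
    obtain ⟨Q, rfl⟩ := hdvd
    have h0 : (Polynomial.X ^ k * Q).coeff k = Q.eval 0 := by
      rw [← coeff_zero_eq_eval_zero]
      simpa using coeff_X_pow_mul Q k 0
    rw [h0]
    have h1 : Tendsto (fun v => C * ‖v‖ ^ (d - k)) (𝓝[≠] (0 : F)) (𝓝 (C * ‖(0 : F)‖ ^ (d - k))) :=
      (((continuous_norm.pow _).const_mul C).tendsto 0).mono_left nhdsWithin_le_nhds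
    rw [norm_zero, zero_pow (by omega), mul_zero] at h1
    have h2 : Tendsto (fun v => Q.eval v) (𝓝[≠] (0 : F)) (𝓝 (Q.eval 0)) :=
      (Q.continuous.tendsto 0).mono_left nhdsWithin_le_nhds
    have h3 : Tendsto (fun v => Q.eval v) (𝓝[≠] (0 : F)) (𝓝 0) := by
      refine squeeze_zero_norm' ?_ h1
      filter_upwards [h.filter_mono nhdsWithin_le_nhds, self_mem_nhdsWithin] with v hv hv0
      have hpos : 0 < ‖v‖ := norm_pos_iff.mpr hv0
      rw [eval_mul, eval_pow, eval_X, norm_mul, norm_pow] at hv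
      have h4 : ‖v‖ ^ d = ‖v‖ ^ (d - k) * ‖v‖ ^ k := by rw [← pow_add]; congr 1; omega
      rw [h4, ← mul_assoc, mul_comm] at hv
      exact le_of_mul_le_mul_right hv (by positivity)
    exact tendsto_nhds_unique h2 h3

end PolyFamily

/-! ### Analytic families of rational maps -/

section AnalyticRational

open Polynomial

variable {F : Type*} [NontriviallyNormedField F] {K : Subfield F} {t₁ : F}

/-- The value at `(x, y)` of the homogenization of degree `N` of the polynomial `P`. -/
def homogEval (N : ℕ) (P : F[X]) (x y : F) : F :=
  ∑ i ∈ Finset.range (N + 1), P.coeff i * x ^ i * y ^ (N - i)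

theorem homogEval_of_ne_zero {N : ℕ} {P : F[X]} (hP : P.natDegree ≤ N) {x y : F} (hy : y ≠ 0) :
    homogEval N P x y = y ^ N * P.eval (x / y) := by
  rw [homogEval, eval_eq_sum_range' (Nat.lt_succ_of_le hP), Finset.mul_sum]
  refine Finset.sum_congr rfl fun i hi => ?_
  have hi : i ≤ N := Nat.lt_succ_iff.mp (Finset.mem_range.mp hi)
  have : y ^ N = y ^ (N - i) * y ^ i := by rw [← pow_add]; congr 1; omega
  rw [this, div_pow]
  field_simp

theorem homogEval_zero (N : ℕ) (P : F[X]) (x : F) : homogEval N P x 0 = P.coeff N * x ^ N := by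
  rw [homogEval, Finset.sum_range_succ, Finset.sum_eq_zero]
  · simp
  · intro i hi
    rw [zero_pow (by have := Finset.mem_range.mp hi; omega), mul_zero]

/-- In homogeneous coordinates a rational map is given by a pair of homogeneous polynomials without
common zero. -/
theorem ratEval_homPt {N : ℕ} {P Q : F[X]} (hPQ : IsCoprime P Q)
    (hN : max P.natDegree Q.natDegree = N) {x y : F} (hxy : x ≠ 0 ∨ y ≠ 0) :
    ratEval N P Q (homPt x y) = homPt (homogEval N P x y) (homogEval N Q x y) ∧
      (homogEval N P x y ≠ 0 ∨ homogEval N Q x y ≠ 0) := by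
  have hP : P.natDegree ≤ N := hN ▸ le_max_left _ _
  have hQ : Q.natDegree ≤ N := hN ▸ le_max_right _ _
  by_cases hy : y = 0
  · subst hy
    simp only [ne_eq, not_true_eq_false, or_false] at hxy
    have hxN : x ^ N ≠ 0 := pow_ne_zero _ hxy
    rw [homogEval_zero, homogEval_zero]
    constructor
    · by_cases h : Q.coeff N = 0
      · simp [homPt, ratEval, h]
      · simp [homPt, ratEval, h, hxN, mul_div_mul_right]
    · by_contra! h
      simp only [mul_eq_zero, hxN, or_false] at h
      obtain ⟨u, v, huv⟩ := hPQ
      rcases Nat.eq_zero_or_pos N with h0 | h0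
      · subst h0
        have h1 := congrArg (Polynomial.eval 0) huv
        rw [coeff_zero_eq_eval_zero, coeff_zero_eq_eval_zero] at h
        simp [h.1, h.2] at h1
      · rcases max_choice P.natDegree Q.natDegree with hm | hm
        · have : P.leadingCoeff = 0 := by rw [leadingCoeff, ← hm, hN]; exact h.1
          rw [leadingCoeff_eq_zero] at this
          simp [this] at hm hN
          omega
        · have : Q.leadingCoeff = 0 := by rw [leadingCoeff, ← hm, hN]; exact h.2
          rw [leadingCoeff_eq_zero] at this
          simp [this] at hm hN
          omega
  · have hyN : y ^ N ≠ 0 := pow_ne_zero _ hy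
    rw [homogEval_of_ne_zero hP hy, homogEval_of_ne_zero hQ hy]
    constructor
    · by_cases h : Q.eval (x / y) = 0
      · simp [homPt, ratEval, h, hy]
      · simp [homPt, ratEval, h, hy, mul_div_mul_left]
    · by_contra! h
      simp only [mul_eq_zero, hyN, false_or] at h
      obtain ⟨u, v, huv⟩ := hPQ
      have h1 := congrArg (Polynomial.eval (x / y)) huv
      simp [h.1, h.2] at h1

/-- A family of rational maps of constant degree, whose coefficients depend analytically on the
parameter near `t₁` and lie in `K` when the parameter does. -/
def AnalyticRational (K : Subfield F) (t₁ : F) (f : F → OnePoint F → OnePoint F) : Prop :=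
  ∃ (N : ℕ) (P Q : F → F[X]), PolyFamily K t₁ P ∧ PolyFamily K t₁ Q ∧
    ∀ᶠ t in 𝓝 t₁, IsCoprime (P t) (Q t) ∧ max (P t).natDegree (Q t).natDegree = N ∧
      f t = ratEval N (P t) (Q t)

theorem PolyFamily.homog {P A B : F → F[X]} (hP : PolyFamily K t₁ P) (hA : PolyFamily K t₁ A)
    (hB : PolyFamily K t₁ B) (N : ℕ) : PolyFamily K t₁ fun t =>
      ∑ i ∈ Finset.range (N + 1), Polynomial.C ((P t).coeff i) * A t ^ i * B t ^ (N - i) :=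
  PolyFamily.sum fun i _ => ((PolyFamily.C (hP.coeff i)).mul (hA.pow i)).mul (hB.pow _)

/-- A chart, translated by a function of the parameter, in homogeneous coordinates. -/
theorem exists_lift_param (b : OnePoint F) {σ : F → F} (hσ : AnalyticOver K t₁ σ) :
    ∃ A B : F → F[X], PolyFamily K t₁ A ∧ PolyFamily K t₁ B ∧ ∀ t v,
      param b (σ t + v) = homPt ((A t).eval v) ((B t).eval v) ∧
        ((A t).eval v ≠ 0 ∨ (B t).eval v ≠ 0) := by
  have h1 : PolyFamily K t₁ fun t => Polynomial.C (σ t) + Polynomial.X :=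
    (PolyFamily.C hσ).add PolyFamily.X
  induction b using OnePoint.rec with
  | infty =>
    refine ⟨_, _, PolyFamily.one, h1, fun t v => ⟨?_, by simp⟩⟩
    by_cases hu : σ t + v = 0 <;> simp [homPt, param, hu]
  | coe a =>
    exact ⟨_, _, h1, PolyFamily.one, fun t v => ⟨by simp [homPt, param], by simp⟩⟩

variable {f : F → OnePoint F → OnePoint F}

/-- The iterates of an analytic family of rational maps lift to homogeneous coordinates as pairs of
families of polynomials in a coordinate of the source. -/
theorem exists_lift_iterate (hf : AnalyticRational K t₁ f) (b : OnePoint F) {σ : F → F}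
    (hσ : AnalyticOver K t₁ σ) (k : ℕ) :
    ∃ A B : F → F[X], PolyFamily K t₁ A ∧ PolyFamily K t₁ B ∧ ∀ᶠ t in 𝓝 t₁, ∀ v,
      (f t)^[k] (param b (σ t + v)) = homPt ((A t).eval v) ((B t).eval v) ∧
        ((A t).eval v ≠ 0 ∨ (B t).eval v ≠ 0) := by
  obtain ⟨N, P, Q, hP, hQ, hPQ⟩ := hf
  induction k with
  | zero =>
    obtain ⟨A, B, hA, hB, h⟩ := exists_lift_param b hσ
    exact ⟨A, B, hA, hB, Eventually.of_forall h⟩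
  | succ k ih =>
    obtain ⟨A, B, hA, hB, h⟩ := ih
    refine ⟨_, _, hP.homog hA hB N, hQ.homog hA hB N, ?_⟩
    filter_upwards [h, hPQ] with t ht ht' v
    obtain ⟨hcop, hN, hft⟩ := ht'
    have heval : ∀ P : F[X], (∑ i ∈ Finset.range (N + 1), Polynomial.C (P.coeff i) * A t ^ i
        * B t ^ (N - i)).eval v = homogEval N P ((A t).eval v) ((B t).eval v) := fun P => by
      simp [homogEval, eval_finsetSum]
    rw [heval, heval, Function.iterate_succ_apply', (ht v).1, hft]
    exact ratEval_homPt hcop hN (ht v).2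

/-- In the chart at `e`, an iterate of an analytic family of rational maps is a quotient of two
families of polynomials. -/
theorem exists_chart_poly (hf : AnalyticRational K t₁ f) (b e : OnePoint F) {σ : F → F}
    (hσ : AnalyticOver K t₁ σ) (k : ℕ) :
    ∃ n m : F → F[X], PolyFamily K t₁ n ∧ PolyFamily K t₁ m ∧ ∀ᶠ t in 𝓝 t₁, ∀ v, ∃ x y,
      (f t)^[k] (param b (σ t + v)) = homPt x y ∧ (x ≠ 0 ∨ y ≠ 0) ∧
      chartNum e x y = (n t).eval v ∧ chartDen e x y = (m t).eval v := by
  obtain ⟨A, B, hA, hB, h⟩ := exists_lift_iterate hf b hσ k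
  induction e using OnePoint.rec with
  | infty => exact ⟨B, A, hB, hA, h.mono fun t ht v => ⟨_, _, (ht v).1, (ht v).2, rfl, rfl⟩⟩
  | coe a => exact ⟨A, B, hA, hB, h.mono fun t ht v => ⟨_, _, (ht v).1, (ht v).2, rfl, rfl⟩⟩

/-- In charts, the iterates of an analytic family of rational maps are analytic functions of the
parameter and the variable. -/
theorem exists_chart (hf : AnalyticRational K t₁ f) {b e : OnePoint F} {σ : F → F}
    (hσ : AnalyticOver K t₁ σ) {k : ℕ} {v₁ x₁ : F}
    (h : (f t₁)^[k] (param b (σ t₁ + v₁)) = param e x₁) :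
    ∃ Φ : F × F → F, AnalyticOver₂ K (t₁, v₁) Φ ∧ Φ (t₁, v₁) = x₁ ∧
      ∀ᶠ z in 𝓝 (t₁, v₁), (f z.1)^[k] (param b (σ z.1 + z.2)) = param e (Φ z) := by
  obtain ⟨n, m, hn, hm, hnm⟩ := exists_chart_poly hf b e hσ k
  have hm0 : (m t₁).eval v₁ ≠ 0 := by
    obtain ⟨x, y, hxy, h0, -, h2⟩ := hnm.self_of_nhds v₁
    rw [← h2]
    exact chartDen_ne_zero h0 (hxy.symm.trans h)
  have hΦ := (hn.eval v₁).div (hm.eval v₁) hm0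
  have hev : ∀ᶠ z in 𝓝 (t₁, v₁), (f z.1)^[k] (param b (σ z.1 + z.2))
      = param e ((n z.1).eval z.2 / (m z.1).eval z.2) := by
    filter_upwards [(continuous_fst.tendsto (t₁, v₁)).eventually hnm,
      (hm.eval v₁).1.continuousAt.eventually_ne hm0] with z hz hz0
    obtain ⟨x, y, hxy, h0, h1, h2⟩ := hz z.2
    rw [hxy, homPt_eq_param (b := e) (by rwa [h2]), h1, h2]
  refine ⟨_, hΦ, ?_, hev⟩
  have := hev.self_of_nhds
  simp only at this
  rw [h] at this
  exact (param_injective e this).symm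

/-- If the coordinate of the image of the point `σ t + v` differs from `w t` by a quantity of the
order of `v ^ d`, for all parameters `t`, then it is `w t + v ^ d * E t v` with an analytic function
`E` of `t` and `v`. -/
theorem exists_chart_factor (hf : AnalyticRational K t₁ f) {b e : OnePoint F} {σ w : F → F}
    (hσ : AnalyticOver K t₁ σ) (hw : AnalyticOver K t₁ w) {k d : ℕ}
    (hfw : ∀ᶠ t in 𝓝 t₁, (f t)^[k] (param b (σ t)) = param e (w t))
    (hord : ∀ᶠ t in 𝓝 t₁, ∃ C : ℝ, ∀ᶠ v in 𝓝 0,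
      ‖coord e ((f t)^[k] (param b (σ t + v))) - w t‖ ≤ C * ‖v‖ ^ d) :
    ∃ E : F × F → F, AnalyticOver₂ K (t₁, 0) E ∧ ∀ᶠ z in 𝓝 (t₁, 0),
      (f z.1)^[k] (param b (σ z.1 + z.2)) = param e (w z.1 + z.2 ^ d * E z) := by
  obtain ⟨n, m, hn, hm, hnm⟩ := exists_chart_poly hf b e hσ k
  have hm0 : ∀ᶠ t in 𝓝 t₁, (m t).eval 0 ≠ 0 := by
    filter_upwards [hnm, hfw] with t ht ht'
    obtain ⟨x, y, hxy, h0, -, h2⟩ := ht 0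
    rw [← h2]
    rw [add_zero] at hxy
    exact chartDen_ne_zero h0 (hxy.symm.trans ht')
  have hD := hn.sub ((PolyFamily.C hw).mul hm)
  have hcoeff : ∀ᶠ t in 𝓝 t₁, ∀ k < d, (n t - Polynomial.C (w t) * m t).coeff k = 0 := by
    filter_upwards [hnm, hm0, hord] with t ht ht0 ⟨C, hC⟩
    refine coeff_eq_zero_of_norm_eval_le (C := (‖(m t).eval 0‖ + 1) * C) ?_
    have hcont := ((m t).continuous.tendsto 0)
    filter_upwards [hC, hcont.eventually_ne ht0,
      hcont.norm.eventually_le_const (lt_add_one _)] with v hv hv0 hv1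
    obtain ⟨x, y, hxy, h0, h1, h2⟩ := ht v
    rw [hxy, coord_homPt, h1, h2] at hv
    have h3 : (n t - Polynomial.C (w t) * m t).eval v
        = (m t).eval v * ((n t).eval v / (m t).eval v - w t) := by
      simp only [eval_sub, eval_mul, eval_C]; field_simp
    rw [h3, norm_mul, mul_assoc]
    gcongr
  obtain ⟨Q, hQ, hDQ⟩ := hD.exists_eq_pow_mul d hcoeff
  refine ⟨_, (hQ.eval 0).div (hm.eval 0) hm0.self_of_nhds, ?_⟩
  have hfst := continuous_fst.tendsto (t₁, (0 : F))
  filter_upwards [hfst.eventually hnm, hfst.eventually hDQ,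
    (hm.eval 0).1.continuousAt.eventually_ne hm0.self_of_nhds] with z hz hzQ hz0
  obtain ⟨x, y, hxy, h0, h1, h2⟩ := hz z.2
  rw [hxy, homPt_eq_param (b := e) (by rwa [h2]), h1, h2]
  congr 1
  have h3 := congrArg (Polynomial.eval z.2) hzQ
  simp only [eval_sub, eval_mul, eval_C, eval_pow, eval_X] at h3
  rw [div_eq_iff hz0, add_mul, mul_assoc, div_mul_cancel₀ _ hz0]
  linear_combination h3

theorem chartAnalyticAt_iterate (hf : AnalyticRational K t₁ f) (k : ℕ) (z : OnePoint F) :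
    ChartAnalyticAt (f t₁)^[k] z := by
  obtain ⟨Φ, hΦ, hΦ1, h⟩ := exists_chart hf (b := z) (e := (f t₁)^[k] z) (k := k)
    (v₁ := coord z z) (x₁ := coord ((f t₁)^[k] z) ((f t₁)^[k] z)) (AnalyticOver.const (zero_mem K))
    (by rw [zero_add, param_coord_self, param_coord_self])
  have hcurve : ContinuousAt (fun w => (t₁, w)) (coord z z) := by fun_prop
  have h1 : ∀ᶠ w in 𝓝 (coord z z), (f t₁)^[k] (param z w) = param ((f t₁)^[k] z) (Φ (t₁, w)) := by
    filter_upwards [hcurve.tendsto.eventually h] with w hw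
    rwa [zero_add] at hw
  have h2 : ∀ᶠ w in 𝓝 (coord z z), Φ (t₁, w) = chartMap (f t₁)^[k] z w := by
    filter_upwards [h1] with w hw
    rw [chartMap, hw, coord_param]
  constructor
  · exact (hΦ.1.comp (AnalyticAt.prod analyticAt_const analyticAt_id)).congr h2
  · filter_upwards [h1, h2] with w hw hw'
    rw [hw, hw']

end AnalyticRational

section Strict

variable {F : Type*} [NontriviallyNormedField F] [CompleteSpace F]

theorem exists_lipschitz_of_analyticAt {E : Type*} [NormedAddCommGroup E] [NormedSpace F E]
    {Φ : E → F} {z₁ : E} (h : AnalyticAt F Φ z₁) :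
    ∃ M δ : ℝ, 0 ≤ M ∧ 0 < δ ∧ ∀ z z', ‖z - z₁‖ ≤ δ → ‖z' - z₁‖ ≤ δ →
      ‖Φ z - Φ z'‖ ≤ M * ‖z - z'‖ := by
  obtain ⟨M, s, hs, hM⟩ := h.hasStrictFDerivAt.exists_lipschitzOnWith
  obtain ⟨δ, hδ, hδs⟩ := Metric.nhds_basis_closedBall.mem_iff.mp hs
  refine ⟨M, δ, M.2, hδ, fun z z' hz hz' => ?_⟩
  rw [← dist_eq_norm, ← dist_eq_norm]
  exact hM.dist_le_mul z (hδs (by rwa [Metric.mem_closedBall, dist_eq_norm])) z'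
    (hδs (by rwa [Metric.mem_closedBall, dist_eq_norm]))

/-- Strict differentiability in the second variable, uniformly in the first one. -/
theorem exists_hasDerivAt_snd_and_strict {Φ : F × F → F} {t₁ x₁ : F}
    (h : AnalyticAt F Φ (t₁, x₁)) :
    ∃ β : F, HasDerivAt (fun x => Φ (t₁, x)) β x₁ ∧ ∀ ε : ℝ, 0 < ε → ∃ δ : ℝ, 0 < δ ∧
      ∀ t x x', ‖t - t₁‖ ≤ δ → ‖x - x₁‖ ≤ δ → ‖x' - x₁‖ ≤ δ →
        ‖Φ (t, x) - Φ (t, x') - β * (x - x')‖ ≤ ε * ‖x - x'‖ := by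
  have hs := h.hasStrictFDerivAt
  set Φ' := fderiv F Φ (t₁, x₁)
  refine ⟨Φ' (0, 1), ?_, fun ε hε => ?_⟩
  · have h1 : HasDerivAt (fun x : F => (t₁, x)) ((0 : F), (1 : F)) x₁ :=
      (hasDerivAt_const x₁ t₁).prodMk (hasDerivAt_id x₁)
    exact hs.hasFDerivAt.comp_hasDerivAt x₁ h1
  · have h1 := hs.isLittleO.def hε
    obtain ⟨δ, hδ, hδs⟩ := Metric.nhds_basis_closedBall.mem_iff.mp h1
    refine ⟨δ, hδ, fun t x x' ht hx hx' => ?_⟩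
    have h2 : (((t, x), (t, x')) : (F × F) × (F × F)) ∈
        Metric.closedBall ((t₁, x₁), (t₁, x₁)) δ := by
      rw [← dist_eq_norm] at ht hx hx'
      simp only [Metric.mem_closedBall, Prod.dist_eq, max_le_iff]
      exact ⟨⟨ht, hx⟩, ht, hx'⟩
    have h3 := hδs h2
    simp only [Set.mem_ofPred_eq, Prod.mk_sub_mk, sub_self] at h3
    have h4 : Φ' (0, x - x') = Φ' (0, 1) * (x - x') := by
      have : ((0 : F), x - x') = (x - x') • ((0 : F), (1 : F)) := by simp
      rw [this, map_smul, smul_eq_mul, mul_comm]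
    rw [h4, Prod.norm_mk, norm_zero, max_eq_right (norm_nonneg _)] at h3
    exact h3

end Strict

/-! ### Inverse branches -/

section Branches

variable {F : Type*} [NontriviallyNormedField F] [IsUltrametricDist F]

theorem exists_box_of_eventually {z₁ : F × F} {P : F × F → Prop}
    (h : ∀ᶠ z in 𝓝 z₁, P z) :
    ∃ δ : ℝ, 0 < δ ∧ ∀ t x, ‖t - z₁.1‖ ≤ δ → ‖x - z₁.2‖ ≤ δ → P (t, x) := by
  obtain ⟨δ, hδ, hδs⟩ := Metric.nhds_basis_closedBall.mem_iff.mp h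
  refine ⟨δ, hδ, fun t x ht hx => hδs ?_⟩
  rw [← dist_eq_norm] at ht hx
  simp only [Metric.mem_closedBall, Prod.dist_eq, max_le_iff]
  exact ⟨ht, hx⟩

theorem exists_ball_of_eventually {P : F → Prop} {x : F} (h : ∀ᶠ t in 𝓝 x, P t) :
    ∃ δ : ℝ, 0 < δ ∧ ∀ t, ‖t - x‖ ≤ δ → P t := by
  obtain ⟨δ, hδ, hδs⟩ := Metric.nhds_basis_closedBall.mem_iff.mp h
  exact ⟨δ, hδ, fun t ht => hδs (by rwa [Metric.mem_closedBall, dist_eq_norm])⟩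

/-- Points of `K` accumulate at each point of `K`. -/
theorem frequently_mem_nhdsNE {K : Subfield F} {lam : F} (hlam : lam ∈ K) (h1 : 1 < ‖lam‖) {x : F}
    (hx : x ∈ K) : ∃ᶠ y in 𝓝[≠] x, y ∈ K := by
  have h0 : lam ≠ 0 := norm_pos_iff.mp (one_pos.trans h1)
  have ht : Tendsto (fun n : ℕ => x + (lam⁻¹) ^ n) atTop (𝓝[≠] x) := by
    rw [tendsto_nhdsWithin_iff]
    constructor
    · have : Tendsto (fun n : ℕ => (lam⁻¹) ^ n) atTop (𝓝 0) :=
        tendsto_pow_atTop_nhds_zero_of_norm_lt_one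
          (by rw [norm_inv]; exact inv_lt_one_of_one_lt₀ h1)
      simpa using this.const_add x
    · exact Eventually.of_forall fun n => by simp [h0]
  exact ht.frequently (Frequently.of_forall fun n => add_mem hx (pow_mem (inv_mem hlam) n))

/-- The derivative of a function that preserves `K` lies in `K`, since it is a limit of difference
quotients at points of `K`. -/
theorem hasDerivAt_mem {K : Subfield F} (hK : IsClosed (K : Set F)) {lam : F} (hlam : lam ∈ K)
    (h1 : 1 < ‖lam‖) {Φ : F → F} {β x : F} (hΦ : HasDerivAt Φ β x) (hx : x ∈ K)
    (hΦK : ∀ᶠ y in 𝓝 x, y ∈ K → Φ y ∈ K) : β ∈ K := by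
  have h2 := hasDerivAt_iff_tendsto_slope.mp hΦ
  refine hK.mem_of_frequently_of_tendsto (b := 𝓝[≠] x) ?_ h2
  refine ((frequently_mem_nhdsNE hlam h1 hx).and_eventually
    (hΦK.filter_mono nhdsWithin_le_nhds)).mono fun y hy => ?_
  rw [slope_def_field]
  exact div_mem (sub_mem (hy.2 hy.1) (hΦK.self_of_nhds hx)) (sub_mem hy.1 hx)

variable [CompleteSpace F]

/-- The implicit function theorem: the solution `y` of `W (t, y) = v`, with `t`, `v` and `y` in
`K`. -/
theorem exists_implicit {K : Subfield F} (hK : IsClosed (K : Set F)) {W : F × F → F} {y₀ β : F}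
    (hW : AnalyticOver₂ K (0, y₀) W) (hW0 : W (0, y₀) = 0) (hy₀ : y₀ ∈ K) (hβ0 : β ≠ 0)
    (hβK : β ∈ K)
    (hβ : ∀ ε : ℝ, 0 < ε → ∃ δ : ℝ, 0 < δ ∧ ∀ t x x', ‖t - 0‖ ≤ δ → ‖x - y₀‖ ≤ δ → ‖x' - y₀‖ ≤ δ →
        ‖W (t, x) - W (t, x') - β * (x - x')‖ ≤ ε * ‖x - x'‖)
    {ε r : ℝ} (hε0 : 0 < ε) (hε1 : ε < 1) (hr : 0 < r) {P : F × F → Prop}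
    (hP : ∀ᶠ z in 𝓝 (0, y₀), P z) :
    ∃ (S : F → F → F) (δ M : ℝ), 0 < δ ∧ 0 ≤ M ∧ S 0 0 = y₀ ∧
      (∀ t ∈ K, ∀ v ∈ K, ‖t‖ ≤ δ → ‖v‖ ≤ δ → S t v ∈ K ∧ ‖S t v - y₀‖ ≤ r ∧ W (t, S t v) = v ∧
        P (t, S t v)) ∧
      (∀ t ∈ K, ∀ v ∈ K, ∀ v' ∈ K, ‖t‖ ≤ δ → ‖v‖ ≤ δ → ‖v'‖ ≤ δ →
        RelClose ε (S t v - S t v') (β⁻¹ * (v - v'))) ∧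
      (∀ t ∈ K, ∀ t' ∈ K, ∀ v ∈ K, ‖t‖ ≤ δ → ‖t'‖ ≤ δ → ‖v‖ ≤ δ →
        ‖S t v - S t' v‖ ≤ M * ‖t - t'‖) := by
  have hβn : 0 < ‖β‖ := norm_pos_iff.mpr hβ0
  obtain ⟨δ₁, hδ₁, h₁⟩ := hβ (ε * ‖β‖) (by positivity)
  obtain ⟨δ₂, hδ₂, h₂⟩ := exists_box_of_eventually (hW.mem.and hP)
  obtain ⟨M, δ₃, hM, hδ₃, h₃⟩ := exists_lipschitz_of_analyticAt hW.analyticAt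
  set s := min r (min δ₁ (min δ₂ δ₃)) with hs
  have hs0 : 0 < s := by positivity
  have hsr : s ≤ r := min_le_left _ _
  have hs1 : s ≤ δ₁ := (min_le_right _ _).trans (min_le_left _ _)
  have hs2 : s ≤ δ₂ := (min_le_right _ _).trans ((min_le_right _ _).trans (min_le_left _ _))
  have hs3 : s ≤ δ₃ := (min_le_right _ _).trans ((min_le_right _ _).trans (min_le_right _ _))
  set δ := min s (min (‖β‖ * s) (‖β‖ * s / (M + 1))) with hδ
  have hδ0 : 0 < δ := by positivity
  have hδs : δ ≤ s := min_le_left _ _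
  have hδβ : δ ≤ ‖β‖ * s := (min_le_right _ _).trans (min_le_left _ _)
  have hδM : M * δ ≤ ‖β‖ * s := by
    have : δ ≤ ‖β‖ * s / (M + 1) := (min_le_right _ _).trans (min_le_right _ _)
    rw [le_div_iff₀ (by positivity)] at this
    nlinarith
  have hclose : ∀ t x x', ‖t‖ ≤ δ → ‖x - y₀‖ ≤ s → ‖x' - y₀‖ ≤ s →
      RelClose ε (W (t, x) - W (t, x')) (β * (x - x')) := fun t x x' ht hx hx' => by
    refine (h₁ t x x' (by rw [sub_zero]; linarith) (hx.trans hs1) (hx'.trans hs1)).trans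
      (le_of_eq ?_)
    rw [norm_mul]; ring
  have hlip : ∀ t t' x, ‖t‖ ≤ δ → ‖t'‖ ≤ δ → ‖x - y₀‖ ≤ s →
      ‖W (t, x) - W (t', x)‖ ≤ M * ‖t - t'‖ := fun t t' x ht ht' hx => by
    have hb : ∀ t : F, ‖t‖ ≤ δ → ‖((t, x) : F × F) - (0, y₀)‖ ≤ δ₃ := fun t ht => by
      rw [Prod.mk_sub_mk, Prod.norm_mk, sub_zero]
      exact max_le (by linarith) (by linarith)
    have := h₃ (t, x) (t', x) (hb t ht) (hb t' ht')
    rwa [Prod.mk_sub_mk, Prod.norm_mk, sub_self, norm_zero, max_eq_left (norm_nonneg _)] at this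
  have hex : ∀ t ∈ K, ∀ v ∈ K, ‖t‖ ≤ δ → ‖v‖ ≤ δ → ∃ y ∈ K, ‖y - y₀‖ ≤ s ∧ W (t, y) = v := by
    intro t ht v hv htδ hvδ
    refine exists_eq_of_relClose hK (φ := fun y => W (t, y)) hε1 hβ0 hβK hy₀ ?_ ?_ hv ?_
    · exact fun y hy hyr => (h₂ t y (by rw [sub_zero]; linarith) (by linarith)).1 ht hy
    · exact fun y _ y' _ hyr hyr' => hclose t y y' htδ hyr hyr'
    · have h4 := hlip t 0 y₀ htδ (by simpa using hδ0.le) (by simpa using hs0.le)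
      rw [hW0, sub_zero, sub_zero] at h4
      refine norm_sub_le_of_le_of_le (hvδ.trans hδβ) (h4.trans (le_trans ?_ hδM))
      gcongr
  choose! S hSK hSs hS using hex
  have h0δ : ‖(0 : F)‖ ≤ δ := by simpa using hδ0.le
  refine ⟨S, δ, M / ‖β‖, hδ0, by positivity, ?_, ?_, ?_, ?_⟩
  · have h4 := hclose 0 (S 0 0) y₀ h0δ
      (hSs 0 (zero_mem K) 0 (zero_mem K) h0δ h0δ) (by simpa using hs0.le)
    rw [hS 0 (zero_mem K) 0 (zero_mem K) h0δ h0δ, hW0, sub_zero] at h4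
    have h5 := h4.norm_eq hε1
    rw [norm_zero, eq_comm, norm_eq_zero, mul_eq_zero, or_iff_right hβ0, sub_eq_zero] at h5
    exact h5
  · intro t ht v hv htδ hvδ
    have hSs' := hSs t ht v hv htδ hvδ
    exact ⟨hSK t ht v hv htδ hvδ, hSs'.trans hsr, hS t ht v hv htδ hvδ,
      (h₂ t _ (by rw [sub_zero]; linarith) (by linarith)).2⟩
  · intro t ht v hv v' hv' htδ hvδ hvδ'
    have h4 := (hclose t _ _ htδ (hSs t ht v hv htδ hvδ) (hSs t ht v' hv' htδ hvδ')).symm hε1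
    rw [hS t ht v hv htδ hvδ, hS t ht v' hv' htδ hvδ'] at h4
    have h5 := h4.mul_left β⁻¹
    rwa [inv_mul_cancel_left₀ hβ0] at h5
  · intro t ht t' ht' v hv htδ htδ' hvδ
    have h4 := (hclose t (S t v) (S t' v) htδ (hSs t ht v hv htδ hvδ)
      (hSs t' ht' v hv htδ' hvδ)).norm_eq hε1
    have h5 := hlip t' t (S t' v) htδ' htδ (hSs t' ht' v hv htδ' hvδ)
    rw [hS t ht v hv htδ hvδ] at h4
    rw [hS t' ht' v hv htδ' hvδ, h4, norm_mul, norm_sub_rev t'] at h5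
    rw [div_mul_eq_mul_div, le_div_iff₀ hβn, mul_comm]
    exact h5

/-- Iteration of the inverse branch of the expanding map `y ↦ y * k t y` that fixes `0`, from a
given function `S₀` on. As relative errors do not accumulate, the derivative of the `i`-th function
is close to the product of `lam ^ (-i)` and that of `S₀`, uniformly in `i`; the Lipschitz constant
with respect to the parameter is also at most of the order of `lam ^ (-i)`. -/
theorem exists_branches {K : Subfield F} (hK : IsClosed (K : Set F)) {lam η : F} (hlam : lam ∈ K)
    (hlam1 : 1 < ‖lam‖) {k : F → F → F} {ε δ₁ δ M M₀ : ℝ} (hε1 : ε < 1) (hδδ : δ ≤ δ₁)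
    (hδ₁ : 0 ≤ δ₁)
    (hkK : ∀ t ∈ K, ∀ y ∈ K, ‖t‖ ≤ δ₁ → ‖y‖ ≤ δ₁ → k t y ∈ K)
    (hk : ∀ t y y', ‖t‖ ≤ δ₁ → ‖y‖ ≤ δ₁ → ‖y'‖ ≤ δ₁ →
      RelClose ε (y * k t y - y' * k t y') (lam * (y - y')))
    (hkt : ∀ t t' y, ‖t‖ ≤ δ₁ → ‖t'‖ ≤ δ₁ → ‖y‖ ≤ δ₁ → ‖k t y - k t' y‖ ≤ M * ‖t - t'‖)
    {S₀ : F → F → F} (hS₀K : ∀ t ∈ K, ∀ v ∈ K, ‖t‖ ≤ δ → ‖v‖ ≤ δ → S₀ t v ∈ K ∧ ‖S₀ t v‖ ≤ δ₁)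
    (hS₀v : ∀ t ∈ K, ∀ v ∈ K, ∀ v' ∈ K, ‖t‖ ≤ δ → ‖v‖ ≤ δ → ‖v'‖ ≤ δ →
        RelClose ε (S₀ t v - S₀ t v') (η * (v - v')))
    (hS₀t : ∀ t ∈ K, ∀ t' ∈ K, ∀ v ∈ K, ‖t‖ ≤ δ → ‖t'‖ ≤ δ → ‖v‖ ≤ δ →
        ‖S₀ t v - S₀ t' v‖ ≤ M₀ * ‖t - t'‖) :
    ∃ S : ℕ → F → F → F, S 0 = S₀ ∧ (∀ i, ∀ t ∈ K, ∀ v ∈ K, ‖t‖ ≤ δ → ‖v‖ ≤ δ →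
        S i t v ∈ K ∧ ‖S i t v‖ ≤ δ₁ ∧ S (i + 1) t v * k t (S (i + 1) t v) = S i t v) ∧
      (∀ i, ∀ t ∈ K, ∀ v ∈ K, ∀ v' ∈ K, ‖t‖ ≤ δ → ‖v‖ ≤ δ → ‖v'‖ ≤ δ →
        RelClose ε (S i t v - S i t v') ((lam ^ i)⁻¹ * η * (v - v'))) ∧
      (∀ i, ∀ t ∈ K, ∀ t' ∈ K, ∀ v ∈ K, ‖t‖ ≤ δ → ‖t'‖ ≤ δ → ‖v‖ ≤ δ →
        ‖S i t v - S i t' v‖ ≤ max M₀ (M * δ₁) * (‖lam‖ ^ i)⁻¹ * ‖t - t'‖) := by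
  have hl0 : 0 < ‖lam‖ := one_pos.trans hlam1
  have hlam0 : lam ≠ 0 := norm_pos_iff.mp hl0
  have h0 : ‖(0 : F)‖ ≤ δ₁ := by simpa using hδ₁
  have hex : ∀ t ∈ K, ∀ s ∈ K, ‖t‖ ≤ δ → ‖s‖ ≤ δ₁ → ∃ y ∈ K, ‖y‖ ≤ δ₁ ∧ y * k t y = s := by
    intro t ht s hs htδ hsδ
    have H : ∃ y ∈ K, ‖y - 0‖ ≤ δ₁ ∧ y * k t y = s := by
      refine exists_eq_of_relClose hK (φ := fun y => y * k t y) hε1 hlam0 hlam (zero_mem K) ?_ ?_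
        hs ?_
      · intro y hy hyr
        rw [sub_zero] at hyr
        exact mul_mem hy (hkK t ht y hy (htδ.trans hδδ) hyr)
      · intro y _ y' _ hyr hyr'
        rw [sub_zero] at hyr hyr'
        exact hk t y y' (htδ.trans hδδ) hyr hyr'
      · rw [zero_mul, sub_zero]
        nlinarith
    simpa only [sub_zero] using H
  choose! g hgK hgδ hg using hex
  let S : ℕ → F → F → F := fun i => Nat.rec S₀ (fun _ T t v => g t (T t v)) i
  have hS0 : S 0 = S₀ := rfl
  have hSsucc : ∀ i t v, S (i + 1) t v = g t (S i t v) := fun _ _ _ => rfl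
  have hSK : ∀ i, ∀ t ∈ K, ∀ v ∈ K, ‖t‖ ≤ δ → ‖v‖ ≤ δ → S i t v ∈ K ∧ ‖S i t v‖ ≤ δ₁ := by
    intro i t ht v hv htδ hvδ
    induction i with
    | zero => exact hS₀K t ht v hv htδ hvδ
    | succ i ih =>
      rw [hSsucc]
      exact ⟨hgK t ht _ ih.1 htδ ih.2, hgδ t ht _ ih.1 htδ ih.2⟩
  have hstep : ∀ i, ∀ t ∈ K, ∀ v ∈ K, ‖t‖ ≤ δ → ‖v‖ ≤ δ →
      S (i + 1) t v * k t (S (i + 1) t v) = S i t v := by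
    intro i t ht v hv htδ hvδ
    have h1 := hSK i t ht v hv htδ hvδ
    rw [hSsucc]
    exact hg t ht _ h1.1 htδ h1.2
  have hnorm : ∀ i, ∀ t ∈ K, ∀ v ∈ K, ‖t‖ ≤ δ → ‖v‖ ≤ δ →
      ‖S i t v‖ ≤ (‖lam‖ ^ i)⁻¹ * δ₁ := by
    intro i t ht v hv htδ hvδ
    induction i with
    | zero => simpa [hS0] using (hS₀K t ht v hv htδ hvδ).2
    | succ i ih =>
      have h1 := (hk t (S (i + 1) t v) 0 (htδ.trans hδδ) (hSK (i + 1) t ht v hv htδ hvδ).2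
        h0).norm_eq hε1
      rw [hstep i t ht v hv htδ hvδ, zero_mul, sub_zero, sub_zero, norm_mul] at h1
      rw [h1] at ih
      rw [pow_succ, mul_inv]
      have : ‖S (i + 1) t v‖ = ‖lam‖⁻¹ * (‖lam‖ * ‖S (i + 1) t v‖) := by field_simp
      rw [this]
      calc ‖lam‖⁻¹ * (‖lam‖ * ‖S (i + 1) t v‖) ≤ ‖lam‖⁻¹ * ((‖lam‖ ^ i)⁻¹ * δ₁) := by gcongr
        _ = _ := by ring
  refine ⟨S, rfl, fun i t ht v hv htδ hvδ => ⟨(hSK i t ht v hv htδ hvδ).1,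
    (hSK i t ht v hv htδ hvδ).2, hstep i t ht v hv htδ hvδ⟩, ?_, ?_⟩
  · intro i t ht v hv v' hv' htδ hvδ hvδ'
    induction i with
    | zero => simpa [hS0] using hS₀v t ht v hv v' hv' htδ hvδ hvδ'
    | succ i ih =>
      have h1 := (hk t (S (i + 1) t v) (S (i + 1) t v') (htδ.trans hδδ)
        (hSK (i + 1) t ht v hv htδ hvδ).2 (hSK (i + 1) t ht v' hv' htδ hvδ').2)
      rw [hstep i t ht v hv htδ hvδ, hstep i t ht v' hv' htδ hvδ'] at h1
      have h2 := ((h1.symm hε1).trans ih hε1).mul_left lam⁻¹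
      rw [inv_mul_cancel_left₀ hlam0] at h2
      convert h2 using 1
      rw [pow_succ, mul_inv]; ring
  · intro i t ht t' ht' v hv htδ htδ' hvδ
    induction i with
    | zero =>
      refine (hS₀t t ht t' ht' v hv htδ htδ' hvδ).trans ?_
      simp only [pow_zero, inv_one, mul_one]
      gcongr
      exact le_max_left _ _
    | succ i ih =>
      set y := S (i + 1) t v with hy
      set y' := S (i + 1) t' v with hy'
      have hyδ := (hSK (i + 1) t ht v hv htδ hvδ).2
      have hyδ' := (hSK (i + 1) t' ht' v hv htδ' hvδ).2
      have h1 := (hk t y y' (htδ.trans hδδ) hyδ hyδ').norm_eq hε1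
      rw [norm_mul] at h1
      have h2 : y * k t y - y' * k t y' = (S i t v - S i t' v) - y' * (k t y' - k t' y') := by
        rw [← hstep i t ht v hv htδ hvδ, ← hstep i t' ht' v hv htδ' hvδ, ← hy, ← hy']; ring
      set A := max M₀ (M * δ₁) with hA
      have h3 : ‖y' * (k t y' - k t' y')‖ ≤ A * (‖lam‖ ^ i)⁻¹ * ‖t - t'‖ := by
        rw [norm_mul]
        have h4 := hkt t t' y' (htδ.trans hδδ) (htδ'.trans hδδ) hyδ'
        have h5 := hnorm (i + 1) t' ht' v hv htδ' hvδ
        have h6 : (‖lam‖ ^ (i + 1))⁻¹ ≤ (‖lam‖ ^ i)⁻¹ :=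
          inv_anti₀ (by positivity) (pow_le_pow_right₀ hlam1.le (by omega))
        calc ‖y'‖ * ‖k t y' - k t' y'‖ ≤ ((‖lam‖ ^ i)⁻¹ * δ₁) * (M * ‖t - t'‖) := by
              gcongr
              exact h5.trans (by gcongr)
          _ = (M * δ₁) * (‖lam‖ ^ i)⁻¹ * ‖t - t'‖ := by ring
          _ ≤ _ := by gcongr; exact le_max_right _ _
      have h7 : ‖lam‖ * ‖y - y'‖ ≤ A * (‖lam‖ ^ i)⁻¹ * ‖t - t'‖ := by
        rw [← h1, h2]
        exact norm_sub_le_of_le_of_le ih h3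
      have h8 : ‖y - y'‖ = ‖lam‖⁻¹ * (‖lam‖ * ‖y - y'‖) := by field_simp
      rw [h8]
      calc ‖lam‖⁻¹ * (‖lam‖ * ‖y - y'‖) ≤ ‖lam‖⁻¹ * (A * (‖lam‖ ^ i)⁻¹ * ‖t - t'‖) := by gcongr
        _ = _ := by rw [pow_succ, mul_inv]; ring

end Branches

/-! ### The dynamics described by the local model -/

section Shift

variable {F : Type*} [NontriviallyNormedField F] {g : OnePoint F → OnePoint F} {b e : OnePoint F}
  {s x₁ : F} {Ψ : F → F} {n : ℕ}

theorem hasDeg_param_add_iff (hΨ : ContinuousAt Ψ x₁)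
    (hg : ∀ᶠ x in 𝓝 x₁, g (param b (s + x)) = param e (Ψ x)) :
    HasDeg g (param b (s + x₁)) n ↔ ∃ c C : ℝ, 0 < c ∧ ∀ᶠ x in 𝓝 x₁,
      c * ‖x - x₁‖ ^ n ≤ ‖Ψ x - Ψ x₁‖ ∧ ‖Ψ x - Ψ x₁‖ ≤ C * ‖x - x₁‖ ^ n := by
  have hmap : map (fun x => s + x) (𝓝 x₁) = 𝓝 (s + x₁) := (Homeomorph.addLeft s).map_nhds_eq x₁
  rw [hasDeg_param_iff (Φ := fun w => Ψ (w - s)) (e := e)]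
  · simp only [← hmap, eventually_map, add_sub_cancel_left, add_sub_add_left_eq_sub]
  · refine ContinuousAt.comp (g := Ψ) ?_ (f := fun w => w - s)
      (continuous_id.sub continuous_const).continuousAt
    rwa [add_sub_cancel_left]
  · rw [← hmap, eventually_map]
    filter_upwards [hg] with x hx
    rw [hx, add_sub_cancel_left]

theorem deriv_ne_zero_of_hasDeg_one {β : F} (hΨ : HasDerivAt Ψ β x₁)
    (hg : ∀ᶠ x in 𝓝 x₁, g (param b (s + x)) = param e (Ψ x))
    (h : HasDeg g (param b (s + x₁)) 1) : β ≠ 0 := by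
  rw [hasDeg_param_add_iff hΨ.continuousAt hg] at h
  obtain ⟨c, C, hc, h⟩ := h
  rintro rfl
  have h1 := (hasDerivAt_iff_tendsto_slope.mp hΨ).norm
  rw [norm_zero] at h1
  obtain ⟨x, hx1, hx2, hx3⟩ := ((h1.eventually_lt_const hc).and
    ((h.filter_mono nhdsWithin_le_nhds).and (self_mem_nhdsWithin (a := x₁) (s := {x₁}ᶜ)))).exists
  have hpos : 0 < ‖x - x₁‖ := norm_pos_iff.mpr (sub_ne_zero.mpr hx3)
  rw [slope_def_field, norm_div, div_lt_iff₀ hpos] at hx1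
  rw [pow_one] at hx2
  linarith [hx2.1]

/-- A map with difference quotients close to a nonzero constant has degree one. -/
theorem hasDeg_one_of_relClose [IsUltrametricDist F] {β : F} {ε : ℝ} (hε : ε < 1) (hβ : β ≠ 0)
    (hΨ : ContinuousAt Ψ x₁)
    (hg : ∀ᶠ x in 𝓝 x₁, g (param b (s + x)) = param e (Ψ x))
    (h : ∀ᶠ x in 𝓝 x₁, RelClose ε (Ψ x - Ψ x₁) (β * (x - x₁))) :
    HasDeg g (param b (s + x₁)) 1 := by
  rw [hasDeg_param_add_iff hΨ hg]
  refine ⟨‖β‖, ‖β‖, norm_pos_iff.mpr hβ, h.mono fun x hx => ?_⟩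
  rw [hx.norm_eq hε, norm_mul, pow_one]
  exact ⟨le_rfl, le_rfl⟩

end Shift

section DynamicalModel

variable {F : Type*} [NontriviallyNormedField F] [IsUltrametricDist F]

/-- A local model together with the statement that it describes the dynamics of the maps `f t`
near the points with coordinate `a t` in the chart at `a₀` and `c t` in the chart at `c₀`. In the
coordinate centred at `a t`, the map `f t` is `y ↦ y * k t y`. -/
structure DynamicalModel (K : Subfield F) (f : F → OnePoint F → OnePoint F) (a₀ c₀ : OnePoint F)
    (a c : F → F) (ℓ : ℕ) extends LocalModel K where
  δ₁ : ℝ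
  k : F → F → F
  δ₁_pos : 0 < δ₁
  δ_le : δ ≤ δ₁
  k_mem : ∀ t ∈ K, ‖t‖ ≤ δ₁ → k t 0 ∈ K
  k_close : ∀ t y, ‖t‖ ≤ δ₁ → ‖y‖ ≤ δ₁ →
    RelClose (‖(d : F)‖ ^ 4 * ‖(d' : F)‖ ^ 2 / 2) (k t y) lam
  k_lip : ∀ t y y', ‖t‖ ≤ δ₁ → ‖y‖ ≤ δ₁ → ‖y'‖ ≤ δ₁ → ‖k t y - k t y'‖ ≤ M * ‖y - y'‖
  k_map : ∀ t y, ‖t‖ ≤ δ₁ → ‖y‖ ≤ δ₁ → f t (param a₀ (a t + y)) = param a₀ (a t + y * k t y)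
  Lam_map : ∀ t v, ‖t‖ ≤ δ → ‖v‖ ≤ δ →
    (f t)^[ℓ] (param c₀ (c t + v)) = param a₀ (a t + toLocalModel.Lam t v)
  S_norm_le : ∀ i, i₀ ≤ i → ∀ t ∈ K, ∀ v ∈ K, ‖t‖ ≤ δ → ‖v‖ ≤ δ → ‖S i t v‖ ≤ δ₁
  S_step : ∀ i, i₀ ≤ i → ∀ t ∈ K, ∀ v ∈ K, ‖t‖ ≤ δ → ‖v‖ ≤ δ →
    S (i + 1) t v * k t (S (i + 1) t v) = S i t v
  S_iter : ∀ i, i₀ ≤ i → ∀ t ∈ K, ∀ v ∈ K, ‖t‖ ≤ δ → ‖v‖ ≤ δ →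
    (f t)^[i] (param a₀ (a t + S i t v)) = param c₀ (c t + v)

variable [CompleteSpace F] {K : Subfield F} {f : F → OnePoint F → OnePoint F} {a₀ c₀ : OnePoint F}
  {a c G : F → F} {k E : F × F → F} {ℓ d d' : ℕ} {lam rho rho' zeta : F} {y : ℕ → F}

set_option maxHeartbeats 1000000 in
/-- The local model of analytic germs. Here `k` is the factor of the maps near the fixed point, `G`
and `E` describe the passage from the critical point to the fixed point, and `y i` is the
coordinate, relative to the fixed point, of the `i`-th point before the critical point on a
homoclinic orbit at the parameter `0`. The inverse branch along this orbit is first obtained, by the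
implicit function theorem, for one iterate whose orbit starts close to the fixed point, and then
continued by the inverse branch of the expanding map `y ↦ y * k t y`. -/
theorem exists_dynamicalModel (hK : IsClosed (K : Set F)) (hf : AnalyticRational K 0 f)
    (ha : AnalyticOver K 0 a) (hc : AnalyticOver K 0 c) (hlam1 : 1 < ‖lam‖)
    (hk : AnalyticOver₂ K (0, 0) k) (hk0 : k (0, 0) = lam)
    (hkf : ∀ᶠ z in 𝓝 ((0 : F), (0 : F)),
      f z.1 (param a₀ (a z.1 + z.2)) = param a₀ (a z.1 + z.2 * k z))
    (hG : AnalyticOver K 0 G) (hG0 : G 0 = rho') (hrho' : rho' ≠ 0)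
    (hE : AnalyticOver₂ K (0, 0) E) (hE0 : E (0, 0) = rho) (hrho : rho ≠ 0)
    (hfE : ∀ᶠ z in 𝓝 ((0 : F), (0 : F)), (f z.1)^[ℓ] (param c₀ (c z.1 + z.2))
      = param a₀ (a z.1 + (z.1 ^ d' * G z.1 + z.2 ^ d * E z)))
    (hd : (d : F) ≠ 0) (hd' : (d' : F) ≠ 0)
    (hyK : ∀ᶠ i in atTop, y i ∈ K) (hy0 : Tendsto y atTop (𝓝 0)) (hyne : ∀ᶠ i in atTop, y i ≠ 0)
    (hzeta : Tendsto (fun i => lam ^ i * y i) atTop (𝓝 zeta))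
    (hystep : ∀ᶠ i in atTop, f 0 (param a₀ (a 0 + y (i + 1))) = param a₀ (a 0 + y i))
    (hyc : ∀ᶠ i in atTop, (f 0)^[i] (param a₀ (a 0 + y i)) = param c₀ (c 0) ∧
      HasDeg (f 0)^[i] (param a₀ (a 0 + y i)) 1) :
    ∃ L : DynamicalModel K f a₀ c₀ a c ℓ, L.lam = lam ∧ L.zeta = zeta ∧ L.rho = rho ∧
      L.rho' = rho' ∧ L.d = d ∧ L.d' = d' := by
  have hdn : 0 < ‖(d : F)‖ := norm_pos_iff.mpr hd
  have hdn' : 0 < ‖(d' : F)‖ := norm_pos_iff.mpr hd'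
  have hl0 : 0 < ‖lam‖ := one_pos.trans hlam1
  have hlam0 : lam ≠ 0 := norm_pos_iff.mp hl0
  set ε : ℝ := ‖(d : F)‖ ^ 4 * ‖(d' : F)‖ ^ 2 / 2 with hε
  have hε0 : 0 < ε := by positivity
  have hε1 : ε < 1 := by
    have h1 : ‖(d : F)‖ ^ 4 ≤ 1 :=
      pow_le_one₀ hdn.le (IsUltrametricDist.norm_natCast_le_one F d)
    have h2 : ‖(d' : F)‖ ^ 2 ≤ 1 :=
      pow_le_one₀ hdn'.le (IsUltrametricDist.norm_natCast_le_one F d')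
    have h3 : ‖(d : F)‖ ^ 4 * ‖(d' : F)‖ ^ 2 ≤ 1 := mul_le_one₀ h1 (by positivity) h2
    linarith
  have hlamK : lam ∈ K := hk0 ▸ hk.mem.self_of_nhds (zero_mem K) (zero_mem K)
  -- a neighbourhood of the fixed point on which the maps are almost linear
  obtain ⟨M₁, r₁, hM₁, hr₁, hlip⟩ := exists_lipschitz_of_analyticAt hk.analyticAt
  obtain ⟨r₂, hr₂, hev⟩ := exists_box_of_eventually (hk.mem.and (hkf.and
    (hk.analyticAt.continuousAt.tendsto.eventually (Metric.closedBall_mem_nhds (k (0, 0))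
      (show 0 < ε * ‖lam‖ by positivity)))))
  obtain ⟨β₀, hβ₀, hstrict⟩ := exists_hasDerivAt_snd_and_strict
    (AnalyticOver₂.snd.mul hk).analyticAt
  have hβlam : β₀ = lam := by
    have h1 : HasDerivAt (fun x => k (0, x)) (deriv (fun x => k (0, x)) 0) 0 :=
      ((hk.analyticAt.comp (f := fun x => ((0 : F), x))
        (AnalyticAt.prod analyticAt_const analyticAt_id)).differentiableAt).hasDerivAt
    have h2 := (hasDerivAt_id (0 : F)).mul h1
    have h3 := hβ₀.unique h2
    rw [h3]; simp [hk0]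
  subst hβlam
  obtain ⟨r₃, hr₃, hstrict⟩ := hstrict (ε * ‖β₀‖) (by positivity)
  set δ₁ := min r₁ (min r₂ r₃) with hδ₁
  have hδ₁0 : 0 < δ₁ := by positivity
  have hδr₁ : δ₁ ≤ r₁ := min_le_left _ _
  have hδr₂ : δ₁ ≤ r₂ := (min_le_right _ _).trans (min_le_left _ _)
  have hδr₃ : δ₁ ≤ r₃ := (min_le_right _ _).trans (min_le_right _ _)
  have hkK : ∀ t ∈ K, ∀ y ∈ K, ‖t‖ ≤ δ₁ → ‖y‖ ≤ δ₁ → k (t, y) ∈ K := fun t ht y hy htδ hyδ =>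
    (hev t y (by simpa using htδ.trans hδr₂) (by simpa using hyδ.trans hδr₂)).1 ht hy
  have hkmap : ∀ t y, ‖t‖ ≤ δ₁ → ‖y‖ ≤ δ₁ →
      f t (param a₀ (a t + y)) = param a₀ (a t + y * k (t, y)) := fun t y htδ hyδ =>
    (hev t y (by simpa using htδ.trans hδr₂) (by simpa using hyδ.trans hδr₂)).2.1
  have hkclose : ∀ t y, ‖t‖ ≤ δ₁ → ‖y‖ ≤ δ₁ → RelClose ε (k (t, y)) β₀ := fun t y htδ hyδ => by
    have := (hev t y (by simpa using htδ.trans hδr₂) (by simpa using hyδ.trans hδr₂)).2.2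
    rwa [hk0, dist_eq_norm] at this
  have hksub : ∀ t y y', ‖t‖ ≤ δ₁ → ‖y‖ ≤ δ₁ → ‖y'‖ ≤ δ₁ →
      RelClose ε (y * k (t, y) - y' * k (t, y')) (β₀ * (y - y')) := fun t y y' htδ hyδ hyδ' => by
    have := hstrict t y y' (by simpa using htδ.trans hδr₃) (by simpa using hyδ.trans hδr₃)
      (by simpa using hyδ'.trans hδr₃)
    refine this.trans (le_of_eq ?_)
    rw [norm_mul]; ring
  have hklip : ∀ t t' y y', ‖t‖ ≤ δ₁ → ‖t'‖ ≤ δ₁ → ‖y‖ ≤ δ₁ → ‖y'‖ ≤ δ₁ →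
      ‖k (t, y) - k (t', y')‖ ≤ M₁ * max ‖t - t'‖ ‖y - y'‖ := fun t t' y y' ht ht' hy hy' => by
    have := hlip (t, y) (t', y')
      (by rw [Prod.mk_sub_mk, sub_zero, sub_zero]; exact max_le (ht.trans hδr₁) (hy.trans hδr₁))
      (by rw [Prod.mk_sub_mk, sub_zero, sub_zero]; exact max_le (ht'.trans hδr₁) (hy'.trans hδr₁))
    rwa [Prod.mk_sub_mk, Prod.norm_mk] at this
  have h0δ₁ : ‖(0 : F)‖ ≤ δ₁ := by simpa using hδ₁0.le
  -- the homoclinic orbit in this neighbourhood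
  have hyball : ∀ᶠ i in atTop, ‖y i‖ ≤ δ₁ := by
    have := hy0.eventually (Metric.closedBall_mem_nhds (0 : F) hδ₁0)
    filter_upwards [this] with i hi
    simpa using hi
  obtain ⟨i₁, hi₁⟩ := eventually_atTop.mp (hyball.and (hyK.and (hyne.and (hystep.and hyc))))
  have hyrec : ∀ i, i₁ ≤ i → y (i + 1) * k (0, y (i + 1)) = y i := fun i hi => by
    have h1 := hkmap 0 (y (i + 1)) h0δ₁ (hi₁ (i + 1) (by omega)).1
    rw [(hi₁ i hi).2.2.2.1] at h1
    exact (add_left_cancel (param_injective a₀ h1)).symm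
  have hynorm : ∀ i, i₁ ≤ i → ‖y i‖ = ‖β₀‖ * ‖y (i + 1)‖ := fun i hi => by
    rw [← hyrec i hi, norm_mul, mul_comm,
      (hkclose 0 (y (i + 1)) h0δ₁ (hi₁ (i + 1) (by omega)).1).norm_eq hε1]
  have hzeta0 : zeta ≠ 0 := by
    have h1 : ∀ j, ‖β₀ ^ (i₁ + j) * y (i₁ + j)‖ = ‖β₀ ^ i₁ * y i₁‖ := by
      intro j
      induction j with
      | zero => rfl
      | succ j ih =>
        rw [← ih, norm_mul, norm_mul, hynorm (i₁ + j) (by omega), norm_pow, norm_pow,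
          ← add_assoc, pow_succ, mul_assoc]
    have h2 : Tendsto (fun j => ‖β₀ ^ (i₁ + j) * y (i₁ + j)‖) atTop (𝓝 ‖zeta‖) :=
      hzeta.norm.comp (tendsto_add_atTop_nat i₁ |>.congr fun j => add_comm _ _)
    simp only [h1] at h2
    have h3 := tendsto_nhds_unique h2 tendsto_const_nhds
    rw [← norm_pos_iff, h3, norm_pos_iff]
    exact mul_ne_zero (pow_ne_zero _ hlam0) (hi₁ i₁ le_rfl).2.2.1
  have hzn : 0 < ‖zeta‖ := norm_pos_iff.mpr hzeta0
  have hzetaK : zeta ∈ K := hK.mem_of_tendsto hzeta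
    (hyK.mono fun i hi => mul_mem (pow_mem hlamK i) hi)
  obtain ⟨i₂, hi₂⟩ := eventually_atTop.mp
    (hzeta.eventually (Metric.closedBall_mem_nhds zeta (show 0 < ε * ‖zeta‖ by positivity)))
  set i₀ := max i₁ i₂ with hi₀
  have hi₁₀ : i₁ ≤ i₀ := le_max_left _ _
  have hyclose : ∀ i, i₀ ≤ i → RelClose ε (y i) ((β₀ ^ i)⁻¹ * zeta) := fun i hi => by
    have h1 := hi₂ i ((le_max_right _ _).trans hi)
    rw [dist_eq_norm] at h1
    have h2 := RelClose.mul_left (ε := ε) (x := β₀ ^ i * y i) (y := zeta) h1 (β₀ ^ i)⁻¹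
    rwa [inv_mul_cancel_left₀ (pow_ne_zero _ hlam0)] at h2
  -- the inverse branch of `f t ^ i₀`
  obtain ⟨Φ, hΦ, hΦ0, hΦmap⟩ := exists_chart hf ha (b := a₀) (e := c₀) (k := i₀) (v₁ := y i₀)
    (x₁ := c 0) (hi₁ i₀ hi₁₀).2.2.2.2.1
  have hW : AnalyticOver₂ K (0, y i₀) fun z => Φ z - c z.1 := hΦ.sub (.of_fst hc)
  obtain ⟨β, hβ, hβstrict⟩ := exists_hasDerivAt_snd_and_strict hW.analyticAt
  have hcurve : Tendsto (fun x => ((0 : F), x)) (𝓝 (y i₀)) (𝓝 (0, y i₀)) :=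
    (Continuous.prodMk_right (0 : F)).tendsto _
  have hβ0 : β ≠ 0 := by
    have h1 : HasDerivAt (fun x => Φ (0, x)) β (y i₀) := by
      have := hβ.add_const (c 0)
      simpa using this
    exact deriv_ne_zero_of_hasDeg_one h1 (hcurve.eventually hΦmap) (hi₁ i₀ hi₁₀).2.2.2.2.2
  have hyi₀K : y i₀ ∈ K := (hi₁ i₀ hi₁₀).2.1
  have hβK : β ∈ K := hasDerivAt_mem hK hlamK hlam1 hβ hyi₀K
    ((hcurve.eventually hW.mem).mono fun x hx => hx (zero_mem K))
  obtain ⟨S₀, r₄, M₀, hr₄, hM₀, hS₀00, hS₀, hS₀v, hS₀t⟩ := exists_implicit hK hW (by simp [hΦ0])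
    hyi₀K hβ0 hβK hβstrict hε0 hε1 hδ₁0 hΦmap
  set r₅ := min r₄ δ₁ with hr₅
  have hr₅0 : 0 < r₅ := by positivity
  have hr₅₄ : r₅ ≤ r₄ := min_le_left _ _
  have h0r₅ : ‖(0 : F)‖ ≤ r₅ := by simpa using hr₅0.le
  obtain ⟨T, hT0, hT, hTv, hTt⟩ := exists_branches hK hlamK hlam1 (η := β⁻¹)
    (k := fun t y => k (t, y)) (δ₁ := δ₁) (δ := r₅) (M := M₁) (M₀ := M₀) (S₀ := S₀) hε1
    (min_le_right _ _) hδ₁0.le hkK hksub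
    (fun t t' y ht ht' hy => by
      have := hklip t t' y y ht ht' hy hy
      rwa [sub_self, norm_zero, max_eq_left (norm_nonneg _)] at this)
    (fun t ht v hv htδ hvδ => by
      have h1 := hS₀ t ht v hv (htδ.trans hr₅₄) (hvδ.trans hr₅₄)
      refine ⟨h1.1, ?_⟩
      rw [← sub_add_cancel (S₀ t v) (y i₀)]
      exact norm_add_le_of_le_of_le h1.2.1 (hi₁ i₀ hi₁₀).1)
    (fun t ht v hv v' hv' htδ hvδ hvδ' => hS₀v t ht v hv v' hv' (htδ.trans hr₅₄)
      (hvδ.trans hr₅₄) (hvδ'.trans hr₅₄))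
    (fun t ht t' ht' v hv htδ htδ' hvδ => hS₀t t ht t' ht' v hv (htδ.trans hr₅₄)
      (htδ'.trans hr₅₄) (hvδ.trans hr₅₄))
  have hT00 : ∀ j, T j 0 0 = y (i₀ + j) := by
    intro j
    induction j with
    | zero => rw [hT0, hS₀00, add_zero]
    | succ j ih =>
      have h1 := hT j 0 (zero_mem K) 0 (zero_mem K) h0r₅ h0r₅
      have h2 := hT (j + 1) 0 (zero_mem K) 0 (zero_mem K) h0r₅ h0r₅
      have h3 := (hksub 0 (T (j + 1) 0 0) (y (i₀ + j + 1)) h0δ₁ h2.2.1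
        (hi₁ (i₀ + j + 1) (by omega)).1).norm_eq hε1
      rw [h1.2.2, ih, hyrec (i₀ + j) (by omega), sub_self, norm_zero, eq_comm, norm_eq_zero,
        mul_eq_zero, or_iff_right hlam0, sub_eq_zero] at h3
      exact h3
  have hyn : ∀ j, ‖y (i₀ + j)‖ = (‖β₀‖ ^ j)⁻¹ * ‖y i₀‖ := by
    intro j
    induction j with
    | zero => simp
    | succ j ih =>
      rw [hynorm (i₀ + j) (by omega), add_assoc] at ih
      rw [pow_succ, mul_inv, mul_right_comm, ← ih]
      field_simp
  have hy₀pos : 0 < ‖y i₀‖ := norm_pos_iff.mpr (hi₁ i₀ hi₁₀).2.2.1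
  set A := max M₀ (M₁ * δ₁) with hA
  have hA0 : 0 ≤ A := hM₀.trans (le_max_left _ _)
  obtain ⟨M₂, r₆, hM₂, hr₆, hGlip⟩ := exists_lipschitz_of_analyticAt hG.analyticAt
  obtain ⟨r₇, hr₇, hGmem⟩ := exists_ball_of_eventually hG.mem
  obtain ⟨M₃, r₈, hM₃, hr₈, hElip⟩ := exists_lipschitz_of_analyticAt hE.analyticAt
  obtain ⟨r₉, hr₉, hEmem⟩ := exists_box_of_eventually (hE.mem.and hfE)
  set δ := min (min r₅ (min r₆ r₇)) (min (min r₈ r₉)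
    (min (ε * ‖y i₀‖ / (A + 1)) (ε * ‖y i₀‖ / (‖β⁻¹‖ + 1)))) with hδ
  have hδ0 : 0 < δ := by positivity
  have hδ₅ : δ ≤ r₅ := (min_le_left _ _).trans (min_le_left _ _)
  have hδ₆ : δ ≤ r₆ := (min_le_left _ _).trans ((min_le_right _ _).trans (min_le_left _ _))
  have hδ₇ : δ ≤ r₇ := (min_le_left _ _).trans ((min_le_right _ _).trans (min_le_right _ _))
  have hδ₈ : δ ≤ r₈ := (min_le_right _ _).trans ((min_le_left _ _).trans (min_le_left _ _))
  have hδ₉ : δ ≤ r₉ := (min_le_right _ _).trans ((min_le_left _ _).trans (min_le_right _ _))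
  have hδA : A * δ ≤ ε * ‖y i₀‖ := by
    have h1 : δ ≤ ε * ‖y i₀‖ / (A + 1) :=
      (min_le_right _ _).trans ((min_le_right _ _).trans (min_le_left _ _))
    rw [le_div_iff₀ (by positivity)] at h1
    linarith
  have hδβ : ‖β⁻¹‖ * δ ≤ ε * ‖y i₀‖ := by
    have h1 : δ ≤ ε * ‖y i₀‖ / (‖β⁻¹‖ + 1) :=
      (min_le_right _ _).trans ((min_le_right _ _).trans (min_le_right _ _))
    rw [le_div_iff₀ (by positivity)] at h1
    linarith
  have hδδ₁ : δ ≤ δ₁ := hδ₅.trans (min_le_right _ _)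
  -- the branches `S i` of the model are the `T (i - i₀)`
  have hTclose : ∀ j, ∀ t ∈ K, ∀ v ∈ K, ‖t‖ ≤ δ → ‖v‖ ≤ δ →
      RelClose ε (T j t v) ((β₀ ^ (i₀ + j))⁻¹ * zeta) := by
    intro j t ht v hv htδ hvδ
    refine RelClose.trans (y := y (i₀ + j)) ?_ (hyclose _ (by omega)) hε1
    rw [← hT00 j]
    unfold RelClose
    refine norm_sub_le_of_triangle (y := T j 0 v) ?_ ?_
    · refine (hTt j t ht 0 (zero_mem K) v hv (htδ.trans hδ₅) h0r₅ (hvδ.trans hδ₅)).trans ?_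
      rw [hT00, hyn, sub_zero]
      calc A * (‖β₀‖ ^ j)⁻¹ * ‖t‖ = (‖β₀‖ ^ j)⁻¹ * (A * ‖t‖) := by ring
        _ ≤ (‖β₀‖ ^ j)⁻¹ * (ε * ‖y i₀‖) := by
            refine mul_le_mul_of_nonneg_left ?_ (by positivity)
            exact le_trans (mul_le_mul_of_nonneg_left htδ hA0) hδA
        _ = _ := by ring
    · have h1 := (hTv j 0 (zero_mem K) v hv 0 (zero_mem K) h0r₅ (hvδ.trans hδ₅) h0r₅).norm_eq hε1
      rw [h1, hT00, hyn, sub_zero, norm_mul, norm_mul, norm_inv, norm_pow]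
      calc (‖β₀‖ ^ j)⁻¹ * ‖β⁻¹‖ * ‖v‖ = (‖β₀‖ ^ j)⁻¹ * (‖β⁻¹‖ * ‖v‖) := by ring
        _ ≤ (‖β₀‖ ^ j)⁻¹ * (ε * ‖y i₀‖) := by
            refine mul_le_mul_of_nonneg_left ?_ (by positivity)
            exact le_trans (mul_le_mul_of_nonneg_left hvδ (norm_nonneg _)) hδβ
        _ = _ := by ring
  have hTiter : ∀ j, ∀ t ∈ K, ∀ v ∈ K, ‖t‖ ≤ δ → ‖v‖ ≤ δ →
      (f t)^[i₀ + j] (param a₀ (a t + T j t v)) = param c₀ (c t + v) := by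
    intro j t ht v hv htδ hvδ
    induction j with
    | zero =>
      have h1 := hS₀ t ht v hv (htδ.trans (hδ₅.trans hr₅₄)) (hvδ.trans (hδ₅.trans hr₅₄))
      rw [hT0, add_zero]
      refine h1.2.2.2.trans (congrArg _ ?_)
      have := h1.2.2.1
      simp only at this
      linear_combination this
    | succ j ih =>
      have h1 := hT j t ht v hv (htδ.trans hδ₅) (hvδ.trans hδ₅)
      have h2 := hT (j + 1) t ht v hv (htδ.trans hδ₅) (hvδ.trans hδ₅)
      rw [← add_assoc, Function.iterate_succ_apply, hkmap t _ (htδ.trans hδδ₁) h2.2.1, h1.2.2, ih]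
  have hsubi : ∀ {i}, i₀ ≤ i → i₀ + (i - i₀) = i := fun hi => by omega
  set M := max (max M₁ M₂) (max M₃ (A * ‖β₀‖ ^ i₀)) with hM
  have hMM₁ : M₁ ≤ M := (le_max_left _ _).trans (le_max_left _ _)
  have hMM₂ : M₂ ≤ M := (le_max_right _ _).trans (le_max_left _ _)
  have hMM₃ : M₃ ≤ M := (le_max_left _ _).trans (le_max_right _ _)
  have hMA : A * ‖β₀‖ ^ i₀ ≤ M := (le_max_right _ _).trans (le_max_right _ _)
  let L : LocalModel K :=
    { lam := β₀, zeta := zeta, eta := β₀ ^ i₀ * β⁻¹, rho := rho, rho' := rho', d := d, d' := d'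
      G := G, E := fun t v => E (t, v), S := fun i => T (i - i₀), δ := δ, M := M, i₀ := i₀
      lam_mem := hlamK, one_lt := hlam1, zeta_mem := hzetaK, zeta_ne := hzeta0
      eta_mem := mul_mem (pow_mem hlamK _) (inv_mem hβK)
      eta_ne := mul_ne_zero (pow_ne_zero _ hlam0) (inv_ne_zero hβ0)
      rho_mem := hE0 ▸ hE.mem.self_of_nhds (zero_mem K) (zero_mem K), rho_ne := hrho
      rho'_mem := hG0 ▸ hG.mem.self_of_nhds (zero_mem K), rho'_ne := hrho'
      d_ne := hd, d'_ne := hd', δ_pos := hδ0, M_nonneg := hM₁.trans hMM₁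
      G_mem := fun t ht htδ => hGmem t (by simpa using htδ.trans hδ₇) ht
      G_zero := hG0
      G_lip := fun t t' ht ht' => (hGlip t t' (by simpa using ht.trans hδ₆)
        (by simpa using ht'.trans hδ₆)).trans (by gcongr)
      E_mem := fun t ht v hv htδ hvδ => (hEmem t v (by simpa using htδ.trans hδ₉)
        (by simpa using hvδ.trans hδ₉)).1 ht hv
      E_zero := hE0
      E_lip := fun t t' v v' ht ht' hv hv' => by
        have := hElip (t, v) (t', v')
          (by rw [Prod.mk_sub_mk, sub_zero, sub_zero]; exact max_le (ht.trans hδ₈) (hv.trans hδ₈))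
          (by
            rw [Prod.mk_sub_mk, sub_zero, sub_zero]; exact max_le (ht'.trans hδ₈) (hv'.trans hδ₈))
        rw [Prod.mk_sub_mk, Prod.norm_mk] at this
        exact this.trans (by gcongr)
      S_mem := fun i _ t ht v hv htδ hvδ =>
        (hT (i - i₀) t ht v hv (htδ.trans hδ₅) (hvδ.trans hδ₅)).1
      S_close := fun i hi t ht v hv htδ hvδ => by
        have := hTclose (i - i₀) t ht v hv htδ hvδ
        rwa [hsubi hi] at this
      S_sub := fun i hi t ht v hv v' hv' htδ hvδ hvδ' => by
        have := hTv (i - i₀) t ht v hv v' hv' (htδ.trans hδ₅) (hvδ.trans hδ₅) (hvδ'.trans hδ₅)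
        convert this using 1
        have h1 : β₀ ^ i = β₀ ^ i₀ * β₀ ^ (i - i₀) := by rw [← pow_add, hsubi hi]
        have h2 : β₀ ^ i₀ ≠ 0 := pow_ne_zero _ hlam0
        rw [h1]
        field_simp
      S_lip := fun i hi t ht t' ht' v hv htδ htδ' hvδ => by
        refine (hTt (i - i₀) t ht t' ht' v hv (htδ.trans hδ₅) (htδ'.trans hδ₅)
          (hvδ.trans hδ₅)).trans ?_
        have h1 : (‖β₀‖ ^ (i - i₀))⁻¹ = ‖β₀‖ ^ i₀ * (‖β₀‖ ^ i)⁻¹ := by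
          have : ‖β₀‖ ^ i = ‖β₀‖ ^ i₀ * ‖β₀‖ ^ (i - i₀) := by rw [← pow_add, hsubi hi]
          rw [this]; field_simp
        rw [h1, ← mul_assoc]
        gcongr }
  refine ⟨{ L with
    δ₁ := δ₁
    k := fun t y => k (t, y)
    δ₁_pos := hδ₁0
    δ_le := hδδ₁
    k_mem := fun t ht htδ => hkK t ht 0 (zero_mem K) htδ h0δ₁
    k_close := hkclose
    k_lip := fun t y y' ht hy hy' => by
      have := hklip t t y y' ht ht hy hy'
      rw [sub_self, norm_zero, max_eq_right (norm_nonneg _)] at this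
      exact this.trans (by gcongr)
    k_map := hkmap
    Lam_map := fun t v ht hv => (hEmem t v (by simpa using ht.trans hδ₉)
        (by simpa using hv.trans hδ₉)).2
    S_norm_le := fun i _ t ht v hv htδ hvδ =>
      (hT (i - i₀) t ht v hv (htδ.trans hδ₅) (hvδ.trans hδ₅)).2.1
    S_step := fun i hi t ht v hv htδ hvδ => by
      have := (hT (i - i₀) t ht v hv (htδ.trans hδ₅) (hvδ.trans hδ₅)).2.2
      rwa [← Nat.sub_add_comm (show i₀ ≤ i from hi)] at this
    S_iter := fun i hi t ht v hv htδ hvδ => by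
      have := hTiter (i - i₀) t ht v hv htδ hvδ
      rwa [hsubi hi] at this }, rfl, rfl, rfl, rfl, rfl, rfl⟩

end DynamicalModel

/-! ### Changes of coordinates -/

section ChartChange

variable {F : Type*} [NontriviallyNormedField F] {f : OnePoint F → OnePoint F} {b e : OnePoint F}
  {u₁ : F} {Φ : F → F}

open Classical in
/-- The derivative at `u` of the change from the coordinate `coord b` to the standard coordinate at
the point `param b u`. -/
noncomputable def chartFactor : OnePoint F → F → F
  | OnePoint.infty, u => if u = 0 then 1 else -(u ^ 2)⁻¹
  | OnePoint.some _, _ => 1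

theorem chartFactor_ne_zero (b : OnePoint F) (u : F) : chartFactor b u ≠ 0 := by
  induction b using OnePoint.rec with
  | infty => by_cases hu : u = 0 <;> simp [chartFactor, hu]
  | coe b => simp [chartFactor]

theorem chartFactor_mem {K : Subfield F} (b : OnePoint F) {u : F} (hu : u ∈ K) :
    chartFactor b u ∈ K := by
  induction b using OnePoint.rec with
  | infty =>
    by_cases h : u = 0
    · simp [chartFactor, h, one_mem]
    · simpa [chartFactor, h] using pow_mem hu 2
  | coe b => simp [chartFactor, one_mem]

/-- The change from the coordinate at `b` to the standard coordinate at a point, to first order. -/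
theorem exists_chart_change (b : OnePoint F) (u₁ : F) : ∃ ψ : F → F, AnalyticAt F ψ u₁ ∧
    ψ u₁ = chartFactor b u₁ ∧ ∀ᶠ x in 𝓝 u₁, coord (param b u₁) (param b x)
      = coord (param b u₁) (param b u₁) + (x - u₁) * ψ x ∧
      param (param b u₁) (coord (param b u₁) (param b x)) = param b x := by
  induction b using OnePoint.rec with
  | infty =>
    by_cases hu : u₁ = 0
    · subst hu
      refine ⟨fun _ => 1, analyticAt_const, by simp [chartFactor], Eventually.of_forall fun x => ?_⟩
      have : (param OnePoint.infty (0 : F)) = OnePoint.infty := by simp [param]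
      rw [this, coord_param]
      simp [coord]
    · refine ⟨fun x => -(x * u₁)⁻¹, ((analyticAt_id.mul analyticAt_const).inv ?_).neg, ?_, ?_⟩
      · simpa using hu
      · simp [chartFactor, hu, pow_two]
      · filter_upwards [(isOpen_ne (x := (0 : F))).mem_nhds hu] with x hx
        have hx : x ≠ 0 := hx
        simp only [param, coord, hu, hx, if_false, and_true]
        field_simp
        ring
  | coe b =>
    exact ⟨fun _ => 1, analyticAt_const, by simp [chartFactor], Eventually.of_forall fun x => by
      simp [param, coord]⟩

/-- The change from the standard coordinate at a point to the coordinate at `b`, to first order. -/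
theorem exists_chart_change_inv (b : OnePoint F) (u₁ : F) : ∃ χ : F → F,
    AnalyticAt F χ (coord (param b u₁) (param b u₁)) ∧
    χ (coord (param b u₁) (param b u₁)) = (chartFactor b u₁)⁻¹ ∧
    ∀ᶠ w in 𝓝 (coord (param b u₁) (param b u₁)),
      param (param b u₁) w = param b (u₁ + (w - coord (param b u₁) (param b u₁)) * χ w) := by
  induction b using OnePoint.rec with
  | infty =>
    by_cases hu : u₁ = 0
    · subst hu
      have : (param OnePoint.infty (0 : F)) = OnePoint.infty := by simp [param]
      exact ⟨fun _ => 1, analyticAt_const, by simp [chartFactor], Eventually.of_forall fun x => by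
        simp [this, coord]⟩
    · have h1 : param OnePoint.infty u₁ = OnePoint.some u₁⁻¹ := by simp [param, hu]
      rw [h1]
      refine ⟨fun w => -(u₁ / w), (analyticAt_const.div analyticAt_id ?_).neg, ?_, ?_⟩
      · simpa [coord] using hu
      · simp [chartFactor, hu, coord, pow_two]
      · have h2 : ({0}ᶜ : Set F) ∈ 𝓝 (coord (OnePoint.some u₁⁻¹) (OnePoint.some u₁⁻¹)) :=
          isOpen_compl_singleton.mem_nhds (by simpa [coord] using hu)
        filter_upwards [h2] with w hw
        have hw : w ≠ 0 := hw
        have h3 : u₁ + (w - u₁⁻¹) * -(u₁ / w) = w⁻¹ := by field_simp; ring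
        simp only [param, coord, h3, inv_eq_zero, hw, if_false, inv_inv]
  | coe b =>
    exact ⟨fun _ => 1, analyticAt_const, by simp [chartFactor], Eventually.of_forall fun x => by
      simp [param, coord]⟩

/-- The leading term of `f` at a point in the standard coordinates, obtained from its leading term
in arbitrary coordinates. -/
theorem hasLeadingTerm_chartMap {h : F → F} {d : ℕ} (hd : d ≠ 0)
    (hf : ∀ᶠ u in 𝓝 u₁, f (param b u) = param e (Φ u))
    (hΦ : ∀ᶠ u in 𝓝 u₁, Φ u = Φ u₁ + (u - u₁) ^ d * h u) (hh : AnalyticAt F h u₁)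
    (hh0 : h u₁ ≠ 0) :
    HasLeadingTerm (fun w => chartMap f (param b u₁) w
        - coord (param e (Φ u₁)) (param e (Φ u₁))) (coord (param b u₁) (param b u₁)) d
      (chartFactor e (Φ u₁) * h u₁ * ((chartFactor b u₁)⁻¹) ^ d) := by
  refine ⟨mul_ne_zero (mul_ne_zero (chartFactor_ne_zero _ _) hh0)
    (pow_ne_zero _ (inv_ne_zero (chartFactor_ne_zero _ _))), ?_⟩
  obtain ⟨ψ, hψ, hψ1, hψ2⟩ := exists_chart_change e (Φ u₁)
  obtain ⟨χ, hχ, hχ1, hχ2⟩ := exists_chart_change_inv b u₁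
  have hf1 := hf.self_of_nhds
  set w₁ := coord (param b u₁) (param b u₁) with hw₁
  -- the coordinate change of the source, and the map it induces
  have hσ : AnalyticAt F (fun w => u₁ + (w - w₁) * χ w) w₁ :=
    analyticAt_const.add ((analyticAt_id.sub analyticAt_const).mul hχ)
  have hσ1 : u₁ + (w₁ - w₁) * χ w₁ = u₁ := by simp
  have hΨ : AnalyticAt F (fun u => Φ u₁ + (u - u₁) ^ d * h u) u₁ :=
    analyticAt_const.add (((analyticAt_id.sub analyticAt_const).pow d).mul hh)
  have hΨ1 : Φ u₁ + (u₁ - u₁) ^ d * h u₁ = Φ u₁ := by simp [hd]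
  have hΨσ : AnalyticAt F (fun w => Φ u₁ + ((u₁ + (w - w₁) * χ w) - u₁) ^ d
      * h (u₁ + (w - w₁) * χ w)) w₁ :=
    AnalyticAt.fun_comp (f := fun w => u₁ + (w - w₁) * χ w) (by rw [hσ1]; exact hΨ) hσ
  have hhσ : AnalyticAt F (fun w => h (u₁ + (w - w₁) * χ w)) w₁ :=
    AnalyticAt.fun_comp (f := fun w => u₁ + (w - w₁) * χ w) (by rw [hσ1]; exact hh) hσ
  have hψσ : AnalyticAt F (fun w => ψ (Φ u₁ + ((u₁ + (w - w₁) * χ w) - u₁) ^ d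
      * h (u₁ + (w - w₁) * χ w))) w₁ :=
    AnalyticAt.fun_comp (g := ψ) (by rw [hσ1, hΨ1]; exact hψ) hΨσ
  have hσt : Tendsto (fun w => u₁ + (w - w₁) * χ w) (𝓝 w₁) (𝓝 u₁) := by
    have := hσ.continuousAt.tendsto; rwa [hσ1] at this
  have hΨt : Tendsto (fun u => Φ u₁ + (u - u₁) ^ d * h u) (𝓝 u₁) (𝓝 (Φ u₁)) := by
    have := hΨ.continuousAt.tendsto; rwa [hΨ1] at this
  refine ⟨fun w => ψ (Φ u₁ + ((u₁ + (w - w₁) * χ w) - u₁) ^ d * h (u₁ + (w - w₁) * χ w))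
    * h (u₁ + (w - w₁) * χ w) * χ w ^ d, (hψσ.mul hhσ).mul (hχ.pow d), ?_, ?_⟩
  · beta_reduce
    rw [hσ1, hΨ1, hψ1, hχ1]
  · filter_upwards [hχ2, hσt.eventually (hf.and (hΦ.and (hΨt.eventually hψ2)))] with w h1 h2
    rw [chartMap, h1, h2.1, h2.2.1, hf1, h2.2.2.1, add_sub_cancel_left, add_sub_cancel_left,
      add_sub_cancel_left, mul_pow]
    ring

theorem HasLeadingTerm.hasDerivAt {g : F → F} {ρ : F} (h : HasLeadingTerm g u₁ 1 ρ) :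
    HasDerivAt g ρ u₁ := by
  obtain ⟨-, k, hk, rfl, hg⟩ := h
  have h1 := ((hasDerivAt_id u₁).sub_const u₁).mul hk.differentiableAt.hasDerivAt
  have h2 : HasDerivAt (fun u => (u - u₁) ^ 1 * k u) (k u₁) u₁ := by
    simpa [Pi.mul_def] using h1
  exact h2.congr_of_eventuallyEq hg

/-- The multiplier of a fixed point is its multiplier in any coordinate. -/
theorem multiplier_param {h : F → F} (hf : ∀ᶠ u in 𝓝 u₁, f (param b u) = param b (Φ u))
    (hu₁ : Φ u₁ = u₁) (hΦ : ∀ᶠ u in 𝓝 u₁, Φ u = Φ u₁ + (u - u₁) * h u) (hh : AnalyticAt F h u₁)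
    (hh0 : h u₁ ≠ 0) : multiplier f (param b u₁) = h u₁ := by
  have h1 := (hasLeadingTerm_chartMap one_ne_zero hf (by simpa only [pow_one] using hΦ) hh
    hh0).hasDerivAt
  rw [hu₁, pow_one, mul_right_comm, mul_inv_cancel₀ (chartFactor_ne_zero _ _), one_mul] at h1
  have h2 := h1.add_const (coord (param b u₁) (param b u₁))
  simp only [sub_add_cancel] at h2
  exact h2.deriv

/-- An analytic map of a given degree has a leading term. -/
theorem exists_leading_factor {d : ℕ} (hΦ : AnalyticAt F Φ u₁)
    (hf : ∀ᶠ u in 𝓝 u₁, f (param b u) = param e (Φ u)) (h : HasDeg f (param b u₁) d) :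
    ∃ h : F → F, AnalyticAt F h u₁ ∧ h u₁ ≠ 0 ∧
      ∀ᶠ u in 𝓝 u₁, Φ u = Φ u₁ + (u - u₁) ^ d * h u := by
  rw [hasDeg_iff_order hΦ hf, (hΦ.fun_sub analyticAt_const).analyticOrderAt_eq_natCast] at h
  obtain ⟨g, hg, hg0, hge⟩ := h
  refine ⟨g, hg, hg0, hge.mono fun u hu => ?_⟩
  rw [← sub_eq_iff_eq_add', hu, smul_eq_mul]

end ChartChange

/-! ### Derivatives in charts -/

section ChartDeriv

variable {F : Type*} [NontriviallyNormedField F] {g g' : OnePoint F → OnePoint F}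
  {b e e' : OnePoint F} {x₁ y₁ z₁ β β' : F}

/-- In the coordinates `coord b` and `coord e`, the map `g` sends `x₁` to `y₁`, with derivative
`β`. -/
def HasChartDeriv (g : OnePoint F → OnePoint F) (b : OnePoint F) (x₁ : F) (e : OnePoint F)
    (y₁ β : F) : Prop :=
  ∃ Φ : F → F, HasDerivAt Φ β x₁ ∧ Φ x₁ = y₁ ∧ ∀ᶠ x in 𝓝 x₁, g (param b x) = param e (Φ x)

theorem HasChartDeriv.comp (h : HasChartDeriv g b x₁ e y₁ β)
    (h' : HasChartDeriv g' e y₁ e' z₁ β') : HasChartDeriv (g' ∘ g) b x₁ e' z₁ (β' * β) := by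
  obtain ⟨Φ, hΦ, rfl, hg⟩ := h
  obtain ⟨Ψ, hΨ, rfl, hg'⟩ := h'
  refine ⟨Ψ ∘ Φ, hΨ.comp x₁ hΦ, rfl, ?_⟩
  filter_upwards [hg, hΦ.continuousAt.tendsto.eventually hg'] with x h1 h2
  rw [Function.comp_apply, h1, h2, Function.comp_apply]

theorem HasChartDeriv.hasDerivAt (h : HasChartDeriv g b x₁ e y₁ β) {Φ : F → F}
    (hΦ : ∀ᶠ x in 𝓝 x₁, g (param b x) = param e (Φ x)) : HasDerivAt Φ β x₁ := by
  obtain ⟨Ψ, hΨ, -, hg⟩ := h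
  refine hΨ.congr_of_eventuallyEq ?_
  filter_upwards [hΦ, hg] with x h1 h2
  exact param_injective e (h1.symm.trans h2)

theorem HasChartDeriv.apply_eq (h : HasChartDeriv g b x₁ e y₁ β) :
    g (param b x₁) = param e y₁ := by
  obtain ⟨Φ, -, rfl, hg⟩ := h
  exact hg.self_of_nhds

/-- A map whose derivative at a point does not vanish has degree one there. -/
theorem HasChartDeriv.hasDeg_one (h : HasChartDeriv g b x₁ e y₁ β) (hβ : β ≠ 0) :
    HasDeg g (param b x₁) 1 := by
  obtain ⟨Φ, hΦ, -, hg⟩ := h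
  rw [hasDeg_param_iff hΦ.continuousAt hg]
  have h0 : 0 < ‖β‖ / 2 := half_pos (norm_pos_iff.mpr hβ)
  refine ⟨‖β‖ / 2, 2 * ‖β‖, h0, ?_⟩
  filter_upwards [hΦ.isLittleO.def h0] with x hx
  rw [smul_eq_mul] at hx
  have h1 := norm_sub_norm_le ((x - x₁) * β) ((x - x₁) * β - (Φ x - Φ x₁))
  have h2 := norm_sub_norm_le (Φ x - Φ x₁) ((x - x₁) * β)
  rw [sub_sub_cancel, norm_sub_rev ((x - x₁) * β), norm_mul] at h1
  rw [norm_mul] at h2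
  rw [pow_one]
  constructor <;> nlinarith [norm_nonneg (x - x₁)]

/-- The iterates of an analytic family of rational maps are differentiable in any charts. -/
theorem exists_hasChartDeriv {K : Subfield F} {t : F} {f : F → OnePoint F → OnePoint F}
    (hf : AnalyticRational K t f) {k : ℕ} (h : (f t)^[k] (param b x₁) = param e y₁) :
    ∃ β, HasChartDeriv (f t)^[k] b x₁ e y₁ β := by
  obtain ⟨Φ, hΦ, hΦ1, hg⟩ := exists_chart hf (AnalyticOver.const (zero_mem K)) (b := b) (e := e)
    (k := k) (v₁ := x₁) (x₁ := y₁) (by rwa [zero_add])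
  have hcurve : Tendsto (fun x => (t, x)) (𝓝 x₁) (𝓝 (t, x₁)) :=
    (Continuous.prodMk_right t).tendsto _
  refine ⟨_, fun x => Φ (t, x), (hΦ.analyticAt.comp (f := fun x => (t, x))
    (AnalyticAt.prod analyticAt_const analyticAt_id)).differentiableAt.hasDerivAt, hΦ1, ?_⟩
  filter_upwards [hcurve.eventually hg] with x hx
  rwa [zero_add] at hx

/-- A derivative can be estimated along any set of points that accumulate. -/
theorem relClose_of_hasDerivAt [IsUltrametricDist F] {ι : Type*} {l : Filter ι} [l.NeBot]
    {Φ : F → F} {x : ι → F} {γ : F} {ε : ℝ} (hΦ : HasDerivAt Φ β x₁)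
    (hx : Tendsto x l (𝓝[≠] x₁))
    (h : ∀ᶠ i in l, RelClose ε (Φ (x i) - Φ x₁) (γ * (x i - x₁))) : RelClose ε β γ := by
  refine RelClose.of_frequently ((hasDerivAt_iff_tendsto_slope.mp hΦ).comp hx)
    (Eventually.frequently ?_)
  filter_upwards [h, hx.eventually self_mem_nhdsWithin] with i h1 h2
  have h3 : x i - x₁ ≠ 0 := sub_ne_zero.mpr h2
  have h4 := h1.mul_left (x i - x₁)⁻¹
  rw [Function.comp_apply, slope_def_field, div_eq_inv_mul]
  rwa [mul_comm γ, inv_mul_cancel_left₀ h3] at h4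

end ChartDeriv

section Bifurcation

variable {F : Type*} [NontriviallyNormedField F] [IsUltrametricDist F] {K : Subfield F}
  {f : F → OnePoint F → OnePoint F} {a₀ c₀ : OnePoint F} {a c : F → F} {ℓ : ℕ}

namespace DynamicalModel

variable (L : DynamicalModel K f a₀ c₀ a c ℓ)

theorem eps_nonneg : 0 ≤ ‖(L.d : F)‖ ^ 4 * ‖(L.d' : F)‖ ^ 2 / 2 := by positivity

theorem eps_le : ‖(L.d : F)‖ ^ 4 * ‖(L.d' : F)‖ ^ 2 / 2 ≤ ‖(L.d : F)‖ ^ 2 / 2 := by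
  have h1 : ‖(L.d : F)‖ ^ 4 ≤ ‖(L.d : F)‖ ^ 2 :=
    pow_le_pow_of_le_one (norm_nonneg _) L.norm_d_le (by norm_num)
  have h2 : ‖(L.d' : F)‖ ^ 2 ≤ 1 := pow_le_one₀ (norm_nonneg _) L.norm_d'_le
  have h3 : ‖(L.d : F)‖ ^ 4 * ‖(L.d' : F)‖ ^ 2 ≤ ‖(L.d : F)‖ ^ 4 :=
    mul_le_of_le_one_right (by positivity) h2
  linarith

theorem sq_lt_one : ‖(L.d : F)‖ ^ 2 / 2 < 1 := by
  have : ‖(L.d : F)‖ ^ 2 ≤ 1 := pow_le_one₀ (norm_nonneg _) L.norm_d_le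
  linarith

theorem eps_lt_one : ‖(L.d : F)‖ ^ 4 * ‖(L.d' : F)‖ ^ 2 / 2 < 1 := L.eps_le.trans_lt L.sq_lt_one

theorem cube_lt_one : ‖(L.d : F)‖ ^ 3 / 2 < 1 := by
  have : ‖(L.d : F)‖ ^ 3 ≤ 1 := pow_le_one₀ (norm_nonneg _) L.norm_d_le
  linarith

theorem S_norm {i : ℕ} (hi : L.i₀ ≤ i) {t v : F} (ht : t ∈ K) (hv : v ∈ K) (htδ : ‖t‖ ≤ L.δ)
    (hvδ : ‖v‖ ≤ L.δ) : ‖L.S i t v‖ = (‖L.lam‖ ^ i)⁻¹ * ‖L.zeta‖ := by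
  rw [(L.S_close i hi t ht v hv htδ hvδ).norm_eq L.eps_lt_one, norm_mul, norm_inv, norm_pow]

theorem map_fixed {t : F} (ht : ‖t‖ ≤ L.δ₁) : f t (param a₀ (a t)) = param a₀ (a t) := by
  have := L.k_map t 0 ht (by simpa using L.δ₁_pos.le)
  simpa using this

/-- Along the inverse branches, the iterate `f t ^ i` has a derivative close to `lam ^ i / eta`. The
branches are only known over `K`, so the derivative is estimated along points of `K`. -/
theorem hasChartDeriv_iterate {i : ℕ} (hi : L.i₀ ≤ i) {t v : F} (hf : AnalyticRational K t f)
    (ht : t ∈ K) (hv : v ∈ K) (htδ : ‖t‖ ≤ L.δ) (hvδ : ‖v‖ ≤ L.δ) :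
    ∃ β, HasChartDeriv (f t)^[i] a₀ (a t + L.S i t v) c₀ (c t + v) β ∧
      RelClose (‖(L.d : F)‖ ^ 4 * ‖(L.d' : F)‖ ^ 2 / 2) β (L.lam ^ i * L.eta⁻¹) := by
  obtain ⟨β, hβ⟩ := exists_hasChartDeriv hf (L.S_iter i hi t ht v hv htδ hvδ)
  refine ⟨β, hβ, ?_⟩
  obtain ⟨Φ, hΦ, hΦ1, hg⟩ := hβ
  have hne : (𝓝[≠] v ⊓ 𝓟 (K : Set F)).NeBot :=
    frequently_mem_iff_neBot.mp (frequently_mem_nhdsNE L.lam_mem L.one_lt hv)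
  have hev : ∀ᶠ v' in 𝓝[≠] v ⊓ 𝓟 (K : Set F), v' ≠ v ∧ v' ∈ K ∧ ‖v'‖ ≤ L.δ := by
    have h1 : ∀ᶠ v' in 𝓝 v, ‖v' - v‖ ≤ L.δ := by
      filter_upwards [Metric.closedBall_mem_nhds v L.δ_pos] with v' hv'
      rwa [← dist_eq_norm]
    filter_upwards [mem_inf_of_left self_mem_nhdsWithin, mem_inf_of_right (mem_principal_self _),
      mem_inf_of_left (nhdsWithin_le_nhds h1)] with v' h2 h3 h4
    refine ⟨h2, h3, ?_⟩
    rw [← sub_add_cancel v' v]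
    exact norm_add_le_of_le_of_le h4 hvδ
  have hA0 : (L.lam ^ i)⁻¹ * L.eta ≠ 0 :=
    mul_ne_zero (inv_ne_zero (pow_ne_zero _ L.lam_ne)) L.eta_ne
  have hsub := fun v' (h : v' ≠ v ∧ v' ∈ K ∧ ‖v'‖ ≤ L.δ) =>
    L.S_sub i hi t ht v' h.2.1 v hv htδ h.2.2 hvδ
  have hx : Tendsto (fun v' => a t + L.S i t v') (𝓝[≠] v ⊓ 𝓟 (K : Set F))
      (𝓝[≠] (a t + L.S i t v)) := by
    rw [tendsto_nhdsWithin_iff]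
    constructor
    · rw [tendsto_iff_norm_sub_tendsto_zero]
      have h1 : Tendsto (fun v' => ‖(L.lam ^ i)⁻¹ * L.eta * (v' - v)‖) (𝓝[≠] v ⊓ 𝓟 (K : Set F))
          (𝓝 0) := by
        have : Tendsto (fun v' => ‖(L.lam ^ i)⁻¹ * L.eta * (v' - v)‖) (𝓝 v)
            (𝓝 ‖(L.lam ^ i)⁻¹ * L.eta * (v - v)‖) := Continuous.tendsto (by fun_prop) v
        rw [sub_self, mul_zero, norm_zero] at this
        exact this.mono_left (inf_le_left.trans nhdsWithin_le_nhds)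
      refine h1.congr' ?_
      filter_upwards [hev] with v' hv'
      rw [add_sub_add_left_eq_sub, (hsub v' hv').norm_eq L.eps_lt_one]
    · filter_upwards [hev] with v' hv' h
      have h1 := (hsub v' hv').ne_zero L.eps_lt_one (mul_ne_zero hA0 (sub_ne_zero.mpr hv'.1))
      exact h1 (sub_eq_zero.mpr (add_left_cancel h))
  refine relClose_of_hasDerivAt hΦ hx ?_
  filter_upwards [hev, (hx.mono_right nhdsWithin_le_nhds).eventually hg] with v' hv' h1
  have h2 : Φ (a t + L.S i t v') = c t + v' := by
    rw [L.S_iter i hi t ht v' hv'.2.1 htδ hv'.2.2] at h1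
    exact (param_injective c₀ h1).symm
  rw [hΦ1, h2, add_sub_add_left_eq_sub, add_sub_add_left_eq_sub]
  have h3 := (hsub v' hv').mul_left (L.lam ^ i * L.eta⁻¹)
  have h4 : L.lam ^ i * L.eta⁻¹ * ((L.lam ^ i)⁻¹ * L.eta * (v' - v)) = v' - v := by
    have := pow_ne_zero i L.lam_ne
    have := L.eta_ne
    field_simp
  rw [h4] at h3
  exact h3.symm L.eps_lt_one

end DynamicalModel

end Bifurcation

/-! ### Passages of the critical point -/

section Passages

variable {F : Type*} [NontriviallyNormedField F] [IsUltrametricDist F] {K : Subfield F}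
  {f : F → OnePoint F → OnePoint F} {a₀ c₀ : OnePoint F} {a c : F → F} {ℓ : ℕ}

namespace DynamicalModel

variable (L : DynamicalModel K f a₀ c₀ a c ℓ)

/-- On the polydisc of radius `μ` the passage from the critical point to the fixed point has its
leading coefficient at the parameter `0`, up to a small relative error. -/
theorem E_close {μ : ℝ} (hμ : μ ≤ L.δ) (hμρ : L.M * μ ≤ ‖(L.d : F)‖ ^ 2 / 2 * ‖L.rho‖) {t v : F}
    (ht : ‖t‖ ≤ μ) (hv : ‖v‖ ≤ μ) : RelClose (‖(L.d : F)‖ ^ 2 / 2) (L.E t v) L.rho := by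
  have h0 : ‖(0 : F)‖ ≤ L.δ := by simpa using L.δ_pos.le
  have h1 := L.E_lip t 0 v 0 (ht.trans hμ) h0 (hv.trans hμ) h0
  rw [L.E_zero, sub_zero, sub_zero] at h1
  exact h1.trans ((mul_le_mul_of_nonneg_left (max_le ht hv) L.M_nonneg).trans hμρ)

theorem Lam_sub_zero (t v : F) : L.Lam t v - L.Lam t 0 = v ^ L.d * L.E t v := by
  rw [L.Lam_zero, LocalModel.Lam, add_sub_cancel_left]

theorem continuousAt_E {t : F} (ht : ‖t‖ ≤ L.δ) : ContinuousAt (L.E t) 0 := by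
  have h0 : ‖(0 : F)‖ ≤ L.δ := by simpa using L.δ_pos.le
  rw [ContinuousAt, tendsto_iff_norm_sub_tendsto_zero]
  have h1 : Tendsto (fun v : F => L.M * ‖v‖) (𝓝 0) (𝓝 0) := by
    have : Tendsto (fun v : F => L.M * ‖v‖) (𝓝 0) (𝓝 (L.M * ‖(0 : F)‖)) :=
      Continuous.tendsto (by fun_prop) 0
    simpa using this
  refine squeeze_zero' (Eventually.of_forall fun _ => norm_nonneg _) ?_ h1
  filter_upwards [Metric.closedBall_mem_nhds (0 : F) L.δ_pos] with v hv
  have h2 := L.E_lip t t v 0 ht ht (by simpa using hv) h0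
  rwa [sub_self, norm_zero, sub_zero, max_eq_right (norm_nonneg _)] at h2

theorem continuousAt_Lam {t : F} (ht : ‖t‖ ≤ L.δ) : ContinuousAt (L.Lam t) 0 := by
  unfold LocalModel.Lam
  exact continuousAt_const.add ((continuousAt_id.pow _).mul (L.continuousAt_E ht))

/-- The degree of `f t ^ ℓ` at the critical point is the same for all small parameters. -/
theorem hasDeg_critical {μ : ℝ} (hμ0 : 0 < μ) (hμ : μ ≤ L.δ)
    (hμρ : L.M * μ ≤ ‖(L.d : F)‖ ^ 2 / 2 * ‖L.rho‖) {t : F} (ht : ‖t‖ ≤ μ) :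
    HasDeg (f t)^[ℓ] (param c₀ (c t)) L.d := by
  have h0 := hasDeg_param_add_iff (g := (f t)^[ℓ]) (b := c₀) (e := a₀) (s := c t) (x₁ := 0)
    (Ψ := fun v => a t + L.Lam t v) (n := L.d)
    (continuousAt_const.add (L.continuousAt_Lam (ht.trans hμ))) (by
      filter_upwards [Metric.closedBall_mem_nhds (0 : F) L.δ_pos] with v hv
      exact L.Lam_map t v (ht.trans hμ) (by simpa using hv))
  rw [add_zero] at h0
  rw [h0]
  refine ⟨‖L.rho‖, ‖L.rho‖, norm_pos_iff.mpr L.rho_ne, ?_⟩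
  filter_upwards [Metric.closedBall_mem_nhds (0 : F) hμ0] with v hv
  have hv : ‖v‖ ≤ μ := by simpa using hv
  have h1 := (L.E_close hμ hμρ ht hv).norm_eq L.sq_lt_one
  rw [add_sub_add_left_eq_sub, L.Lam_sub_zero, norm_mul, norm_pow, h1, sub_zero, mul_comm]
  exact ⟨le_rfl, le_rfl⟩

end DynamicalModel

namespace LocalModel.Solution

variable {L : DynamicalModel K f a₀ c₀ a c ℓ} {J : ℕ} {μ : ℝ} (s : L.Solution J μ)

/-- The approximate derivative of one cycle between returns: the passage near the fixed point, from
the coordinate of the image under `R ^ ℓ` of the point with coordinate `ω (j + 1)` to the coordinate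
`ω j`, followed by `R ^ ℓ`. -/
def returnFactor : F := L.lam ^ (2 * s.n) * L.eta⁻¹ * (L.d * L.rho * s.v₀ ^ (L.d - 1))

theorem t_le (hμ : μ ≤ L.δ) : ‖s.t‖ ≤ L.δ := s.norm_t.trans hμ

theorem t_near : ‖s.t - s.t‖ ≤ s.s := by simpa using s.s_pos.le

theorem norm_ω (j : ℕ) {t' : F} (ht' : t' ∈ K) (h : ‖t' - s.t‖ ≤ s.s) : ‖s.ω j t'‖ = ‖s.v₀‖ :=
  (s.ω_close j t' ht' h).norm_eq L.cube_lt_one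

theorem ω_le (hμ : μ ≤ L.δ) (j : ℕ) {t' : F} (ht' : t' ∈ K) (h : ‖t' - s.t‖ ≤ s.s) :
    ‖s.ω j t'‖ ≤ L.δ := by
  rw [s.norm_ω j ht' h]; exact s.norm_v₀.trans hμ

theorem linear_ne_zero : L.d * L.rho * s.v₀ ^ (L.d - 1) ≠ 0 :=
  mul_ne_zero (mul_ne_zero L.d_ne L.rho_ne) (pow_ne_zero _ s.v₀_ne)

theorem returnFactor_ne_zero : s.returnFactor ≠ 0 :=
  mul_ne_zero (mul_ne_zero (pow_ne_zero _ L.lam_ne) (inv_ne_zero L.eta_ne)) s.linear_ne_zero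

/-- The points with coordinates `ω j` land on the fixed point. -/
theorem iterate_ω (hμ : μ ≤ L.δ) (j : ℕ) {t' : F} (ht' : t' ∈ K) (h : ‖t' - s.t‖ ≤ s.s) :
    (f t')^[ℓ + j * (2 * s.n + ℓ)] (param c₀ (c t' + s.ω j t')) = param a₀ (a t') := by
  have htδ := (s.norm_le t' ht' h).trans hμ
  induction j with
  | zero =>
    rw [zero_mul, add_zero, L.Lam_map t' _ htδ (s.ω_le hμ 0 ht' h), s.ω_zero t' ht' h, add_zero]
  | succ j ih =>
    rw [show ℓ + (j + 1) * (2 * s.n + ℓ) = (ℓ + j * (2 * s.n + ℓ)) + (2 * s.n + ℓ) by ring,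
      Function.iterate_add_apply _ (ℓ + j * (2 * s.n + ℓ)), Function.iterate_add_apply _ (2 * s.n),
      L.Lam_map t' _ htδ (s.ω_le hμ _ ht' h), s.ω_succ j t' ht' h,
      L.S_iter _ (by have := s.le_n; omega) t' ht' _ (s.ω_mem j t' ht' h) htδ
        (s.ω_le hμ j ht' h), ih]

/-- The first passage from the critical point to the point with coordinate `ω J`. -/
theorem iterate_S (hμ : μ ≤ L.δ) {t' : F} (ht' : t' ∈ K) (h : ‖t' - s.t‖ ≤ s.s) :
    (f t')^[s.n] (param a₀ (a t' + L.S s.n t' (s.ω J t'))) = param c₀ (c t' + s.ω J t') :=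
  L.S_iter _ s.le_n t' ht' _ (s.ω_mem J t' ht' h) ((s.norm_le t' ht' h).trans hμ)
    (s.ω_le hμ J ht' h)

/-- The derivative of `f t ^ ℓ` at the returns, which is close to that of `rho * v ^ d` at `v₀`. -/
theorem hasChartDeriv_return (hμ : μ ≤ L.δ) (hf : AnalyticRational K s.t f) (j : ℕ) :
    ∃ β, HasChartDeriv (f s.t)^[ℓ] c₀ (c s.t + s.ω j s.t) a₀ (a s.t + L.Lam s.t (s.ω j s.t)) β ∧
      RelClose (‖(L.d : F)‖ ^ 2 / 2) β (L.d * L.rho * s.v₀ ^ (L.d - 1)) := by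
  have hωδ := s.ω_le hμ j s.t_mem s.t_near
  obtain ⟨β, hβ⟩ := exists_hasChartDeriv hf (L.Lam_map s.t _ (s.t_le hμ) hωδ)
  refine ⟨β, hβ, ?_⟩
  obtain ⟨Φ, hΦ, hΦ1, hg⟩ := hβ
  refine relClose_of_hasDerivAt (l := 𝓝[≠] (c s.t + s.ω j s.t)) (x := id) hΦ tendsto_id ?_
  have hω := s.ω_close j s.t s.t_mem s.t_near
  have hd3 : 0 < ‖(L.d : F)‖ ^ 3 / 2 * ‖s.v₀‖ := by
    have := L.norm_d_pos
    have := norm_pos_iff.mpr s.v₀_ne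
    positivity
  refine Filter.Eventually.filter_mono nhdsWithin_le_nhds ?_
  filter_upwards [hg, Metric.closedBall_mem_nhds (c s.t + s.ω j s.t) hd3] with x h1 h2
  have h3 : RelClose (‖(L.d : F)‖ ^ 3 / 2) (x - c s.t) s.v₀ := by
    have h4 : ‖x - c s.t - s.ω j s.t‖ ≤ ‖(L.d : F)‖ ^ 3 / 2 * ‖s.v₀‖ := by
      rw [sub_sub, ← dist_eq_norm]; exact h2
    exact norm_sub_le_of_triangle h4 hω
  have h5 : ‖x - c s.t‖ ≤ L.δ := by
    rw [h3.norm_eq L.cube_lt_one]; exact s.norm_v₀.trans hμ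
  have h6 := L.Lam_map s.t _ (s.t_le hμ) h5
  rw [add_sub_cancel, h1] at h6
  rw [hΦ1, id, param_injective a₀ h6, add_sub_add_left_eq_sub]
  have h7 := s.Lam_sub _ _ h3 hω
  rwa [sub_sub] at h7

/-- The derivative at the point with coordinate `ω j` of the iterate that maps it to the fixed
point. Up to a small relative error it only depends on `j` through the number of factors
`returnFactor`. -/
theorem hasChartDeriv_ω (hμ : μ ≤ L.δ) (hf : AnalyticRational K s.t f) (j : ℕ) :
    ∃ β, HasChartDeriv (f s.t)^[ℓ + j * (2 * s.n + ℓ)] c₀ (c s.t + s.ω j s.t) a₀ (a s.t) β ∧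
      RelClose (‖(L.d : F)‖ ^ 2 / 2) β
        (L.d * L.rho * s.v₀ ^ (L.d - 1) * s.returnFactor ^ j) := by
  induction j with
  | zero =>
    obtain ⟨β, hβ, hβc⟩ := s.hasChartDeriv_return hμ hf 0
    rw [s.ω_zero _ s.t_mem s.t_near, add_zero] at hβ
    exact ⟨β, by simpa using hβ, by simpa using hβc⟩
  | succ j ih =>
    obtain ⟨β, hβ, hβc⟩ := ih
    obtain ⟨β₁, hβ₁, hβ₁c⟩ := s.hasChartDeriv_return hμ hf (j + 1)
    obtain ⟨β₂, hβ₂, hβ₂c⟩ := L.hasChartDeriv_iterate (i := 2 * s.n)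
      (by have := s.le_n; omega) hf s.t_mem (s.ω_mem j _ s.t_mem s.t_near) (s.t_le hμ)
      (s.ω_le hμ j s.t_mem s.t_near)
    rw [s.ω_succ j _ s.t_mem s.t_near] at hβ₁
    have h1 := (hβ₁.comp hβ₂).comp hβ
    rw [← Function.iterate_add, ← Function.iterate_add] at h1
    refine ⟨β * (β₂ * β₁), by convert h1 using 2; ring, ?_⟩
    have h2 := hβc.mul ((hβ₂c.mono L.eps_le).mul hβ₁c L.sq_lt_one) L.sq_lt_one
    convert h2 using 1
    rw [pow_succ, ← mul_assoc]
    rfl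

/-- The passage from the image under `R ^ ℓ` of the critical point to the fixed point. -/
theorem hasChartDeriv_landing (hμ : μ ≤ L.δ) (hf : AnalyticRational K s.t f) :
    ∃ β, HasChartDeriv (f s.t)^[ℓ + J * (2 * s.n + ℓ) + s.n] a₀ (a s.t + L.Lam s.t 0) a₀ (a s.t) β ∧
      RelClose (‖(L.d : F)‖ ^ 2 / 2) β
        (L.d * L.rho * s.v₀ ^ (L.d - 1) * s.returnFactor ^ J * (L.lam ^ s.n * L.eta⁻¹)) := by
  obtain ⟨β, hβ, hβc⟩ := s.hasChartDeriv_ω hμ hf J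
  obtain ⟨β₁, hβ₁, hβ₁c⟩ := L.hasChartDeriv_iterate s.le_n hf s.t_mem
    (s.ω_mem J _ s.t_mem s.t_near) (s.t_le hμ) (s.ω_le hμ J s.t_mem s.t_near)
  rw [← s.landing] at hβ₁
  have h1 := hβ₁.comp hβ
  rw [← Function.iterate_add] at h1
  exact ⟨_, h1, hβc.mul (hβ₁c.mono L.eps_le) L.sq_lt_one⟩

theorem landing_ne_zero {β : F} (h : RelClose (‖(L.d : F)‖ ^ 2 / 2) β
    (L.d * L.rho * s.v₀ ^ (L.d - 1) * s.returnFactor ^ J * (L.lam ^ s.n * L.eta⁻¹))) : β ≠ 0 :=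
  h.ne_zero L.sq_lt_one (mul_ne_zero (mul_ne_zero s.linear_ne_zero
    (pow_ne_zero _ s.returnFactor_ne_zero)) (mul_ne_zero (pow_ne_zero _ L.lam_ne)
    (inv_ne_zero L.eta_ne)))

/-- The number of iterations after which the critical point lands on the fixed point. -/
def time : ℕ := ℓ + J * (2 * s.n + ℓ) + s.n + ℓ

theorem iterate_time (hμ : μ ≤ L.δ) :
    (f s.t)^[s.time] (param c₀ (c s.t)) = param a₀ (a s.t) := by
  have h1 := L.Lam_map s.t 0 (s.t_le hμ) (by simpa using L.δ_pos.le)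
  rw [add_zero] at h1
  rw [time, Function.iterate_add_apply, h1, s.landing, Function.iterate_add_apply,
    s.iterate_S hμ s.t_mem s.t_near, s.iterate_ω hμ J s.t_mem s.t_near]

/-- The first return of the critical point. -/
theorem iterate_return (hμ : μ ≤ L.δ) :
    (f s.t)^[s.n + ℓ] (param c₀ (c s.t)) = param c₀ (c s.t + s.ω J s.t) := by
  have h1 := L.Lam_map s.t 0 (s.t_le hμ) (by simpa using L.δ_pos.le)
  rw [add_zero] at h1
  rw [Function.iterate_add_apply, h1, s.landing, s.iterate_S hμ s.t_mem s.t_near]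

/-- One step before it lands, the critical point is the image under `R ^ (ℓ - 1)` of the point with
coordinate `ω 0`. -/
theorem iterate_time_sub_one (hμ : μ ≤ L.δ) (hℓ : 1 ≤ ℓ) :
    (f s.t)^[s.time - 1] (param c₀ (c s.t)) =
      (f s.t)^[ℓ - 1] (param c₀ (c s.t + s.ω 0 s.t)) := by
  have h : ∀ j, (f s.t)^[j * (2 * s.n + ℓ)] (param c₀ (c s.t + s.ω j s.t))
      = param c₀ (c s.t + s.ω 0 s.t) := by
    intro j
    induction j with
    | zero => simp
    | succ j ih =>
      rw [show (j + 1) * (2 * s.n + ℓ) = j * (2 * s.n + ℓ) + (2 * s.n + ℓ) by ring,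
        Function.iterate_add_apply, Function.iterate_add_apply,
        L.Lam_map _ _ (s.t_le hμ) (s.ω_le hμ _ s.t_mem s.t_near), s.ω_succ j _ s.t_mem s.t_near,
        L.S_iter _ (by have := s.le_n; omega) _ s.t_mem _ (s.ω_mem j _ s.t_mem s.t_near)
          (s.t_le hμ) (s.ω_le hμ j s.t_mem s.t_near), ih]
  rw [show s.time - 1 = (ℓ - 1) + (J * (2 * s.n + ℓ) + (s.n + ℓ)) by unfold time; omega,
    Function.iterate_add_apply, Function.iterate_add_apply, s.iterate_return hμ, h]

end LocalModel.Solution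

end Passages

/-! ### Multipliers and asymptotic positions -/

section LeadingTerm

variable {F : Type*} [NontriviallyNormedField F]

/-- A simple zero has a leading term of exponent one. -/
theorem hasLeadingTerm_one {g : F → F} {u₁ β : F} (hg : AnalyticAt F g u₁) (h0 : g u₁ = 0)
    (hd : HasDerivAt g β u₁) (hβ : β ≠ 0) : HasLeadingTerm g u₁ 1 β := by
  obtain ⟨q, hq⟩ := hg
  refine ⟨hβ, dslope g u₁, hq.has_fpower_series_dslope_fslope.analyticAt, ?_, ?_⟩
  · rw [dslope_same, hd.deriv]
  · refine Eventually.of_forall fun u => ?_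
    have := sub_smul_dslope g u₁ u
    rw [h0, sub_zero, smul_eq_mul] at this
    rw [pow_one, this]

/-- The multiplier of a fixed point is its multiplier in any coordinate. -/
theorem multiplier_eq_of_hasChartDeriv {K : Subfield F} {t β u₁ : F}
    {f : F → OnePoint F → OnePoint F} {b : OnePoint F} (hf : AnalyticRational K t f)
    (h : HasChartDeriv (f t) b u₁ b u₁ β) (hβ : β ≠ 0) :
    multiplier (f t) (param b u₁) = β := by
  obtain ⟨Φ, hΦ, hΦ1, hg⟩ := exists_chart hf (AnalyticOver.const (zero_mem K)) (b := b) (e := b)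
    (k := 1) (v₁ := u₁) (x₁ := u₁) (by rw [zero_add]; exact h.apply_eq)
  have hcurve : Tendsto (fun x => (t, x)) (𝓝 u₁) (𝓝 (t, u₁)) :=
    (Continuous.prodMk_right t).tendsto _
  have hΦt : AnalyticAt F (fun x => Φ (t, x)) u₁ := hΦ.analyticAt.comp (f := fun x => (t, x))
    (AnalyticAt.prod analyticAt_const analyticAt_id)
  have hgt : ∀ᶠ x in 𝓝 u₁, f t (param b x) = param b (Φ (t, x)) := by
    filter_upwards [hcurve.eventually hg] with x hx
    simpa using hx
  obtain ⟨k, hk, hk1, hk2⟩ := (hasLeadingTerm_one (hΦt.fun_sub analyticAt_const)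
    (by rw [hΦ1, sub_self]) ((h.hasDerivAt hgt).sub_const u₁) hβ).2
  rw [← hk1] at hβ ⊢
  refine multiplier_param hgt hΦ1 (hk2.mono fun x hx => ?_) hk hβ
  rw [pow_one] at hx
  rw [hΦ1]
  exact sub_eq_iff_eq_add'.mp hx

end LeadingTerm

section LandingPoint

variable {F : Type*} [NontriviallyNormedField F] [IsUltrametricDist F] {K : Subfield F}
  {f : F → OnePoint F → OnePoint F} {a₀ c₀ : OnePoint F} {a c : F → F} {ℓ : ℕ}

namespace DynamicalModel

variable (L : DynamicalModel K f a₀ c₀ a c ℓ)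

theorem zero_le_δ₁ : ‖(0 : F)‖ ≤ L.δ₁ := by simpa using L.δ₁_pos.le

theorem zero_le_δ : ‖(0 : F)‖ ≤ L.δ := by simpa using L.δ_pos.le

theorem norm_k {t y : F} (ht : ‖t‖ ≤ L.δ₁) (hy : ‖y‖ ≤ L.δ₁) : ‖L.k t y‖ = ‖L.lam‖ :=
  (L.k_close t y ht hy).norm_eq L.eps_lt_one

theorem k_ne_zero {t y : F} (ht : ‖t‖ ≤ L.δ₁) (hy : ‖y‖ ≤ L.δ₁) : L.k t y ≠ 0 :=
  (L.k_close t y ht hy).ne_zero L.eps_lt_one L.lam_ne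

theorem multiplier_eq {t : F} (ht : ‖t‖ ≤ L.δ₁) (hf : AnalyticRational K t f) :
    multiplier (f t) (param a₀ (a t)) = L.k t 0 := by
  refine multiplier_eq_of_hasChartDeriv hf
    ⟨fun u => a t + (u - a t) * L.k t (u - a t), ?_, by simp, ?_⟩ (L.k_ne_zero ht L.zero_le_δ₁)
  · rw [hasDerivAt_iff_tendsto_slope]
    have h1 : Tendsto (fun u => L.M * ‖u - a t‖) (𝓝[≠] (a t)) (𝓝 0) := by
      have : Tendsto (fun u => L.M * ‖u - a t‖) (𝓝 (a t)) (𝓝 (L.M * ‖a t - a t‖)) :=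
        Continuous.tendsto (by fun_prop) _
      rw [sub_self, norm_zero, mul_zero] at this
      exact this.mono_left nhdsWithin_le_nhds
    rw [tendsto_iff_norm_sub_tendsto_zero]
    refine squeeze_zero' (Eventually.of_forall fun _ => norm_nonneg _) ?_ h1
    filter_upwards [self_mem_nhdsWithin,
      nhdsWithin_le_nhds (Metric.closedBall_mem_nhds (a t) L.δ₁_pos)] with u hu hu'
    rw [Metric.mem_closedBall, dist_eq_norm] at hu'
    have h2 := L.k_lip t (u - a t) 0 ht hu' L.zero_le_δ₁
    rw [sub_zero] at h2
    have h3 : u - a t ≠ 0 := sub_ne_zero.mpr hu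
    rwa [slope_def_field, sub_self, zero_mul, add_zero, add_sub_cancel_left,
      mul_div_cancel_left₀ _ h3]
  · filter_upwards [Metric.closedBall_mem_nhds (a t) L.δ₁_pos] with u hu
    rw [Metric.mem_closedBall, dist_eq_norm] at hu
    have := L.k_map t (u - a t) ht hu
    rwa [add_sub_cancel] at this

theorem isRepelling {t : F} (ht : ‖t‖ ≤ L.δ₁) (hf : AnalyticRational K t f) :
    IsRepellingFixedPt (f t) (param a₀ (a t)) :=
  ⟨L.map_fixed ht, by rw [L.multiplier_eq ht hf, L.norm_k ht L.zero_le_δ₁]; exact L.one_lt⟩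

theorem tendsto_S {t v : F} (ht : t ∈ K) (hv : v ∈ K) (htδ : ‖t‖ ≤ L.δ) (hvδ : ‖v‖ ≤ L.δ) :
    Tendsto (fun i => L.S i t v) atTop (𝓝 0) := by
  rw [tendsto_zero_iff_norm_tendsto_zero]
  have h1 : Tendsto (fun i : ℕ => (‖L.lam‖⁻¹) ^ i * ‖L.zeta‖) atTop (𝓝 (0 * ‖L.zeta‖)) :=
    (tendsto_pow_atTop_nhds_zero_of_lt_one (by positivity)
      (inv_lt_one_of_one_lt₀ L.one_lt)).mul_const _
  rw [zero_mul] at h1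
  refine h1.congr' ?_
  filter_upwards [eventually_ge_atTop L.i₀] with i hi
  rw [L.S_norm hi ht hv htδ hvδ, inv_pow]

/-- The asymptotic position of the homoclinic orbit in the coordinate at `a₀`. It is close to `ζ`.
The limit exists because the successive terms differ by the factor `k t (S (i + 1) t v) / k t 0`,
which tends to `1` geometrically. -/
theorem exists_tendsto_zeta [CompleteSpace F] {t v : F} (ht : t ∈ K) (hv : v ∈ K)
    (htδ : ‖t‖ ≤ L.δ) (hvδ : ‖v‖ ≤ L.δ) :
    ∃ ζ, Tendsto (fun i => L.k t 0 ^ i * L.S i t v) atTop (𝓝 ζ) ∧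
      RelClose (‖(L.d : F)‖ ^ 4 * ‖(L.d' : F)‖ ^ 2 / 2) ζ L.zeta := by
  have ht₁ := htδ.trans L.δ_le
  have hl : 0 < ‖L.lam‖ := one_pos.trans L.one_lt
  have hk := L.norm_k ht₁ L.zero_le_δ₁
  have hstep : ∀ j, dist (L.k t 0 ^ (j + L.i₀) * L.S (j + L.i₀) t v)
      (L.k t 0 ^ (j + 1 + L.i₀) * L.S (j + 1 + L.i₀) t v)
      ≤ (L.M * ‖L.zeta‖ ^ 2 * (‖L.lam‖ ^ (L.i₀ + 2))⁻¹) * ‖L.lam‖⁻¹ ^ j := by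
    intro j
    have h1 := L.S_step (j + L.i₀) (by omega) t ht v hv htδ hvδ
    have h2 := L.S_norm_le (j + L.i₀ + 1) (by omega) t ht v hv htδ hvδ
    have h3 := L.S_norm (i := j + L.i₀ + 1) (by omega) ht hv htδ hvδ
    have h4 := L.k_lip t (L.S (j + L.i₀ + 1) t v) 0 ht₁ h2 L.zero_le_δ₁
    rw [sub_zero] at h4
    rw [dist_eq_norm, show j + 1 + L.i₀ = j + L.i₀ + 1 by ring, ← h1, pow_succ (L.k t 0),
      show L.k t 0 ^ (j + L.i₀) * (L.S (j + L.i₀ + 1) t v * L.k t (L.S (j + L.i₀ + 1) t v))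
        - L.k t 0 ^ (j + L.i₀) * L.k t 0 * L.S (j + L.i₀ + 1) t v
        = L.k t 0 ^ (j + L.i₀) * L.S (j + L.i₀ + 1) t v
          * (L.k t (L.S (j + L.i₀ + 1) t v) - L.k t 0) by ring, norm_mul, norm_mul, norm_pow, hk]
    calc ‖L.lam‖ ^ (j + L.i₀) * ‖L.S (j + L.i₀ + 1) t v‖
          * ‖L.k t (L.S (j + L.i₀ + 1) t v) - L.k t 0‖
        ≤ ‖L.lam‖ ^ (j + L.i₀) * ‖L.S (j + L.i₀ + 1) t v‖ * (L.M * ‖L.S (j + L.i₀ + 1) t v‖) := by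
          gcongr
      _ = _ := by
          rw [h3]
          simp only [pow_add, inv_pow, pow_one]
          field_simp
  have hinv : ‖L.lam‖⁻¹ < 1 := inv_lt_one_of_one_lt₀ L.one_lt
  obtain ⟨ζ, hζ⟩ := cauchySeq_tendsto_of_complete (cauchySeq_of_le_geometric _ _ hinv hstep)
  have hζ' : Tendsto (fun i => L.k t 0 ^ i * L.S i t v) atTop (𝓝 ζ) :=
    (tendsto_add_atTop_iff_nat L.i₀).mp hζ
  refine ⟨ζ, hζ', RelClose.of_frequently hζ' (Eventually.frequently ?_)⟩
  filter_upwards [eventually_ge_atTop L.i₀] with i hi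
  have h1 := ((L.k_close t 0 ht₁ L.zero_le_δ₁).pow L.eps_nonneg L.eps_lt_one i).mul
    (L.S_close i hi t ht v hv htδ hvδ) L.eps_lt_one
  rwa [mul_inv_cancel_left₀ (pow_ne_zero _ L.lam_ne)] at h1

end DynamicalModel

end LandingPoint

/-! ### Homoclinic orbits at nearby parameters -/

section RationalPoints

variable {F : Type*} [NontriviallyNormedField F] {K : Subfield F}

/-- The points of the projective line over `K`. -/
def IsPointOver (K : Subfield F) (z : OnePoint F) : Prop :=
  z = OnePoint.infty ∨ ∃ x ∈ K, z = OnePoint.some x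

theorem isPointOver_param (b : OnePoint F) {u : F} (hu : u ∈ K) : IsPointOver K (param b u) := by
  induction b using OnePoint.rec with
  | infty =>
    by_cases h : u = 0
    · left; simp [param, h]
    · right; exact ⟨u⁻¹, inv_mem hu, by simp [param, h]⟩
  | coe b => exact Or.inr ⟨u, hu, rfl⟩

theorem AnalyticRational.isPointOver {f : F → OnePoint F → OnePoint F} {t : F}
    (hf : AnalyticRational K t f) (ht : t ∈ K) {z : OnePoint F} (hz : IsPointOver K z) :
    IsPointOver K (f t z) := by
  obtain ⟨N, P, Q, hP, hQ, h⟩ := hf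
  obtain ⟨-, -, h⟩ := h.self_of_nhds
  rw [h]
  rcases hz with rfl | ⟨x, hx, rfl⟩
  · by_cases h0 : (Q t).coeff N = 0
    · left; simp [ratEval, h0]
    · right
      exact ⟨_, div_mem ((hP.coeff N).mem.self_of_nhds ht) ((hQ.coeff N).mem.self_of_nhds ht),
        by simp [ratEval, h0]⟩
  · by_cases h0 : (Q t).eval x = 0
    · left; simp [ratEval, h0]
    · right
      exact ⟨_, div_mem ((hP.eval x).mem.self_of_nhds ht hx) ((hQ.eval x).mem.self_of_nhds ht hx),
        by simp [ratEval, h0]⟩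

theorem AnalyticRational.isPointOver_iterate {f : F → OnePoint F → OnePoint F} {t : F}
    (hf : AnalyticRational K t f) (ht : t ∈ K) {z : OnePoint F} (hz : IsPointOver K z) (n : ℕ) :
    IsPointOver K ((f t)^[n] z) := by
  induction n with
  | zero => exact hz
  | succ n ih => rw [Function.iterate_succ_apply']; exact hf.isPointOver ht ih

end RationalPoints

section Orbit

variable {F : Type*} [NontriviallyNormedField F] [IsUltrametricDist F] {K : Subfield F}
  {f : F → OnePoint F → OnePoint F} {a₀ c₀ : OnePoint F} {a c : F → F} {ℓ : ℕ}

namespace DynamicalModel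

variable (L : DynamicalModel K f a₀ c₀ a c ℓ)

/-- The homoclinic orbit at the parameter `t` through the critical point. The point with index `-i`
is given by the inverse branch `S i` at the critical point if `i ≥ i₀`, and by the iterates of the
point with index `-i₀` otherwise: the two truncated numbers in the definition are `j + i₀` and `i₀`
for `j ≥ -i₀`, and `0` and `-j` for `j ≤ -i₀`. -/
noncomputable def orbit (t : F) (j : ℤ) : OnePoint F :=
  (f t)^[(j + L.i₀).toNat] (param a₀ (a t + L.S (max (-j) L.i₀).toNat t 0))

variable {L} {t : F}

theorem orbit_neg {i : ℕ} (hi : L.i₀ ≤ i) :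
    L.orbit t (-(i : ℤ)) = param a₀ (a t + L.S i t 0) := by
  have h1 : (-(i : ℤ) + L.i₀).toNat = 0 := by omega
  have h2 : (max (-(-(i : ℤ))) L.i₀).toNat = i := by omega
  rw [orbit, h1, h2, Function.iterate_zero_apply]

theorem orbit_add_one (ht : t ∈ K) (htδ : ‖t‖ ≤ L.δ) (j : ℤ) :
    f t (L.orbit t j) = L.orbit t (j + 1) := by
  rcases lt_or_ge j (-(L.i₀ : ℤ)) with hj | hj
  · obtain ⟨i, hi⟩ : ∃ i : ℕ, (i : ℤ) = -j - 1 := ⟨(-j - 1).toNat, by omega⟩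
    have hi₀ : L.i₀ ≤ i := by omega
    rw [show j = -((i + 1 : ℕ) : ℤ) by push_cast; omega,
      show -((i + 1 : ℕ) : ℤ) + 1 = -(i : ℤ) by push_cast; omega, orbit_neg hi₀,
      orbit_neg (by omega), L.k_map _ _ (htδ.trans L.δ_le)
        (L.S_norm_le _ (by omega) t ht 0 (zero_mem K) htδ L.zero_le_δ),
      L.S_step i hi₀ t ht 0 (zero_mem K) htδ L.zero_le_δ]
  · have h1 : (j + 1 + L.i₀).toNat = (j + L.i₀).toNat + 1 := by omega
    have h2 : max (-(j + 1)) (L.i₀ : ℤ) = max (-j) L.i₀ := by omega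
    rw [orbit, orbit, h1, h2, Function.iterate_succ_apply']

theorem orbit_zero (ht : t ∈ K) (htδ : ‖t‖ ≤ L.δ) : L.orbit t 0 = param c₀ (c t) := by
  have h1 : ((0 : ℤ) + L.i₀).toNat = L.i₀ := by omega
  have h2 : (max (-(0 : ℤ)) L.i₀).toNat = L.i₀ := by omega
  rw [orbit, h1, h2, L.S_iter _ le_rfl t ht 0 (zero_mem K) htδ L.zero_le_δ, add_zero]

theorem orbit_natCast (ht : t ∈ K) (htδ : ‖t‖ ≤ L.δ) (n : ℕ) :
    L.orbit t n = (f t)^[n] (param c₀ (c t)) := by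
  induction n with
  | zero => exact orbit_zero ht htδ
  | succ n ih => rw [Nat.cast_succ, ← orbit_add_one ht htδ, ih, Function.iterate_succ_apply']

theorem tendsto_orbit (ht : t ∈ K) (htδ : ‖t‖ ≤ L.δ) {T : ℕ}
    (hT : (f t)^[T] (param c₀ (c t)) = param a₀ (a t)) :
    Tendsto (fun j => chordal (L.orbit t j) (param a₀ (a t))) cofinite (𝓝 0) := by
  rw [Int.cofinite_eq, tendsto_sup]
  constructor
  · have h1 : Tendsto (fun j : ℤ => ‖L.S (-j).toNat t 0‖) atBot (𝓝 0) := by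
      have := (L.tendsto_S ht (zero_mem K) htδ L.zero_le_δ).norm
      rw [norm_zero] at this
      refine this.comp (tendsto_atTop.mpr fun N => ?_)
      filter_upwards [eventually_le_atBot (-(N : ℤ))] with j hj
      omega
    refine squeeze_zero' (Eventually.of_forall fun _ => chordal_nonneg _ _) ?_ h1
    filter_upwards [eventually_le_atBot (-(L.i₀ : ℤ))] with j hj
    obtain ⟨i, rfl⟩ : ∃ i : ℕ, j = -(i : ℤ) := ⟨(-j).toNat, by omega⟩
    rw [orbit_neg (by omega)]
    refine (chordal_param_le a₀ _ _).trans (le_of_eq ?_)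
    rw [add_sub_cancel_left, neg_neg, Int.toNat_natCast]
  · refine tendsto_const_nhds.congr' ?_
    filter_upwards [eventually_ge_atTop (T : ℤ)] with j hj
    obtain ⟨i, rfl⟩ : ∃ i : ℕ, j = ((i + T : ℕ) : ℤ) := ⟨(j - T).toNat, by omega⟩
    rw [orbit_natCast ht htδ, Function.iterate_add_apply, hT,
      Function.iterate_fixed (L.map_fixed (htδ.trans L.δ_le)), chordal_param, sub_self, norm_zero,
      zero_div]

theorem hasDeg_S (hf : AnalyticRational K t f) (ht : t ∈ K) (htδ : ‖t‖ ≤ L.δ) {i : ℕ}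
    (hi : L.i₀ ≤ i) : HasDeg (f t)^[i] (param a₀ (a t + L.S i t 0)) 1 := by
  obtain ⟨β, hβ, hβc⟩ := L.hasChartDeriv_iterate hi hf ht (zero_mem K) htδ L.zero_le_δ
  exact hβ.hasDeg_one (hβc.ne_zero L.eps_lt_one
    (mul_ne_zero (pow_ne_zero _ L.lam_ne) (inv_ne_zero L.eta_ne)))

theorem isUnramifiedPreimage_orbit (hf : AnalyticRational K t f) (ht : t ∈ K) (htδ : ‖t‖ ≤ L.δ)
    {j : ℤ} (hj : j < 0) : IsUnramifiedPreimage (f t) (param c₀ (c t)) (L.orbit t j) := by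
  obtain ⟨n, hn⟩ : ∃ n : ℕ, (n : ℤ) = -j := ⟨(-j).toNat, by omega⟩
  have h2 : n + (j + L.i₀).toNat = (max (-j) L.i₀).toNat := by omega
  have h3 : L.i₀ ≤ (max (-j) L.i₀).toNat := by omega
  have h4 := hasDeg_S hf ht htδ h3
  have h5 := L.S_iter _ h3 t ht 0 (zero_mem K) htδ L.zero_le_δ
  rw [← h2, Function.iterate_add] at h4 h5
  rw [Function.comp_apply, h2] at h5
  refine ⟨n, by omega, ?_, ?_⟩
  · rw [orbit, h5, add_zero]
  · rw [h2] at h4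
    have h6 := (h4.one_of_comp (chartAnalyticAt_iterate hf _ _) (chartAnalyticAt_iterate hf _ _)
      (by rw [← Function.iterate_add]; exact chartAnalyticAt_iterate hf _ _)).2
    exact_mod_cast (chartAnalyticAt_iterate hf n _).localDegree_eq_iff.mpr h6

theorem isPointOver_orbit (hf : AnalyticRational K t f) (ha : AnalyticOver K t a) (ht : t ∈ K)
    (htδ : ‖t‖ ≤ L.δ) (j : ℤ) : IsPointOver K (L.orbit t j) :=
  hf.isPointOver_iterate ht (isPointOver_param a₀ (add_mem (ha.mem.self_of_nhds ht)
    (L.S_mem _ (by omega) t ht 0 (zero_mem K) htδ L.zero_le_δ))) _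

theorem isCriticalHomoclinic_orbit (hf : AnalyticRational K t f) (ht : t ∈ K) (htδ : ‖t‖ ≤ L.δ)
    {T : ℕ} (hT : (f t)^[T] (param c₀ (c t)) = param a₀ (a t)) :
    IsCriticalHomoclinic (f t) (param a₀ (a t)) (param c₀ (c t)) (L.orbit t) :=
  ⟨⟨orbit_add_one ht htδ, tendsto_orbit ht htδ hT⟩, orbit_zero ht htδ,
    fun _ hj => isUnramifiedPreimage_orbit hf ht htδ hj⟩

/-- The points of the homoclinic orbit with negative index are distinct, since their distances to
the fixed point are. -/
theorem isUnramified (hf : AnalyticRational K t f) (ht : t ∈ K) (htδ : ‖t‖ ≤ L.δ) :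
    IsUnramified (f t) (param c₀ (c t)) := by
  refine Set.infinite_of_injective_forall_mem
    (f := fun i : ℕ => L.orbit t (-((L.i₀ + 1 + i : ℕ) : ℤ)))
    (fun i j hij => ?_) fun i => isUnramifiedPreimage_orbit hf ht htδ (by omega)
  simp only at hij
  rw [orbit_neg (by omega), orbit_neg (by omega)] at hij
  have h1 := congrArg norm (add_left_cancel (param_injective a₀ hij))
  rw [L.S_norm (by omega) ht (zero_mem K) htδ L.zero_le_δ,
    L.S_norm (by omega) ht (zero_mem K) htδ L.zero_le_δ] at h1
  have h2 := inv_injective (mul_right_cancel₀ (norm_ne_zero_iff.mpr L.zeta_ne) h1)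
  have := pow_right_injective₀ (one_pos.trans L.one_lt) L.one_lt.ne' h2
  omega

/-- The asymptotic position in the standard coordinate at the fixed point. -/
theorem isAsymptoticPosition_orbit (hf : AnalyticRational K t f) (ht : t ∈ K) (htδ : ‖t‖ ≤ L.δ)
    {ζ : F} (hζ : Tendsto (fun i => L.k t 0 ^ i * L.S i t 0) atTop (𝓝 ζ)) :
    IsAsymptoticPosition (f t) (param a₀ (a t)) (L.orbit t) (ζ * chartFactor a₀ (a t)) := by
  obtain ⟨ψ, hψ, hψ1, hψ2⟩ := exists_chart_change a₀ (a t)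
  have h1 : Tendsto (fun i => a t + L.S i t 0) atTop (𝓝 (a t)) := by
    simpa using (L.tendsto_S ht (zero_mem K) htδ L.zero_le_δ).const_add (a t)
  have h2 := hψ.continuousAt.tendsto.comp h1
  rw [hψ1] at h2
  refine (hζ.mul h2).congr' ?_
  filter_upwards [eventually_ge_atTop L.i₀, h1.eventually hψ2] with i hi h3
  rw [orbit_neg hi, h3.1, L.multiplier_eq (htδ.trans L.δ_le) hf, Function.comp_apply]
  ring

end DynamicalModel

end Orbit

/-! ### Landing on the fixed point -/

section OpenCondition

variable {F : Type*} [NontriviallyNormedField F] [IsUltrametricDist F] [CompleteSpace F]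
  {K : Subfield F} {f : F → OnePoint F → OnePoint F}

/-- Being of local degree one is an open condition on the parameter and the point. -/
theorem eventually_hasDeg_one {t₁ u₁ : F} {b : OnePoint F} {k : ℕ} (hf : AnalyticRational K t₁ f)
    (h : HasDeg (f t₁)^[k] (param b u₁) 1) :
    ∀ᶠ z in 𝓝 (t₁, u₁), HasDeg (f z.1)^[k] (param b z.2) 1 := by
  obtain ⟨Φ, hΦ, -, hg⟩ := exists_chart hf (AnalyticOver.const (zero_mem K)) (b := b)
    (e := (f t₁)^[k] (param b u₁)) (k := k) (v₁ := u₁) (by rw [zero_add, param_coord_self])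
  simp only [zero_add] at hg
  obtain ⟨β, hβ, hstrict⟩ := exists_hasDerivAt_snd_and_strict hΦ.analyticAt
  have hcurve : Tendsto (fun x => (t₁, x)) (𝓝 u₁) (𝓝 (t₁, u₁)) :=
    (Continuous.prodMk_right t₁).tendsto _
  have hβ0 : β ≠ 0 := by
    refine deriv_ne_zero_of_hasDeg_one (s := 0) (b := b) (e := (f t₁)^[k] (param b u₁)) hβ ?_
      (by rwa [zero_add])
    filter_upwards [hcurve.eventually hg] with x hx
    rw [zero_add, hx]
  obtain ⟨r, hr, hstrict⟩ := hstrict (1 / 2 * ‖β‖) (by have := norm_pos_iff.mpr hβ0; positivity)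
  have hbox : ∀ᶠ z in 𝓝 (t₁, u₁), z ∈ Metric.closedBall (t₁, u₁) r :=
    Metric.closedBall_mem_nhds _ hr
  filter_upwards [(hg.and hbox).eventually_nhds, hΦ.analyticAt.eventually_analyticAt] with z h1 h2
  have hslice : Tendsto (fun x => (z.1, x)) (𝓝 z.2) (𝓝 z) :=
    (Continuous.prodMk_right z.1).tendsto _
  have h3 := hslice.eventually h1
  have h4 : HasDeg (f z.1)^[k] (param b (0 + z.2)) 1 := by
    refine hasDeg_one_of_relClose (ε := 1 / 2) (β := β)
      (e := (f t₁)^[k] (param b u₁)) (Ψ := fun x => Φ (z.1, x)) (by norm_num) hβ0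
      (h2.continuousAt.comp (f := fun x => (z.1, x)) hslice) (h3.mono fun x hx => ?_) ?_
    · rw [zero_add]; exact hx.1
    · filter_upwards [h3] with x hx
      have h6 := h3.self_of_nhds.2
      have h7 := hx.2
      rw [Metric.mem_closedBall, dist_eq_norm, Prod.norm_def, max_le_iff] at h6 h7
      refine (hstrict z.1 x z.2 h6.1 h7.2 h6.2).trans (le_of_eq ?_)
      rw [norm_mul, mul_assoc]
  rwa [zero_add] at h4

end OpenCondition

section Landing

variable {F : Type*} [NontriviallyNormedField F] [IsUltrametricDist F] [CompleteSpace F]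
  {K : Subfield F} {f : F → OnePoint F → OnePoint F} {a₀ c₀ : OnePoint F} {a c : F → F} {ℓ : ℕ}

namespace LocalModel.Solution

variable {L : DynamicalModel K f a₀ c₀ a c ℓ} {J : ℕ} {μ : ℝ} (s : L.Solution J μ)

/-- The passage from the image under `R ^ ℓ` of the critical point to the fixed point, as a function
of the parameter. It is expanding in the second variable. -/
theorem exists_landing_chart (hμ : μ ≤ L.δ) (hf : AnalyticRational K s.t f)
    (ha : AnalyticOver K s.t a) :
    ∃ (Θ : F × F → F) (β : F), AnalyticOver₂ K (s.t, L.Lam s.t 0) Θ ∧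
      Θ (s.t, L.Lam s.t 0) = a s.t ∧ β ≠ 0 ∧
      (∀ᶠ z in 𝓝 (s.t, L.Lam s.t 0),
        (f z.1)^[ℓ + J * (2 * s.n + ℓ) + s.n] (param a₀ (a z.1 + z.2)) = param a₀ (Θ z)) ∧
      ∃ r : ℝ, 0 < r ∧ ∀ t x x', ‖t - s.t‖ ≤ r → ‖x - L.Lam s.t 0‖ ≤ r →
        ‖x' - L.Lam s.t 0‖ ≤ r → RelClose (1 / 2) (Θ (t, x) - Θ (t, x')) (β * (x - x')) := by
  obtain ⟨β, hβ, hβc⟩ := s.hasChartDeriv_landing hμ hf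
  have hβ0 := s.landing_ne_zero hβc
  obtain ⟨Θ, hΘ, hΘ1, hg⟩ := exists_chart hf ha (b := a₀) (e := a₀) hβ.apply_eq
  obtain ⟨β', hβ', hstrict⟩ := exists_hasDerivAt_snd_and_strict hΘ.analyticAt
  have hββ : β = β' := by
    have h1 : HasDerivAt (fun u => Θ (s.t, u - a s.t)) β (a s.t + L.Lam s.t 0) := by
      refine hβ.hasDerivAt ?_
      have hcurve : Tendsto (fun u => (s.t, u - a s.t)) (𝓝 (a s.t + L.Lam s.t 0))
          (𝓝 (s.t, L.Lam s.t 0)) := by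
        have : Continuous fun u => (s.t, u - a s.t) := by fun_prop
        have := this.tendsto (a s.t + L.Lam s.t 0)
        rwa [add_sub_cancel_left] at this
      filter_upwards [hcurve.eventually hg] with u hu
      rwa [add_sub_cancel] at hu
    have h2 := HasDerivAt.comp_const_add (f := fun u => Θ (s.t, u - a s.t)) (a s.t) (L.Lam s.t 0) h1
    simp only [add_sub_cancel_left] at h2
    exact h2.unique hβ'
  subst hββ
  obtain ⟨r, hr, h⟩ := hstrict (1 / 2 * ‖β‖) (by have := norm_pos_iff.mpr hβ0; positivity)
  refine ⟨Θ, β, hΘ, hΘ1, hβ0, hg, r, hr, fun t x x' h1 h2 h3 => ?_⟩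
  refine (h t x x' h1 h2 h3).trans (le_of_eq ?_)
  rw [norm_mul, mul_assoc]

/-- The position of the image of the critical point relative to the fixed point is analytic. -/
theorem analyticOver_Lam (hμ : μ ≤ L.δ) (hμ0 : 0 < μ) (hf : AnalyticRational K s.t f)
    (ha : AnalyticOver K s.t a) (hc : AnalyticOver K s.t c) :
    AnalyticOver K s.t fun t => L.Lam t 0 := by
  have h0 := L.Lam_map s.t 0 (s.t_le hμ) L.zero_le_δ
  obtain ⟨Φ, hΦ, -, hg⟩ := exists_chart hf hc (b := c₀) (e := a₀) h0
  have h1 := (hΦ.comp_curve (σ := fun _ => 0) (AnalyticOver.const (zero_mem K))).sub ha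
  have hcurve : Tendsto (fun t : F => (t, (0 : F))) (𝓝 s.t) (𝓝 (s.t, 0)) :=
    (Continuous.prodMk_left (0 : F)).tendsto _
  have hev : ∀ᶠ t in 𝓝 s.t, Φ (t, 0) - a t = L.Lam t 0 := by
    filter_upwards [hcurve.eventually hg, Metric.closedBall_mem_nhds s.t hμ0] with t h2 h3
    have h4 : ‖t‖ ≤ L.δ := by
      rw [← sub_add_cancel t s.t]
      refine norm_add_le_of_le_of_le ?_ (s.t_le hμ)
      rw [← dist_eq_norm]; exact (Metric.mem_closedBall.mp h3).trans hμ
    rw [L.Lam_map t 0 h4 L.zero_le_δ] at h2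
    rw [← param_injective a₀ h2, add_sub_cancel_left]
  refine ⟨h1.analyticAt.congr hev, ?_⟩
  filter_upwards [h1.mem, hev] with t h2 h3 ht
  rw [← h3]; exact h2 ht

/-- The branch that lands on the fixed point after the prescribed returns is a Lipschitz function of
the parameter. -/
theorem norm_S_sub_le (hμ : μ ≤ L.δ) {t : F} (ht : t ∈ K) (h : ‖t - s.t‖ ≤ s.s) :
    ‖L.S s.n t (s.ω J t) - L.Lam s.t 0‖
      ≤ max (‖L.eta‖ * s.C) L.M * (‖L.lam‖ ^ s.n)⁻¹ * ‖t - s.t‖ := by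
  have htδ := (s.norm_le t ht h).trans hμ
  have hω := s.ω_mem J t ht h
  have hω' := s.ω_mem J s.t s.t_mem s.t_near
  have hωδ := s.ω_le hμ J ht h
  have hωδ' := s.ω_le hμ J s.t_mem s.t_near
  rw [s.landing]
  refine norm_sub_le_of_triangle (y := L.S s.n t (s.ω J s.t)) ?_ ?_
  · rw [(L.S_sub s.n s.le_n t ht _ hω _ hω' htδ hωδ hωδ').norm_eq L.eps_lt_one, norm_mul, norm_mul,
      norm_inv, norm_pow]
    calc (‖L.lam‖ ^ s.n)⁻¹ * ‖L.eta‖ * ‖s.ω J t - s.ω J s.t‖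
        ≤ (‖L.lam‖ ^ s.n)⁻¹ * ‖L.eta‖ * (s.C * ‖t - s.t‖) := by
          gcongr; exact s.ω_lip J t ht h
      _ = ‖L.eta‖ * s.C * (‖L.lam‖ ^ s.n)⁻¹ * ‖t - s.t‖ := by ring
      _ ≤ _ := by gcongr; exact le_max_left _ _
  · refine (L.S_lip s.n s.le_n t ht s.t s.t_mem _ hω' htδ (s.t_le hμ) hωδ').trans ?_
    gcongr
    exact le_max_right _ _

/-- The position relative to the fixed point of the final image of the critical point has a simple
zero at the parameter of a solution. For `t` in `K`, the final passage, which expands distances,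
maps `S n t (ω J t)` exactly to the fixed point. By `expand` the image of the critical point under
`R ^ ℓ` is at least at a distance `c * ‖t - s.t‖` from this point. Hence a vanishing derivative is
impossible. -/
theorem exists_landing_curve (hK : IsClosed (K : Set F)) (hμ : μ ≤ L.δ) (hμ0 : 0 < μ)
    (hf : AnalyticRational K s.t f)
    (ha : AnalyticOver K s.t a) (hc : AnalyticOver K s.t c) :
    ∃ (X : F → F) (γ : F), AnalyticOver K s.t X ∧ X s.t = a s.t ∧
      (∀ᶠ t in 𝓝 s.t, (f t)^[s.time] (param c₀ (c t)) = param a₀ (X t)) ∧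
      HasDerivAt (fun t => X t - a t) γ s.t ∧ γ ≠ 0 ∧ γ ∈ K := by
  obtain ⟨Θ, β, hΘ, hΘ1, hβ, hΘg, r, hr, hstrict⟩ := s.exists_landing_chart hμ hf ha
  have hLam := s.analyticOver_Lam hμ hμ0 hf ha hc
  have hcurve : Tendsto (fun t => (t, L.Lam t 0)) (𝓝 s.t) (𝓝 (s.t, L.Lam s.t 0)) :=
    (continuousAt_id.prodMk hLam.analyticAt.continuousAt).tendsto
  have hX : AnalyticOver K s.t fun t => Θ (t, L.Lam t 0) := hΘ.comp_curve hLam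
  have hXa := hX.sub ha
  have hd := hXa.analyticAt.differentiableAt.hasDerivAt
  set γ := deriv (fun t => Θ (t, L.Lam t 0) - a t) s.t with hγ
  have hnear : ∀ᶠ t in 𝓝 s.t, ‖t‖ ≤ L.δ := by
    filter_upwards [Metric.closedBall_mem_nhds s.t L.δ_pos] with t ht
    rw [Metric.mem_closedBall, dist_eq_norm] at ht
    rw [← sub_add_cancel t s.t]
    exact norm_add_le_of_le_of_le ht (s.t_le hμ)
  refine ⟨_, γ, hX, hΘ1, ?_, hd, fun h0 => ?_,
    hasDerivAt_mem hK L.lam_mem L.one_lt hd s.t_mem hXa.mem⟩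
  · filter_upwards [hcurve.eventually hΘg, hnear] with t h1 h2
    have h3 := L.Lam_map t 0 h2 L.zero_le_δ
    rw [add_zero] at h3
    rw [time, Function.iterate_add_apply, h3, h1]
  · rw [h0] at hd
    set A := max (‖L.eta‖ * s.C) L.M * (‖L.lam‖ ^ s.n)⁻¹ with hA
    have hA0 : 0 ≤ A := mul_nonneg (L.M_nonneg.trans (le_max_right _ _)) (by positivity)
    have hβn := norm_pos_iff.mpr hβ
    have hκ : 0 < ‖β‖ * s.c / 2 := by have := s.c_pos; positivity
    have hS : Tendsto (fun t => (t, L.S s.n t (s.ω J t))) (𝓝[≠] s.t ⊓ 𝓟 (K : Set F))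
        (𝓝 (s.t, L.Lam s.t 0)) := by
      refine Tendsto.prodMk_nhds (tendsto_id.mono_left (inf_le_left.trans nhdsWithin_le_nhds)) ?_
      rw [tendsto_iff_norm_sub_tendsto_zero]
      have h1 : Tendsto (fun t => A * ‖t - s.t‖) (𝓝[≠] s.t ⊓ 𝓟 (K : Set F)) (𝓝 0) := by
        have : Tendsto (fun t => A * ‖t - s.t‖) (𝓝 s.t) (𝓝 (A * ‖s.t - s.t‖)) :=
          Continuous.tendsto (by fun_prop) _
        rw [sub_self, norm_zero, mul_zero] at this
        exact this.mono_left (inf_le_left.trans nhdsWithin_le_nhds)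
      refine squeeze_zero' (Eventually.of_forall fun _ => norm_nonneg _) ?_ h1
      filter_upwards [mem_inf_of_left (nhdsWithin_le_nhds (Metric.closedBall_mem_nhds s.t s.s_pos)),
        mem_inf_of_right (mem_principal_self _)] with t h2 h3
      exact s.norm_S_sub_le hμ h3 (by rwa [← dist_eq_norm])
    have hne : (𝓝[≠] s.t ⊓ 𝓟 (K : Set F)).NeBot :=
      frequently_mem_iff_neBot.mp (frequently_mem_nhdsNE L.lam_mem L.one_lt s.t_mem)
    have hd' := (hd.isLittleO.def hκ).filter_mono
      (inf_le_left.trans nhdsWithin_le_nhds : 𝓝[≠] s.t ⊓ 𝓟 (K : Set F) ≤ 𝓝 s.t)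
    have hr' : Metric.closedBall (s.t, L.Lam s.t 0) r ∈ 𝓝 (s.t, L.Lam s.t 0) :=
      Metric.closedBall_mem_nhds _ hr
    have hs : ∀ᶠ t in 𝓝[≠] s.t ⊓ 𝓟 (K : Set F), ‖t - s.t‖ ≤ s.s ∧ t ∈ K ∧ t ≠ s.t := by
      filter_upwards [mem_inf_of_left (nhdsWithin_le_nhds (Metric.closedBall_mem_nhds s.t s.s_pos)),
        mem_inf_of_right (mem_principal_self _), mem_inf_of_left self_mem_nhdsWithin]
        with t h1 h2 h3
      exact ⟨by rwa [← dist_eq_norm], h2, h3⟩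
    have hcurve' := hcurve.mono_left
      (inf_le_left.trans nhdsWithin_le_nhds : 𝓝[≠] s.t ⊓ 𝓟 (K : Set F) ≤ 𝓝 s.t)
    obtain ⟨t, h1, h2, h3, h4, h5, h6, h7⟩ := (hd'.and ((hS.eventually hΘg).and
      ((hS.eventually hr').and ((hcurve'.eventually hr').and hs)))).exists
    simp only at h2 h3 h4
    rw [Function.iterate_add_apply, s.iterate_S hμ h6 h5, s.iterate_ω hμ J h6 h5] at h2
    rw [dist_eq_norm, Prod.mk_sub_mk, Prod.norm_mk, max_le_iff] at h3 h4
    have h8 := hstrict t _ _ h4.1 h4.2 h3.2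
    rw [← param_injective a₀ h2] at h8
    have h9 := h8.norm_eq (by norm_num)
    have h10 := s.expand t h6 h5
    rw [hΘ1, sub_self, sub_zero, smul_zero, sub_zero, h9, norm_mul] at h1
    have h11 : 0 < ‖t - s.t‖ := norm_pos_iff.mpr (sub_ne_zero.mpr h7)
    have h12 := mul_le_mul_of_nonneg_left h10 hβn.le
    have h13 := mul_pos hκ h11
    linarith

/-- The local degree of the iterate that maps the critical point to the fixed point is `d`, also at
nearby parameters, since after the first passage the orbit does not come back to the critical
point. -/
theorem eventually_hasDeg (hμ : μ ≤ L.δ) (hμ0 : 0 < μ)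
    (hμρ : L.M * μ ≤ ‖(L.d : F)‖ ^ 2 / 2 * ‖L.rho‖) (hf : AnalyticRational K s.t f)
    (ha : AnalyticOver K s.t a) (hc : AnalyticOver K s.t c) :
    ∀ᶠ t in 𝓝 s.t, HasDeg (f t)^[s.time] (param c₀ (c t)) L.d := by
  obtain ⟨β, hβ, hβc⟩ := s.hasChartDeriv_landing hμ hf
  have hone := eventually_hasDeg_one hf (hβ.hasDeg_one (s.landing_ne_zero hβc))
  have hcurve : Tendsto (fun t => (t, a t + L.Lam t 0)) (𝓝 s.t) (𝓝 (s.t, a s.t + L.Lam s.t 0)) :=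
    (continuousAt_id.prodMk (ha.analyticAt.continuousAt.add
      (s.analyticOver_Lam hμ hμ0 hf ha hc).analyticAt.continuousAt)).tendsto
  filter_upwards [hcurve.eventually hone, Metric.closedBall_mem_nhds s.t hμ0] with t h1 h2
  have htμ : ‖t‖ ≤ μ := by
    rw [Metric.mem_closedBall, dist_eq_norm] at h2
    rw [← sub_add_cancel t s.t]
    exact norm_add_le_of_le_of_le h2 s.norm_t
  have h3 := L.Lam_map t 0 (htμ.trans hμ) L.zero_le_δ
  rw [add_zero] at h3
  rw [← h3] at h1
  have h4 := h1.comp (L.hasDeg_critical hμ0 hμ hμρ htμ) L.d_ne_zero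
  rwa [mul_one, ← Function.iterate_add] at h4

/-- The leading coefficient at the critical point of the iterate that maps it to the fixed point. -/
theorem exists_hasLeadingTerm (hK : IsClosed (K : Set F)) (hμ : μ ≤ L.δ) (hμ0 : 0 < μ)
    (hμρ : L.M * μ ≤ ‖(L.d : F)‖ ^ 2 / 2 * ‖L.rho‖) (hf : AnalyticRational K s.t f)
    (ha : AnalyticOver K s.t a) (hc : AnalyticOver K s.t c) :
    ∃ ρ, HasLeadingTerm (fun w => chartMap (f s.t)^[s.time] (param c₀ (c s.t)) w
        - coord (param a₀ (a s.t)) (param a₀ (a s.t)))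
        (coord (param c₀ (c s.t)) (param c₀ (c s.t))) L.d
        (chartFactor a₀ (a s.t) * ρ * ((chartFactor c₀ (c s.t))⁻¹) ^ L.d) ∧
      RelClose (‖(L.d : F)‖ ^ 2 / 2) ρ (L.d * L.rho * s.v₀ ^ (L.d - 1) * s.returnFactor ^ J
        * (L.lam ^ s.n * L.eta⁻¹) * L.rho) ∧ ρ ∈ K := by
  obtain ⟨β, hβ, hβc⟩ := s.hasChartDeriv_landing hμ hf
  have hβ0 := s.landing_ne_zero hβc
  have htδ := s.t_le hμ
  obtain ⟨Φ, hΦ, hΦ1, hΦg⟩ := exists_chart hf hc (b := c₀) (e := a₀) (k := s.time) (v₁ := 0)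
    (x₁ := a s.t) (by rw [add_zero, s.iterate_time hμ])
  have hcurve : Tendsto (fun u => (s.t, u - c s.t)) (𝓝 (c s.t)) (𝓝 (s.t, 0)) := by
    have : Continuous fun u => (s.t, u - c s.t) := by fun_prop
    have := this.tendsto (c s.t)
    rwa [sub_self] at this
  have hX : AnalyticAt F (fun u => Φ (s.t, u - c s.t)) (c s.t) :=
    AnalyticAt.fun_comp (g := Φ) (f := fun u => (s.t, u - c s.t))
      (by rw [sub_self]; exact hΦ.analyticAt)
      (AnalyticAt.prod analyticAt_const (analyticAt_id.sub analyticAt_const))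
  have hXg : ∀ᶠ u in 𝓝 (c s.t), (f s.t)^[s.time] (param c₀ u)
      = param a₀ (Φ (s.t, u - c s.t)) := by
    filter_upwards [hcurve.eventually hΦg] with u hu
    rwa [add_sub_cancel] at hu
  obtain ⟨h, hh, hh0, hhΦ⟩ := exists_leading_factor hX hXg
    (s.eventually_hasDeg hμ hμ0 hμρ hf ha hc).self_of_nhds
  have h1 := hasLeadingTerm_chartMap L.d_ne_zero hXg hhΦ hh hh0
  simp only [sub_self, hΦ1] at h1
  refine ⟨_, h1, ?_, ?_⟩
  swap
  · have hcK : c s.t ∈ K := hc.mem.self_of_nhds s.t_mem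
    have haK : a s.t ∈ K := ha.mem.self_of_nhds s.t_mem
    refine hK.mem_of_frequently_of_tendsto ?_
      (hh.continuousAt.tendsto.mono_left (nhdsWithin_le_nhds (s := {c s.t}ᶜ)))
    refine ((frequently_mem_nhdsNE L.lam_mem L.one_lt hcK).and_eventually
      (((hhΦ.and (hcurve.eventually hΦ.mem)).filter_mono nhdsWithin_le_nhds).and
        self_mem_nhdsWithin)).mono fun u hu => ?_
    obtain ⟨hu, ⟨h2, h3⟩, h4⟩ := hu
    have h5 : u - c s.t ≠ 0 := sub_ne_zero.mpr h4
    rw [sub_self, hΦ1, ← sub_eq_iff_eq_add'] at h2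
    rw [eq_div_of_mul_eq (pow_ne_zero L.d h5) ((mul_comm _ _).trans h2.symm)]
    exact div_mem (sub_mem (h3 s.t_mem (sub_mem hu hcK)) haK) (pow_mem (sub_mem hu hcK) _)
  -- the leading coefficient is the product of those of the two passages
  have hval : h (c s.t) = β * L.E s.t 0 := by
    obtain ⟨Ψ, hΨ, hΨ1, hΨg⟩ := hβ
    have hE0 := L.E_close hμ hμρ s.norm_t (v := 0) (by simpa using hμ0.le)
    have hE0' := hE0.ne_zero L.sq_lt_one L.rho_ne
    have hsub : Tendsto (fun u => u - c s.t) (𝓝[≠] (c s.t)) (𝓝 0) := by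
      have : Tendsto (fun u => u - c s.t) (𝓝 (c s.t)) (𝓝 (c s.t - c s.t)) :=
        Continuous.tendsto (by fun_prop) _
      rw [sub_self] at this
      exact this.mono_left nhdsWithin_le_nhds
    have hEt := (L.continuousAt_E htδ).tendsto.comp hsub
    have hLt : Tendsto (fun u => a s.t + L.Lam s.t (u - c s.t)) (𝓝[≠] (c s.t))
        (𝓝[≠] (a s.t + L.Lam s.t 0)) := by
      rw [tendsto_nhdsWithin_iff]
      refine ⟨((L.continuousAt_Lam htδ).tendsto.comp hsub).const_add _, ?_⟩
      filter_upwards [self_mem_nhdsWithin, hEt.eventually_ne hE0'] with u hu hu2 h2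
      have h3 := L.Lam_sub_zero s.t (u - c s.t)
      rw [add_left_cancel h2, sub_self] at h3
      exact mul_ne_zero (pow_ne_zero _ (sub_ne_zero.mpr hu)) hu2 h3.symm
    have hlim := ((hasDerivAt_iff_tendsto_slope.mp hΨ).comp hLt).mul hEt
    refine tendsto_nhds_unique (hh.continuousAt.tendsto.mono_left nhdsWithin_le_nhds)
      (hlim.congr' ?_)
    filter_upwards [self_mem_nhdsWithin, nhdsWithin_le_nhds (hhΦ.and hXg),
      (hLt.mono_right nhdsWithin_le_nhds).eventually hΨg,
      hsub.eventually (Metric.closedBall_mem_nhds (0 : F) L.δ_pos),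
      hEt.eventually_ne hE0'] with u hu h2 h3 h4 h5
    have h6 : u - c s.t ≠ 0 := sub_ne_zero.mpr hu
    have h7 := L.Lam_map s.t (u - c s.t) htδ (by simpa using h4)
    rw [add_sub_cancel] at h7
    have h8 := h2.2
    rw [time, Function.iterate_add_apply, h7, h3] at h8
    have h9 := h2.1
    rw [sub_self, hΦ1, ← param_injective a₀ h8] at h9
    have h10 := L.Lam_sub_zero s.t (u - c s.t)
    simp only [Function.comp_apply] at h5 ⊢
    rw [slope_def_field, hΨ1, h9, add_sub_add_left_eq_sub, h10, add_sub_cancel_left]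
    have := pow_ne_zero L.d h6
    field_simp
  rw [hval]
  exact hβc.mul (L.E_close hμ hμρ s.norm_t (by simpa using hμ0.le)) L.sq_lt_one

end LocalModel.Solution

end Landing

/-! ### Transversality and admissibility -/

section Transversality

variable {F : Type*} [NontriviallyNormedField F] [IsUltrametricDist F] [CompleteSpace F]
  {K : Subfield F} {f : F → OnePoint F → OnePoint F} {a₀ c₀ : OnePoint F} {a c : F → F} {ℓ : ℕ}

namespace DynamicalModel

variable {L : DynamicalModel K f a₀ c₀ a c ℓ} {t : F}

/-- The coordinate of the fixed point in the standard chart at its value at `t` continues this fixed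
point. -/
theorem continuation (ha : AnalyticAt F a t) (htδ : ‖t‖ ≤ L.δ) :
    AnalyticAt F (fun t' => coord (param a₀ (a t)) (param a₀ (a t'))) t ∧
      ∀ᶠ t' in 𝓝 t, f t' (param (param a₀ (a t)) (coord (param a₀ (a t)) (param a₀ (a t'))))
        = param (param a₀ (a t)) (coord (param a₀ (a t)) (param a₀ (a t'))) := by
  obtain ⟨ψ, hψ, hψ1, hψ2⟩ := exists_chart_change a₀ (a t)
  have h1 := ha.continuousAt.tendsto.eventually hψ2
  constructor
  · have h2 : AnalyticAt F (fun t' => coord (param a₀ (a t)) (param a₀ (a t))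
        + (a t' - a t) * ψ (a t')) t :=
      analyticAt_const.add ((ha.sub analyticAt_const).mul (hψ.comp ha))
    exact h2.congr (h1.mono fun t' ht' => ht'.1.symm)
  · filter_upwards [h1, Metric.closedBall_mem_nhds t L.δ_pos] with t' h2 h3
    have h4 : ‖t'‖ ≤ L.δ := by
      rw [← sub_add_cancel t' t]
      refine norm_add_le_of_le_of_le ?_ htδ
      rwa [← dist_eq_norm]
    rw [h2.2, L.map_fixed (h4.trans L.δ_le)]

end DynamicalModel

namespace LocalModel.Solution

variable {L : DynamicalModel K f a₀ c₀ a c ℓ} {J : ℕ} {μ : ℝ} (s : L.Solution J μ)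

/-- The image of the critical point has a simple crossing with the fixed point at the parameter of a
solution. It is not a fixed point for nearby parameters, because the maps `y ↦ y * k t y`, with
`‖k t y‖ > 1`, have no other fixed point than `0`. -/
theorem exists_gap (hK : IsClosed (K : Set F)) (hμ : μ ≤ L.δ) (hμ0 : 0 < μ)
    (hf : AnalyticRational K s.t f) (ha : AnalyticOver K s.t a) (hc : AnalyticOver K s.t c) :
    ∃ γ ∈ K, HasLeadingTerm (fun t => coord (param a₀ (a s.t))
        ((f t)^[s.time] (param c₀ (c t))) - coord (param a₀ (a s.t)) (param a₀ (a t))) s.t 1 γ ∧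
      ∀ᶠ t in 𝓝[≠] s.t,
        f t ((f t)^[s.time] (param c₀ (c t))) ≠ (f t)^[s.time] (param c₀ (c t)) := by
  obtain ⟨X, γ, hX, hX1, hg, hd, hγ, hγK⟩ := s.exists_landing_curve hK hμ hμ0 hf ha hc
  refine ⟨chartFactor a₀ (a s.t) * γ,
    mul_mem (chartFactor_mem _ (ha.mem.self_of_nhds s.t_mem)) hγK, ?_, ?_⟩
  · obtain ⟨ψ, hψ, hψ1, hψ2⟩ := exists_chart_change a₀ (a s.t)
    have hτ : AnalyticAt F (fun x => coord (param a₀ (a s.t)) (param a₀ (a s.t))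
        + (x - a s.t) * ψ x) (a s.t) :=
      analyticAt_const.add ((analyticAt_id.sub analyticAt_const).mul hψ)
    have hτd : HasDerivAt (fun x => coord (param a₀ (a s.t)) (param a₀ (a s.t))
        + (x - a s.t) * ψ x) (chartFactor a₀ (a s.t)) (a s.t) := by
      have h1 := ((hasDerivAt_id (a s.t)).sub_const (a s.t)).mul hψ.differentiableAt.hasDerivAt
      have h2 := h1.const_add (coord (param a₀ (a s.t)) (param a₀ (a s.t)))
      simpa [hψ1, Pi.mul_def] using h2
    have hXt := hX.analyticAt.continuousAt.tendsto
    rw [hX1] at hXt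
    have heq : ∀ᶠ t in 𝓝 s.t, coord (param a₀ (a s.t)) ((f t)^[s.time] (param c₀ (c t)))
        - coord (param a₀ (a s.t)) (param a₀ (a t))
        = (coord (param a₀ (a s.t)) (param a₀ (a s.t)) + (X t - a s.t) * ψ (X t))
          - (coord (param a₀ (a s.t)) (param a₀ (a s.t)) + (a t - a s.t) * ψ (a t)) := by
      filter_upwards [hg, hXt.eventually hψ2, ha.analyticAt.continuousAt.tendsto.eventually hψ2]
        with t h1 h2 h3
      rw [h1, h2.1, h3.1]
    refine hasLeadingTerm_one ?_ ?_ ?_ (mul_ne_zero (chartFactor_ne_zero _ _) hγ)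
    · have hτX := AnalyticAt.comp_of_eq hτ hX.analyticAt hX1
      exact (hτX.sub (hτ.comp ha.analyticAt)).congr (heq.mono fun t ht => ht.symm)
    · rw [s.iterate_time hμ, sub_self]
    · have hXd := hX.analyticAt.differentiableAt.hasDerivAt
      have had := ha.analyticAt.differentiableAt.hasDerivAt
      have h1 := (HasDerivAt.comp_of_eq s.t hτd hXd hX1.symm).sub (hτd.comp s.t had)
      rw [← mul_sub, ← hd.unique (hXd.sub had)] at h1
      exact h1.congr_of_eventuallyEq heq
  · have h1 := hd.eventually_ne hγ (c := 0)
    have h2 : Tendsto (fun t => X t - a t) (𝓝 s.t) (𝓝 0) := by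
      have := hd.continuousAt.tendsto
      rwa [hX1, sub_self] at this
    filter_upwards [h1, nhdsWithin_le_nhds hg, nhdsWithin_le_nhds
      (h2.eventually (Metric.closedBall_mem_nhds (0 : F) L.δ₁_pos)),
      nhdsWithin_le_nhds (Metric.closedBall_mem_nhds s.t L.δ_pos)] with t h3 h4 h5 h6 h7
    have h8 : ‖t‖ ≤ L.δ₁ := by
      rw [← sub_add_cancel t s.t]
      refine norm_add_le_of_le_of_le ?_ ((s.t_le hμ).trans L.δ_le)
      rw [← dist_eq_norm]; exact (Metric.mem_closedBall.mp h6).trans L.δ_le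
    have h9 : ‖X t - a t‖ ≤ L.δ₁ := by simpa using h5
    have h10 := L.k_map t (X t - a t) h8 h9
    rw [add_sub_cancel, ← h4, h7, h4] at h10
    have h11 := param_injective a₀ h10
    have h12 : (X t - a t) * (L.k t (X t - a t) - 1) = 0 := by linear_combination -h11
    rw [mul_eq_zero, or_iff_right h3, sub_eq_zero] at h12
    have h13 := L.norm_k h8 h9
    rw [h12, norm_one] at h13
    exact L.one_lt.ne h13

/-- The asymptotic position and the coefficients of the expansions at the parameter of a solution
satisfy the condition on `d`-th powers. The coefficient `ρ` is close to `B * rho / eta * lam ^ n`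
times the product of the `d - 1` factors `B / eta * lam ^ (2 * n)` of the intermediate passages,
where `B = d * rho * v₀ ^ (d - 1)`. Since the number of returns is `d`, this is
`lam ^ m * lam ^ n * rho * (B / eta) ^ d` with `m = 2 * n * (d - 1)`. As
`v₀ ^ d = -zeta / (lam ^ n * rho)`, the quotient `-lam ^ m * zeta / ρ` is close to the `d`-th power
of `v₀ * eta / B`. -/
theorem exists_pow_eq (hK : IsClosed (K : Set F)) (s : L.Solution (L.d - 1) μ) (hμ : μ ≤ L.δ)
    {ζ ρ : F} (hζK : ζ ∈ K) (hρK : ρ ∈ K)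
    (hζ : RelClose (‖(L.d : F)‖ ^ 4 * ‖(L.d' : F)‖ ^ 2 / 2) ζ L.zeta)
    (hρ : RelClose (‖(L.d : F)‖ ^ 2 / 2) ρ (L.d * L.rho * s.v₀ ^ (L.d - 1)
      * s.returnFactor ^ (L.d - 1) * (L.lam ^ s.n * L.eta⁻¹) * L.rho)) :
    ∃ (m : ℕ) (x : F), x ∈ K ∧ x ^ L.d = -(L.k s.t 0 ^ m * ζ / ρ) := by
  have htδ := (s.t_le hμ).trans L.δ_le
  have hkK := L.k_mem s.t s.t_mem htδ
  have hη := L.eta_ne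
  have hl := L.lam_ne
  have hB := s.linear_ne_zero
  have hr := L.rho_ne
  set m := 2 * s.n * (L.d - 1) with hm
  set B := L.d * L.rho * s.v₀ ^ (L.d - 1) with hBdef
  have hBK : B ∈ K := mul_mem (mul_mem (natCast_mem K _) L.rho_mem) (pow_mem s.v₀_mem _)
  set w := s.v₀ / (L.eta⁻¹ * B) with hw
  have hwK : w ∈ K := div_mem s.v₀_mem (mul_mem (inv_mem L.eta_mem) hBK)
  have hw0 : w ≠ 0 := div_ne_zero s.v₀_ne (mul_ne_zero (inv_ne_zero hη) hB)
  have h1 : RelClose (‖(L.d : F)‖ ^ 2 / 2) (-(L.k s.t 0 ^ m * ζ / ρ)) (w ^ L.d) := by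
    have h2 := ((((L.k_close s.t 0 htδ L.zero_le_δ₁).mono L.eps_le).pow (by positivity)
      L.sq_lt_one m).mul (hζ.mono L.eps_le) L.sq_lt_one).div hρ L.sq_lt_one |>.neg
    convert h2 using 1
    have h3 : B * s.returnFactor ^ (L.d - 1) * (L.lam ^ s.n * L.eta⁻¹) * L.rho
        = L.lam ^ m * (L.lam ^ s.n * (L.eta⁻¹ * B) ^ L.d * L.rho) := by
      have h4 : s.returnFactor = L.lam ^ (2 * s.n) * (L.eta⁻¹ * B) := by
        rw [returnFactor, mul_assoc]
      rw [h4, mul_pow, ← pow_mul, ← hm]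
      have h5 : (L.eta⁻¹ * B) ^ L.d = (L.eta⁻¹ * B) ^ (L.d - 1) * (L.eta⁻¹ * B) := by
        rw [← pow_succ, Nat.sub_add_cancel (Nat.pos_of_ne_zero L.d_ne_zero)]
      rw [h5]; ring
    rw [h3, hw, div_pow, s.v₀_pow]
    have := pow_ne_zero m hl
    have := pow_ne_zero s.n hl
    have := pow_ne_zero L.d (mul_ne_zero (inv_ne_zero hη) hB)
    field_simp
  have h2 : RelClose (‖(L.d : F)‖ ^ 2 / 2) (-(L.k s.t 0 ^ m * ζ / ρ) / w ^ L.d) 1 :=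
    (RelClose.div_right_iff (pow_ne_zero _ hw0)).mpr h1
  obtain ⟨x, hx, hxd⟩ := exists_pow_eq_of_relClose_one hK L.d_ne le_rfl
    (div_mem (neg_mem (div_mem (mul_mem (pow_mem hkK m) hζK) hρK)) (pow_mem hwK _)) h2
  refine ⟨m, x * w, mul_mem hx hwK, ?_⟩
  rw [mul_pow, hxd, div_mul_cancel₀ _ (pow_ne_zero _ hw0)]

end LocalModel.Solution

end Transversality

/-! ### Families defined over a finite extension of the p-adic numbers -/

section Recentring

variable {F : Type*} [NontriviallyNormedField F] [IsUltrametricDist F] [CompleteSpace F]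

/-- A power series that converges at a point `z₀` also converges on the closed ball through this
point, and is analytic at all points of this closed ball. -/
theorem analyticAt_of_hasSum {a : ℕ → F} {g : F → F} {ξ t z₀ : F}
    (hs : Summable fun n => a n * (z₀ - ξ) ^ n) (hz₀ : z₀ ≠ ξ) (ht : ‖t - ξ‖ ≤ ‖z₀ - ξ‖)
    (hg : ∀ᶠ z in 𝓝 t, HasSum (fun n => a n * (z - ξ) ^ n) (g z)) : AnalyticAt F g t := by
  set r := ‖z₀ - ξ‖ with hr
  have hr0 : 0 < r := norm_pos_iff.mpr (sub_ne_zero.mpr hz₀)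
  have hlim : Tendsto (fun n => ‖a n‖ * r ^ n) atTop (𝓝 0) := by
    have := hs.tendsto_atTop_zero.norm
    rw [norm_zero] at this
    refine this.congr fun n => ?_
    rw [norm_mul, norm_pow]
  -- the terms of the expansion of the powers of `(t - ξ) + h`
  obtain ⟨T, hT⟩ : ∃ T : F → ℕ × ℕ → F, ∀ h q,
      T h q = a q.1 * (q.1.choose q.2 * (t - ξ) ^ (q.1 - q.2)) * h ^ q.2 := ⟨_, fun _ _ => rfl⟩
  have hbound : ∀ h : F, ‖h‖ ≤ r → ∀ q, ‖T h q‖ ≤ ‖a q.1‖ * r ^ q.1 := by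
    intro h hh q
    rcases lt_or_ge q.1 q.2 with hq | hq
    · simp only [hT, Nat.choose_eq_zero_of_lt hq, Nat.cast_zero, zero_mul, mul_zero, norm_zero]
      positivity
    · rw [hT, norm_mul, norm_mul, norm_mul, norm_pow, norm_pow, mul_assoc]
      refine mul_le_mul_of_nonneg_left ?_ (norm_nonneg _)
      calc ‖(q.1.choose q.2 : F)‖ * ‖t - ξ‖ ^ (q.1 - q.2) * ‖h‖ ^ q.2
          ≤ 1 * r ^ (q.1 - q.2) * r ^ q.2 := by
            gcongr
            exact IsUltrametricDist.norm_natCast_le_one F _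
        _ = r ^ q.1 := by rw [one_mul, ← pow_add, Nat.sub_add_cancel hq]
  have hsum : ∀ h : F, ‖h‖ ≤ r → Summable (T h) := by
    intro h hh
    refine NonarchimedeanAddGroup.summable_of_tendsto_cofinite_zero ?_
    rw [Metric.tendsto_nhds]
    intro ε hε
    obtain ⟨N, hN⟩ := eventually_atTop.mp (hlim.eventually_lt_const hε)
    refine Set.Finite.subset ((Finset.range N ×ˢ Finset.range N).finite_toSet) fun q hq => ?_
    rw [Set.mem_compl_iff, Set.mem_ofPred_eq, dist_zero_right, not_lt] at hq
    have h1 : q.1 < N := by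
      by_contra h1
      exact absurd (hq.trans (hbound h hh q)) (not_le.mpr (hN q.1 (not_lt.mp h1)))
    have h2 : q.2 ≤ q.1 := by
      by_contra h2
      have : T h q = 0 := by simp [hT, Nat.choose_eq_zero_of_lt (not_le.mp h2)]
      rw [this, norm_zero] at hq
      exact absurd hq (not_le.mpr hε)
    simp only [Finset.coe_product, Set.mem_prod, Finset.coe_range, Set.mem_Iio]
    omega
  have hrow : ∀ h : F, ∀ n, HasSum (fun k => T h (n, k)) (a n * (t + h - ξ) ^ n) := by
    intro h n
    have h1 : a n * (t + h - ξ) ^ n = ∑ k ∈ Finset.range (n + 1), T h (n, k) := by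
      rw [show t + h - ξ = h + (t - ξ) by ring, add_pow, Finset.mul_sum]
      exact Finset.sum_congr rfl fun k _ => by simp only [hT]; ring
    rw [h1]
    refine hasSum_sum_of_ne_finset_zero fun k hk => ?_
    rw [Finset.mem_range, not_lt] at hk
    simp [hT, Nat.choose_eq_zero_of_lt (show n < k by omega)]
  have hcol : ∀ k, Summable fun n => a n * (n.choose k * (t - ξ) ^ (n - k)) := by
    intro k
    have h1 := ((hsum (z₀ - ξ) le_rfl).comp_injective (i := fun n => (n, k))
      (fun n m h => (Prod.mk.inj h).1)).mul_right ((z₀ - ξ) ^ k)⁻¹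
    refine h1.congr fun n => ?_
    have := pow_ne_zero k (sub_ne_zero.mpr hz₀)
    simp only [hT, Function.comp_apply]
    field_simp
  refine HasFPowerSeriesAt.analyticAt (p := FormalMultilinearSeries.ofScalars F
    fun k => ∑' n, a n * (n.choose k * (t - ξ) ^ (n - k))) ?_
  rw [hasFPowerSeriesAt_iff]
  have h0 : Tendsto (fun h : F => t + h) (𝓝 0) (𝓝 t) := by
    have : Tendsto (fun h : F => t + h) (𝓝 0) (𝓝 (t + 0)) := Continuous.tendsto (by fun_prop) _
    rwa [add_zero] at this
  filter_upwards [h0.eventually hg, Metric.closedBall_mem_nhds (0 : F) hr0] with h h1 h2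
  have h3 := (hsum h (by simpa using h2)).hasSum
  have h4 := h3.prod_fiberwise (hrow h)
  rw [h1.unique h4]
  have h5 : HasSum (fun q : ℕ × ℕ => T h q.swap) (∑' q, T h q) :=
    (Equiv.prodComm ℕ ℕ).hasSum_iff.mpr h3
  refine h5.prod_fiberwise fun k => ?_
  simp only [FormalMultilinearSeries.coeff_ofScalars, smul_eq_mul, Prod.swap_prod_mk, hT]
  rw [mul_comm]
  exact (hcol k).hasSum.mul_right (h ^ k)

end Recentring

section Family

variable {p : ℕ} [Fact p.Prime]

/-- A finite extension of a complete field is complete, hence closed. -/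
theorem isClosed_toSubfield (K : IntermediateField ℚ_[p] ℂ_[p]) [FiniteDimensional ℚ_[p] K] :
    IsClosed (K.toSubfield : Set ℂ_[p]) :=
  Submodule.closed_of_finiteDimensional (Subalgebra.toSubmodule K.toSubalgebra)

theorem IsBall.isOpen {B : Set ℂ_[p]} (hB : IsBall B) : IsOpen B := by
  obtain ⟨a, r, hr, rfl | rfl⟩ := hB
  · exact IsUltrametricDist.isOpen_closedBall a hr.ne'
  · exact Metric.isOpen_ball

theorem HolomorphicOnBallOver.analyticOver {K : IntermediateField ℚ_[p] ℂ_[p]}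
    [FiniteDimensional ℚ_[p] K] {B : Set ℂ_[p]} (hB : IsBall B) {g : ℂ_[p] → ℂ_[p]}
    (hg : HolomorphicOnBallOver K g B) {t : ℂ_[p]} (ht : t ∈ B) :
    AnalyticOver K.toSubfield t g := by
  obtain ⟨ξ, hξ, hξK, a, haK, hsum⟩ := hg
  have hBt : ∀ᶠ z in 𝓝 t, z ∈ B := hB.isOpen.mem_nhds ht
  refine ⟨?_, ?_⟩
  · obtain ⟨z₀, hz₀, hz₀ξ, htz⟩ : ∃ z₀ ∈ B, z₀ ≠ ξ ∧ ‖t - ξ‖ ≤ ‖z₀ - ξ‖ := by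
      by_cases h : t = ξ
      · have hBξ : ∀ᶠ z in 𝓝 ξ, z ∈ B := hB.isOpen.mem_nhds hξ
        obtain ⟨z, hz, hzξ⟩ := ((hBξ.filter_mono nhdsWithin_le_nhds).and
          (self_mem_nhdsWithin (a := ξ) (s := {ξ}ᶜ))).exists
        exact ⟨z, hz, hzξ, by rw [h, sub_self, norm_zero]; exact norm_nonneg _⟩
      · exact ⟨t, ht, h, le_rfl⟩
    exact analyticAt_of_hasSum (hsum z₀ hz₀).summable hz₀ξ htz (hBt.mono fun z hz => hsum z hz)
  · filter_upwards [hBt] with z hz hzK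
    refine (isClosed_toSubfield K).mem_of_tendsto (hsum z hz) (Eventually.of_forall fun s => ?_)
    exact sum_mem fun n _ => mul_mem (haK n) (pow_mem (sub_mem hzK hξK) n)

theorem AnalyticOver.eventually {F : Type*} [NontriviallyNormedField F] [CompleteSpace F]
    {K : Subfield F} {t₁ : F} {g : F → F} (hg : AnalyticOver K t₁ g) :
    ∀ᶠ t in 𝓝 t₁, AnalyticOver K t g := by
  filter_upwards [hg.analyticAt.eventually_analyticAt, hg.mem.eventually_nhds] with t h1 h2
    using ⟨h1, h2⟩

theorem polyFamily_polyOfCoeffs {K : Subfield ℂ_[p]} {t : ℂ_[p]} {N : ℕ}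
    {a : Fin (N + 1) → ℂ_[p] → ℂ_[p]} (ha : ∀ i, AnalyticOver K t (a i)) :
    PolyFamily K t fun t => polyOfCoeffs fun i => a i t :=
  PolyFamily.sum fun i _ => (PolyFamily.C (ha i)).mul (PolyFamily.X.pow i)

namespace MarkedFamily

variable {R : MarkedFamily p} {K : IntermediateField ℚ_[p] ℂ_[p]} [FiniteDimensional ℚ_[p] K]

theorem DefinedOver.analyticRational (hRK : R.DefinedOver K) {t : ℂ_[p]} (ht : t ∈ R.B) :
    AnalyticRational K.toSubfield t R.map := by
  refine ⟨R.N, _, _, polyFamily_polyOfCoeffs fun i => (hRK.1 i).analyticOver R.isBall ht,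
    polyFamily_polyOfCoeffs fun i => (hRK.2.1 i).analyticOver R.isBall ht, ?_⟩
  filter_upwards [R.isBall.isOpen.mem_nhds ht] with t' ht'
  exact ⟨R.coprime t' ht', R.degree_eq t' ht', rfl⟩

/-- The critical point is analytic in the coordinate at its value at a parameter. -/
theorem DefinedOver.exists_crit (hRK : R.DefinedOver K) {t : ℂ_[p]} (ht : t ∈ R.B) :
    ∃ c : ℂ_[p] → ℂ_[p], AnalyticOver K.toSubfield t c ∧
      ∀ᶠ t' in 𝓝 t, R.crit t' = param (R.crit t) (c t') := by
  have hX := hRK.2.2.1.analyticOver R.isBall ht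
  have hY := hRK.2.2.2.analyticOver R.isBall ht
  set b := R.crit t with hb
  have h0 : chartDen b (R.critX t) (R.critY t) ≠ 0 :=
    chartDen_ne_zero (R.crit_ne t ht) (u := coord b b) (by rw [param_coord_self]; rfl)
  have hnum : AnalyticOver K.toSubfield t fun t => chartNum b (R.critX t) (R.critY t) := by
    induction b using OnePoint.rec with
    | infty => exact hY
    | coe b => exact hX
  have hden : AnalyticOver K.toSubfield t fun t => chartDen b (R.critX t) (R.critY t) := by
    induction b using OnePoint.rec with
    | infty => exact hX
    | coe b => exact hY
  refine ⟨fun t => chartNum b (R.critX t) (R.critY t) / chartDen b (R.critX t) (R.critY t),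
    ⟨hnum.1.div hden.1 h0, ?_⟩, ?_⟩
  · filter_upwards [hnum.2, hden.2] with t' h1 h2 ht' using div_mem (h1 ht') (h2 ht')
  · filter_upwards [hden.1.continuousAt.eventually_ne h0] with t' h1
    exact homPt_eq_param h1

end MarkedFamily

end Family

/-! ### Persistence of repelling fixed points -/

section Persistence

variable {F : Type*} [NontriviallyNormedField F] [IsUltrametricDist F] [CompleteSpace F]
  {K : Subfield F} {f : F → OnePoint F → OnePoint F}

/-- A repelling fixed point is not critical for any iterate. -/
theorem hasDeg_one_of_repelling {t : F} {a₀ : OnePoint F} (hf : AnalyticRational K t f)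
    (h : IsRepellingFixedPt (f t) a₀) (e : ℕ) : HasDeg (f t)^[e] a₀ 1 := by
  have hm : multiplier (f t) a₀ ≠ 0 := norm_pos_iff.mp (one_pos.trans h.2)
  have hone : HasDeg (f t) a₀ 1 := by
    have h1 := chartAnalyticAt_iterate hf 1 a₀
    rw [Function.iterate_one] at h1
    have h2 : HasChartDeriv (f t) a₀ (coord a₀ a₀) (f t a₀) (chartMap (f t) a₀ (coord a₀ a₀))
        (multiplier (f t) a₀) := ⟨_, h1.1.differentiableAt.hasDerivAt, rfl, h1.2⟩
    have h3 := h2.hasDeg_one hm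
    rwa [param_coord_self] at h3
  induction e with
  | zero =>
    refine ⟨1, 1, one_pos, Eventually.of_forall fun x => ?_⟩
    simp
  | succ e ih =>
    have h1 : HasDeg (f t) ((f t)^[e] a₀) 1 := by rwa [Function.iterate_fixed h.1]
    have := h1.comp ih one_ne_zero
    rwa [mul_one, ← Function.iterate_succ'] at this

/-- The multiplier of a fixed point as a function of the parameter and of the distance to the fixed
point. -/
theorem exists_multiplier_factor {a : F → F} {a₀ : OnePoint F} (hf : AnalyticRational K 0 f)
    (ha : AnalyticOver K 0 a) (ha0 : a 0 = coord a₀ a₀)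
    (hfix : ∀ᶠ t in 𝓝 0, f t (param a₀ (a t)) = param a₀ (a t)) :
    ∃ k : F × F → F, AnalyticOver₂ K (0, 0) k ∧ k (0, 0) = multiplier (f 0) a₀ ∧
      ∀ᶠ z in 𝓝 ((0 : F), (0 : F)),
        f z.1 (param a₀ (a z.1 + z.2)) = param a₀ (a z.1 + z.2 * k z) := by
  obtain ⟨Φ, hΦ, hΦ1, hg⟩ := exists_chart hf ha (b := a₀) (e := a₀) (k := 1) (v₁ := 0) (x₁ := a 0)
    (by rw [add_zero]; exact hfix.self_of_nhds)
  obtain ⟨M, r, hM, hr, hlip⟩ := exists_lipschitz_of_analyticAt hΦ.analyticAt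
  obtain ⟨r', hr', hbox⟩ := exists_box_of_eventually hg
  obtain ⟨k, hk, hkg⟩ := exists_chart_factor hf (b := a₀) (e := a₀) ha ha (k := 1) (d := 1)
    (by simpa using hfix) (by
      filter_upwards [Metric.closedBall_mem_nhds (0 : F) hr,
        Metric.closedBall_mem_nhds (0 : F) hr', hfix] with t h1 h2 h3
      refine ⟨M, ?_⟩
      filter_upwards [Metric.closedBall_mem_nhds (0 : F) hr,
        Metric.closedBall_mem_nhds (0 : F) hr'] with v h4 h5
      rw [mem_closedBall_zero_iff] at h1 h2 h4 h5
      have h6 := hbox t v (by simpa using h2) (by simpa using h5)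
      have h7 := hbox t 0 (by simpa using h2) (by simpa using hr'.le)
      simp only [add_zero, Function.iterate_one] at h6 h7
      rw [h3] at h7
      rw [Function.iterate_one, h6, coord_param, param_injective a₀ h7]
      have h8 := hlip (t, v) (t, 0)
        (by rw [Prod.mk_sub_mk, sub_zero, sub_zero, Prod.norm_mk]; exact max_le h1 h4)
        (by rw [Prod.mk_sub_mk, sub_zero, sub_zero, Prod.norm_mk, norm_zero]; exact max_le h1 hr.le)
      rw [Prod.mk_sub_mk, sub_self, sub_zero, Prod.norm_mk, norm_zero,
        max_eq_right (norm_nonneg _)] at h8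
      rwa [pow_one])
  simp only [pow_one, Function.iterate_one] at hkg
  refine ⟨k, hk, ?_, hkg⟩
  have hfa : f 0 a₀ = a₀ := by
    have := hfix.self_of_nhds
    rwa [ha0, param_coord_self] at this
  have hkt : AnalyticAt F (fun x => k (0, x)) 0 := hk.analyticAt.comp (f := fun x => ((0 : F), x))
    (AnalyticAt.prod analyticAt_const analyticAt_id)
  have h1 : HasDerivAt (fun x => a 0 + x * k (0, x)) (k (0, 0)) 0 := by
    have := (((hasDerivAt_id (0 : F)).mul hkt.differentiableAt.hasDerivAt).const_add (a 0))
    simpa [Pi.mul_def] using this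
  have h2 : HasDerivAt (fun u => a 0 + (u - a 0) * k (0, u - a 0)) (k (0, 0)) (a 0) := by
    have h3 : HasDerivAt (fun x => a 0 + x * k (0, x)) (k (0, 0)) (a 0 - a 0) := by rwa [sub_self]
    exact h3.comp_sub_const (a 0) (a 0)
  have hcurve : Tendsto (fun u => ((0 : F), u - a 0)) (𝓝 (a 0)) (𝓝 (0, 0)) := by
    have : Continuous fun u => ((0 : F), u - a 0) := by fun_prop
    have := this.tendsto (a 0)
    rwa [sub_self] at this
  rw [multiplier, ← ha0]
  refine (h2.congr_of_eventuallyEq ?_).deriv.symm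
  filter_upwards [hcurve.eventually hkg] with u hu
  rw [add_sub_cancel] at hu
  rw [chartMap, hfa, hu, coord_param]

/-- The continuation of a repelling fixed point takes values in `K` at the parameters in `K`, by
the uniqueness of the solution of the equation that defines it. -/
theorem analyticOver_of_fixed (hK : IsClosed (K : Set F)) {q : F} (hq : q ∈ K) (hq1 : 1 < ‖q‖)
    {a : F → F} {a₀ : OnePoint F} (hf : AnalyticRational K 0 f) (ha : AnalyticAt F a 0)
    (ha0 : a 0 = coord a₀ a₀) (haK : a 0 ∈ K)
    (hfix : ∀ᶠ t in 𝓝 0, f t (param a₀ (a t)) = param a₀ (a t))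
    (hrep : 1 < ‖multiplier (f 0) a₀‖) : AnalyticOver K 0 a := by
  refine ⟨ha, ?_⟩
  obtain ⟨Φ, hΦ, hΦ1, hg⟩ := exists_chart hf (AnalyticOver.const (zero_mem K)) (b := a₀) (e := a₀)
    (k := 1) (v₁ := a 0) (x₁ := a 0) (by rw [zero_add]; exact hfix.self_of_nhds)
  simp only [zero_add, Function.iterate_one] at hg
  have hW : AnalyticOver₂ K (0, a 0) fun z => Φ z - z.2 := hΦ.sub .snd
  obtain ⟨β, hβ, hstrict⟩ := exists_hasDerivAt_snd_and_strict hW.analyticAt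
  have hcurve : Tendsto (fun x => ((0 : F), x)) (𝓝 (a 0)) (𝓝 (0, a 0)) :=
    (Continuous.prodMk_right (0 : F)).tendsto _
  have hβ1 : β + 1 = multiplier (f 0) a₀ := by
    have h1 := hβ.add (hasDerivAt_id (a 0))
    have hfa : f 0 a₀ = a₀ := by
      have := hfix.self_of_nhds
      rwa [ha0, param_coord_self] at this
    rw [multiplier, ← ha0]
    refine (h1.congr_of_eventuallyEq ?_).deriv.symm
    filter_upwards [hcurve.eventually hg] with u hu
    rw [chartMap, hfa, hu, coord_param]
    simp
  -- the equation `f t x = x` is nondegenerate because the multiplier is not `1`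
  have hβ0 : β ≠ 0 := by
    rintro rfl
    rw [← hβ1, zero_add, norm_one] at hrep
    exact lt_irrefl _ hrep
  have hβK : β ∈ K := hasDerivAt_mem hK hq hq1 hβ haK
    ((hcurve.eventually hW.mem).mono fun x hx => hx (zero_mem K))
  obtain ⟨r, hr, hsep⟩ := hstrict (1 / 2 * ‖β‖) (by have := norm_pos_iff.mpr hβ0; positivity)
  obtain ⟨S, δ, -, hδ, -, -, hS, -, -⟩ := exists_implicit hK hW (by simp [hΦ1]) haK hβ0 hβK hstrict
    (ε := 1 / 2) (by norm_num) (by norm_num) hr (P := fun _ => True)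
    (Eventually.of_forall fun _ => trivial)
  have hcurve' : Tendsto (fun t => (t, a t)) (𝓝 0) (𝓝 (0, a 0)) :=
    (continuousAt_id.prodMk ha.continuousAt).tendsto
  filter_upwards [hfix, hcurve'.eventually hg, Metric.closedBall_mem_nhds (0 : F) hr,
    Metric.closedBall_mem_nhds (0 : F) hδ,
    ha.continuousAt.tendsto.eventually (Metric.closedBall_mem_nhds (a 0) hr)]
    with t h1 h2 h3 h4 h5 ht
  rw [mem_closedBall_zero_iff] at h3 h4
  rw [dist_eq_norm] at h5
  obtain ⟨h6, h7, h8, -⟩ := hS t ht 0 (zero_mem K) h4 (by simpa using hδ.le)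
  simp only at h2 h8
  rw [h1] at h2
  have h9 := hsep t (a t) (S t 0) (by simpa using h3) h5 h7
  have h10 : Φ (t, a t) - a t = 0 := by rw [← param_injective a₀ h2, sub_self]
  simp only at h9
  rw [h10, h8, sub_self, zero_sub, norm_neg, norm_mul] at h9
  have h11 : ‖a t - S t 0‖ = 0 := by
    have h12 := norm_pos_iff.mpr hβ0
    nlinarith [norm_nonneg (a t - S t 0), mul_nonneg h12.le (norm_nonneg (a t - S t 0))]
  rw [norm_eq_zero, sub_eq_zero] at h11
  rwa [h11]

end Persistence

/-! ### The local model of a homoclinic orbit -/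

section Homoclinic

variable {F : Type*} [NontriviallyNormedField F] {g : OnePoint F → OnePoint F} {a₀ c₀ : OnePoint F}
  {z : ℤ → OnePoint F}

theorem IsPointOver.coord_mem {K : Subfield F} {z : OnePoint F} (hz : IsPointOver K z)
    (b : OnePoint F) : coord b z ∈ K := by
  rcases hz with rfl | ⟨x, hx, rfl⟩ <;> induction b using OnePoint.rec <;>
    simp [coord, zero_mem] <;> assumption

theorem IsHomoclinic.tendsto_neg (hz : IsHomoclinic g a₀ z) :
    Tendsto (fun i : ℕ => z (-(i : ℤ))) atTop (pnhds (param a₀ (coord a₀ a₀))) := by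
  rw [param_coord_self, tendsto_pnhds]
  refine hz.2.comp ?_
  rw [← Nat.cofinite_eq_atTop]
  exact Function.Injective.tendsto_cofinite fun i j h => by simpa using h

theorem IsHomoclinic.iterate (hz : IsHomoclinic g a₀ z) (n : ℕ) (i : ℤ) :
    g^[n] (z i) = z (i + n) := by
  induction n with
  | zero => simp
  | succ n ih =>
    rw [Function.iterate_succ_apply', ih, hz.1]
    push_cast
    ring_nf

/-- The point `z (-i)` of a homoclinic orbit is mapped to the critical point exactly by the `i`-th
iterate, since the critical point is not periodic. -/
theorem IsCriticalHomoclinic.localDegree_eq_one (hz : IsCriticalHomoclinic g a₀ c₀ z)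
    (ha₀ : g a₀ = a₀) (hne : c₀ ≠ a₀) {ℓ : ℕ} (hℓ : g^[ℓ] c₀ = a₀) {i : ℕ} (hi : 1 ≤ i) :
    localDegree g^[i] (z (-(i : ℤ))) = 1 := by
  obtain ⟨n, -, hn1, hn2⟩ := hz.2.2 (-(i : ℤ)) (by omega)
  have hper : ∀ e, 0 < e → g^[e] c₀ ≠ c₀ := by
    intro e he h
    have h1 : g^[e * ℓ] c₀ = c₀ := by rw [Function.iterate_mul, Function.iterate_fixed h]
    have h2 : e * ℓ = (e * ℓ - ℓ) + ℓ := (Nat.sub_add_cancel (Nat.le_mul_of_pos_left ℓ he)).symm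
    rw [h2, Function.iterate_add_apply, hℓ, Function.iterate_fixed ha₀] at h1
    exact hne h1.symm
  have hi0 : g^[i] (z (-(i : ℤ))) = c₀ := by rw [hz.1.iterate, neg_add_cancel, hz.2.1]
  rcases lt_trichotomy n i with h | h | h
  · exfalso
    obtain ⟨e, rfl⟩ := Nat.exists_eq_add_of_lt h
    rw [show n + e + 1 = (e + 1) + n by ring, Function.iterate_add_apply] at hi0
    rw [show n + e + 1 = (e + 1) + n by ring] at hn1
    rw [hn1] at hi0
    exact hper _ (by omega) hi0
  · rwa [h] at hn2
  · exfalso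
    obtain ⟨e, rfl⟩ := Nat.exists_eq_add_of_lt h
    rw [show i + e + 1 = (e + 1) + i by ring, Function.iterate_add_apply, hi0] at hn1
    exact hper _ (by omega) hn1

end Homoclinic

section Model

variable {F : Type*} [NontriviallyNormedField F] [IsUltrametricDist F] [CompleteSpace F]
  [CharZero F] {K : Subfield F} {f : F → OnePoint F → OnePoint F} {a₀ c₀ : OnePoint F} {a c : F → F}
  {ℓ d d' : ℕ} {z : ℤ → OnePoint F} {q ζ ρ ρ' : F}

theorem eq_of_hasLeadingTerm {g h : F → F} {u₁ : F} {d : ℕ} (hg : HasLeadingTerm g u₁ d ρ)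
    (hh : ContinuousAt h u₁) (hgh : ∀ᶠ u in 𝓝[≠] u₁, g u = (u - u₁) ^ d * h u) : h u₁ = ρ := by
  obtain ⟨-, k, hk, hk1, hgk⟩ := hg
  rw [← hk1]
  refine tendsto_nhds_unique (hh.tendsto.mono_left (nhdsWithin_le_nhds (s := {u₁}ᶜ)))
    ((hk.continuousAt.tendsto.mono_left nhdsWithin_le_nhds).congr' ?_)
  filter_upwards [hgh, nhdsWithin_le_nhds hgk, self_mem_nhdsWithin] with u h1 h2 h3
  rw [h2] at h1
  exact mul_left_cancel₀ (pow_ne_zero _ (sub_ne_zero.mpr h3)) h1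

theorem HasLeadingTerm.ne_zero {g : F → F} {u₁ : F} (hg : HasLeadingTerm g u₁ d ρ)
    (h0 : g u₁ = 0) : d ≠ 0 := by
  rintro rfl
  obtain ⟨hρ, k, -, hk1, hgk⟩ := hg
  have := hgk.self_of_nhds
  rw [h0, pow_zero, one_mul, hk1] at this
  exact hρ this.symm

/-- The degree of the critical point, from the leading term of the iterate landing on the fixed
point. -/
theorem hasDeg_of_hasLeadingTerm {g : OnePoint F → OnePoint F} (hg : ChartAnalyticAt g c₀)
    (h : HasLeadingTerm (fun u => chartMap g c₀ u - coord (g c₀) (g c₀)) (coord c₀ c₀) d ρ) :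
    HasDeg g c₀ d := by
  rw [← hg.localDegree_eq_iff, localDegree,
    (hg.1.fun_sub analyticAt_const).analyticOrderAt_eq_natCast]
  obtain ⟨hρ, k, hk, hk1, hgk⟩ := h
  exact ⟨k, hk, by rwa [hk1], by simpa only [smul_eq_mul] using hgk⟩

/-- The local model of a family with a critical homoclinic orbit defined over `K`. All germs that
enter into it preserve `K`: the fixed point by `analyticOver_of_fixed`, and the other ones as
quotients of functions obtained from the maps. The hypotheses on `q` are used to approximate points
of `K` by other points of `K`. -/
theorem exists_dynamicalModel_of_homoclinic (hK : IsClosed (K : Set F)) (hq : q ∈ K)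
    (hq1 : 1 < ‖q‖) (hf : AnalyticRational K 0 f)
    (hc : AnalyticOver K 0 c) (hc0 : c 0 = coord c₀ c₀)
    (ha : AnalyticAt F a 0) (ha0 : a 0 = coord a₀ a₀)
    (hfix : ∀ᶠ t in 𝓝 0, f t (param a₀ (a t)) = param a₀ (a t))
    (hrep : IsRepellingFixedPt (f 0) a₀) (hne : c₀ ≠ a₀) (hland : (f 0)^[ℓ] c₀ = a₀)
    {e : ℕ} (hdeg : ∀ᶠ t in 𝓝 0, HasDeg (f t)^[ℓ] (param c₀ (c t)) e)
    (hz : IsCriticalHomoclinic (f 0) a₀ c₀ z) (hzK : ∀ i, IsPointOver K (z i))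
    (hζ : IsAsymptoticPosition (f 0) a₀ z ζ)
    (hρ : HasLeadingTerm (fun u => chartMap (f 0)^[ℓ] c₀ u - coord a₀ a₀) (coord c₀ c₀) d ρ)
    (hρ' : HasLeadingTerm (fun t => coord a₀ ((f t)^[ℓ] (param c₀ (c t))) - a t) 0 d' ρ') :
    AnalyticOver K 0 a ∧ ∃ L : DynamicalModel K f a₀ c₀ a c ℓ,
      L.lam = multiplier (f 0) a₀ ∧ L.zeta = ζ ∧ L.rho = ρ ∧ L.rho' = ρ' ∧ L.d = d ∧ L.d' = d' := by
  have hcc : param c₀ (c 0) = c₀ := by rw [hc0, param_coord_self]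
  have haa : param a₀ (a 0) = a₀ := by rw [ha0, param_coord_self]
  -- the coordinates of the homoclinic orbit near the fixed point
  have hzt := tendsto_coord_of_tendsto_pnhds hz.1.tendsto_neg
  rw [← ha0] at hzt
  have haK : a 0 ∈ K := hK.mem_of_tendsto hzt.1 (Eventually.of_forall fun i => (hzK _).coord_mem a₀)
  have haO := analyticOver_of_fixed hK hq hq1 hf ha ha0 haK hfix hrep.2
  refine ⟨haO, ?_⟩
  obtain ⟨k, hk, hk0, hkf⟩ := exists_multiplier_factor hf haO ha0 hfix
  -- the passage from the critical point to the fixed point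
  obtain ⟨Φ, hΦ, hΦ1, hΦg⟩ := exists_chart hf hc (b := c₀) (e := a₀) (k := ℓ) (v₁ := 0) (x₁ := a 0)
    (by rw [add_zero, hcc, hland, haa])
  have hcurve : Tendsto (fun t : F => (t, (0 : F))) (𝓝 0) (𝓝 (0, 0)) :=
    (Continuous.prodMk_left (0 : F)).tendsto _
  have hw : AnalyticOver K 0 fun t => Φ (t, 0) :=
    hΦ.comp_curve (AnalyticOver.const (zero_mem K))
  have hwg : ∀ᶠ t in 𝓝 0, (f t)^[ℓ] (param c₀ (c t)) = param a₀ (Φ (t, 0)) := by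
    filter_upwards [hcurve.eventually hΦg] with t ht
    simpa using ht
  have hCA : ChartAnalyticAt (f 0)^[ℓ] c₀ := chartAnalyticAt_iterate hf ℓ c₀
  have hed : e = d := by
    have h1 := hdeg.self_of_nhds
    rw [hcc] at h1
    have h2 := hasDeg_of_hasLeadingTerm hCA (d := d) (ρ := ρ) (by rw [hland]; exact hρ)
    exact hCA.unique h1 h2
  subst hed
  obtain ⟨E, hE, hEg⟩ := exists_chart_factor hf hc hw (k := ℓ) (d := e) hwg (by
    filter_upwards [hdeg, (hΦg.and hΦ.analyticAt.eventually_analyticAt).eventually_nhds |>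
      hcurve.eventually] with t h1 h2
    have hslice : Tendsto (fun v => (t, v)) (𝓝 (0 : F)) (𝓝 (t, 0)) :=
      (Continuous.prodMk_right t).tendsto _
    have h3 := hasDeg_param_add_iff (g := (f t)^[ℓ]) (b := c₀) (e := a₀) (s := c t) (x₁ := 0)
      (Ψ := fun v => Φ (t, v)) (n := e) (h2.self_of_nhds.2.continuousAt.comp
      (f := fun v => (t, v)) hslice) ((hslice.eventually h2).mono fun v hv => hv.1)
    rw [add_zero] at h3
    obtain ⟨C₁, C, -, h4⟩ := h3.mp h1
    refine ⟨C, ?_⟩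
    filter_upwards [h4, hslice.eventually h2] with v h5 h6
    have h7 := h5.2
    rw [sub_zero] at h7
    rw [h6.1, coord_param]
    exact h7)
  have hd : e ≠ 0 := hρ.ne_zero (by rw [chartMap_coord_self, hland, sub_self])
  have hE0 : E (0, 0) = ρ := by
    have hsub : Tendsto (fun u => ((0 : F), u - c 0)) (𝓝 (c 0)) (𝓝 (0, 0)) := by
      have : Continuous fun u => ((0 : F), u - c 0) := by fun_prop
      have := this.tendsto (c 0)
      rwa [sub_self] at this
    have h1 := eq_of_hasLeadingTerm (h := fun u => E (0, u - c 0)) (u₁ := c 0) (by rwa [hc0])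
      (by
        refine Tendsto.comp (y := 𝓝 ((0 : F), (0 : F))) (g := E) ?_ hsub
        simp only [sub_self]
        exact hE.analyticAt.continuousAt.tendsto) ?_
    · rwa [sub_self] at h1
    · filter_upwards [nhdsWithin_le_nhds (hsub.eventually hEg)] with u hu
      rw [add_sub_cancel] at hu
      rw [chartMap, hland, hu, coord_param, hΦ1, ha0, add_sub_cancel_left]
  -- the motion of the image of the critical point with respect to the fixed point
  have hgap : ∀ᶠ t in 𝓝 0, coord a₀ ((f t)^[ℓ] (param c₀ (c t))) - a t = Φ (t, 0) - a t := by
    filter_upwards [hwg] with t ht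
    rw [ht, coord_param]
  have hd' : d' ≠ 0 := hρ'.ne_zero (by rw [hcc, hland, ha0, sub_self])
  obtain ⟨hρ'0, G, hG, hG0, hGg⟩ := hρ'
  have hGK : AnalyticOver K 0 G := by
    have hne : ∀ᶠ t in 𝓝[≠] 0, t ∈ K → G t ∈ K := by
      filter_upwards [nhdsWithin_le_nhds (hGg.and (hgap.and (hw.sub haO).mem)),
        self_mem_nhdsWithin] with t h1 h2 ht
      have h3 : (Φ (t, 0) - a t) / t ^ d' = G t := by
        rw [← h1.2.1, h1.1, sub_zero, mul_div_cancel_left₀ _ (pow_ne_zero _ h2)]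
      rw [← h3]
      exact div_mem (h1.2.2 ht) (pow_mem ht _)
    refine ⟨hG, ?_⟩
    have h0 : G 0 ∈ K := hK.mem_of_frequently_of_tendsto
      (((frequently_mem_nhdsNE hq hq1 (zero_mem K)).and_eventually hne).mono fun t ht => ht.2 ht.1)
      (hG.continuousAt.tendsto.mono_left nhdsWithin_le_nhds)
    filter_upwards [eventually_nhdsWithin_iff.mp hne] with t h1 ht
    by_cases h2 : t = 0
    · rwa [h2]
    · exact h1 h2 ht
  have hlam := hrep.2
  rw [← hk0] at hlam ⊢
  have hfst : Tendsto (Prod.fst : F × F → F) (𝓝 (0, 0)) (𝓝 0) := continuous_fst.tendsto _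
  refine exists_dynamicalModel (y := fun i => coord a₀ (z (-(i : ℤ))) - a 0) hK hf haO hc hlam hk
    rfl hkf hGK hG0 hρ'0 hE hE0 hρ.1 ?_ (Nat.cast_ne_zero.mpr hd) (Nat.cast_ne_zero.mpr hd')
    (Eventually.of_forall fun i => sub_mem ((hzK _).coord_mem a₀) haK) ?_ ?_ ?_ ?_ ?_
  · filter_upwards [hEg, hfst.eventually (hGg.and hgap)] with v h1 h2
    rw [h1]
    congr 1
    have h3 := h2.1
    rw [h2.2, sub_zero] at h3
    linear_combination h3
  · have := hzt.1.sub_const (a 0)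
    rwa [sub_self] at this
  · filter_upwards [hzt.2] with i hi h
    rw [sub_eq_zero.mp h, haa] at hi
    have h1 := hz.1.iterate i (-(i : ℤ))
    rw [hi, Function.iterate_fixed hrep.1, neg_add_cancel, hz.2.1] at h1
    exact hne h1.symm
  · rw [hk0, ha0]; exact hζ
  · filter_upwards [hzt.2, (tendsto_add_atTop_nat 1).eventually hzt.2] with i h1 h2
    rw [add_sub_cancel, add_sub_cancel, ← h1, ← h2, hz.1.1]
    push_cast
    ring_nf
  · filter_upwards [hzt.2, eventually_ge_atTop 1] with i h1 h2
    rw [add_sub_cancel, ← h1, hcc]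
    refine ⟨by rw [hz.1.iterate, neg_add_cancel, hz.2.1], ?_⟩
    rw [← (chartAnalyticAt_iterate hf i _).localDegree_eq_iff]
    exact_mod_cast hz.localDegree_eq_one hrep.1 hne hland h2

end Model

/-! ### Misiurewicz bifurcations -/

theorem HasLeadingTerm.congr {F : Type*} [NontriviallyNormedField F] {g g' : F → F} {u₁ ρ : F}
    {d : ℕ} (hg : HasLeadingTerm g u₁ d ρ) (h : ∀ᶠ u in 𝓝 u₁, g u = g' u) :
    HasLeadingTerm g' u₁ d ρ := by
  obtain ⟨hρ, k, hk, hk1, hgk⟩ := hg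
  refine ⟨hρ, k, hk, hk1, ?_⟩
  filter_upwards [h, hgk] with u h1 h2 using h1.symm.trans h2

section Landing

variable {p : ℕ} [Fact p.Prime] {R : MarkedFamily p} {K : IntermediateField ℚ_[p] ℂ_[p]}
  [FiniteDimensional ℚ_[p] K] {t : ℂ_[p]}

namespace MarkedFamily

theorem HasMisiurewiczBifurcation.landingTime_spec (h : R.HasMisiurewiczBifurcation t) :
    1 ≤ R.landingTime t ∧ IsRepellingFixedPt (R.map t) (R.landingPt t) := by
  obtain ⟨-, ℓ, hℓ, hrep, -⟩ := h
  exact Nat.sInf_mem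
    (s := {ℓ : ℕ | 1 ≤ ℓ ∧ IsRepellingFixedPt (R.map t) ((R.map t)^[ℓ] (R.crit t))}) ⟨ℓ, hℓ, hrep⟩

/-- A repelling fixed point is not critical. -/
theorem crit_ne_of_repelling (hRK : R.DefinedOver K) (ht : t ∈ R.B) {z : OnePoint ℂ_[p]}
    (hz : IsRepellingFixedPt (R.map t) z) : R.crit t ≠ z := by
  rintro rfl
  have hf := hRK.analyticRational ht
  have h1 := (chartAnalyticAt_iterate hf 1 _).localDegree_eq_iff.mpr
    (hasDeg_one_of_repelling hf hz 1)
  have h2 := R.isCritical t ht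
  rw [Function.iterate_one] at h1
  unfold IsCriticalPt at h2
  exact (h2.trans_eq (h1.trans Nat.cast_one)).false

/-- The critical point does not reach the fixed point before the landing time; for the landing time
`1`, this holds because the critical point is not the fixed point itself. -/
theorem HasMisiurewiczBifurcation.iterate_landingTime_sub_one_ne (hRK : R.DefinedOver K)
    (h : R.HasMisiurewiczBifurcation t) :
    (R.map t)^[R.landingTime t - 1] (R.crit t) ≠ R.landingPt t := by
  obtain ⟨h1, h2⟩ := h.landingTime_spec
  intro h3
  rcases Nat.eq_or_lt_of_le h1 with h4 | h4
  · rw [← h4] at h3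
    exact crit_ne_of_repelling hRK h.1 h2 h3
  · have h5 : R.landingTime t ≤ R.landingTime t - 1 :=
      Nat.sInf_le ⟨by omega, by rwa [h3]⟩
    omega

/-- The landing time is `T` if the orbit is at a repelling fixed point at time `T`, but not at time
`T - 1`, since an orbit that is at a fixed point stays there. -/
theorem landingTime_eq {T : ℕ} {z : OnePoint ℂ_[p]} (hT : 1 ≤ T)
    (hTz : (R.map t)^[T] (R.crit t) = z) (hz : IsRepellingFixedPt (R.map t) z)
    (hne : (R.map t)^[T - 1] (R.crit t) ≠ z) : R.landingTime t = T := by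
  refine le_antisymm (Nat.sInf_le ⟨hT, by rwa [hTz]⟩)
    (le_csInf ⟨T, hT, by rwa [hTz]⟩ fun j hj => ?_)
  by_contra! hjT
  have hfix := hj.2.1
  have h1 : ∀ i, j ≤ i → (R.map t)^[i] (R.crit t) = (R.map t)^[j] (R.crit t) := by
    intro i hi
    obtain ⟨e, rfl⟩ := Nat.exists_eq_add_of_le' hi
    rw [Function.iterate_add_apply, Function.iterate_fixed hfix]
  exact hne (by rw [h1 _ (by omega), ← h1 T hjT.le, hTz])

/-- The degree of `R_t ^ ℓ` at the critical point is constant near a Misiurewicz bifurcation with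
landing time `ℓ`, since further iterates have degree one near the repelling fixed point. -/
theorem HasMisiurewiczBifurcation.exists_eventually_hasDeg (hRK : R.DefinedOver K)
    (h : R.HasMisiurewiczBifurcation t) {c : ℂ_[p] → ℂ_[p]} (hc : AnalyticOver K.toSubfield t c)
    (hcrit : ∀ᶠ t' in 𝓝 t, R.crit t' = param (R.crit t) (c t')) :
    ∃ d, ∀ᶠ t' in 𝓝 t, HasDeg (R.map t')^[R.landingTime t] (param (R.crit t) (c t')) d := by
  have hf := hRK.analyticRational h.1
  have hrep := h.landingTime_spec.2
  obtain ⟨hB, ℓ, hℓ, hrep', -, -, d, hd⟩ := h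
  have hle : R.landingTime t ≤ ℓ := Nat.sInf_le ⟨hℓ, hrep'⟩
  obtain ⟨e, rfl⟩ := Nat.exists_eq_add_of_le' hle
  set a₀ := R.landingPt t with ha₀
  obtain ⟨Φ, hΦ, hΦ1, hΦg⟩ := exists_chart hf hc (b := R.crit t) (e := a₀) (k := R.landingTime t)
    (v₁ := 0) (x₁ := coord a₀ a₀)
    (by rw [add_zero, ← hcrit.self_of_nhds, param_coord_self, ha₀, landingPt])
  have hcurve : Tendsto (fun t' : ℂ_[p] => (t', (0 : ℂ_[p]))) (𝓝 t) (𝓝 (t, 0)) :=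
    (Continuous.prodMk_left (0 : ℂ_[p])).tendsto _
  have hΦt : Tendsto (fun t' => (t', Φ (t', 0))) (𝓝 t) (𝓝 (t, coord a₀ a₀)) := by
    refine tendsto_id.prodMk_nhds ?_
    rw [← hΦ1]
    exact hΦ.analyticAt.continuousAt.tendsto.comp hcurve
  have hone := eventually_hasDeg_one hf (b := a₀) (u₁ := coord a₀ a₀) (k := e)
    (by rw [param_coord_self]; exact hasDeg_one_of_repelling hf hrep e)
  refine ⟨d, ?_⟩
  filter_upwards [hd, hcrit, hcurve.eventually hΦg, hΦt.eventually hone,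
    R.isBall.isOpen.mem_nhds hB] with t' h1 h2 h3 h4 h5
  have hf' := hRK.analyticRational h5
  rw [(chartAnalyticAt_iterate hf' _ _).localDegree_eq_iff, h2, Function.iterate_add] at h1
  refine h1.of_comp ?_ (chartAnalyticAt_iterate hf' _ _).tendsto
  rw [add_zero] at h3
  rwa [h3]

/-- The local model of a Misiurewicz bifurcation with an admissible homoclinic orbit. -/
theorem IsAdmissibleHomoclinic.exists_dynamicalModel (hRK : R.DefinedOver K)
    (hbif : R.HasMisiurewiczBifurcation 0) {z : ℤ → OnePoint ℂ_[p]}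
    (hz : R.IsAdmissibleHomoclinic K 0 z) {c : ℂ_[p] → ℂ_[p]} (hc : AnalyticOver K.toSubfield 0 c)
    (hcrit : ∀ᶠ t in 𝓝 0, R.crit t = param (R.crit 0) (c t)) :
    ∃ a, AnalyticOver K.toSubfield 0 a ∧ a 0 = coord (R.landingPt 0) (R.landingPt 0) ∧
    ∃ (L : DynamicalModel K.toSubfield R.map (R.landingPt 0) (R.crit 0) a c (R.landingTime 0))
      (m₀ : ℤ) (x y : ℂ_[p]), x ∈ K ∧ y ∈ K ∧ x ^ L.d = -(L.lam ^ m₀ * L.zeta / L.rho) ∧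
        y ^ L.d' = L.lam ^ m₀ * L.zeta / L.rho' := by
  obtain ⟨hz, hzK, ζ, ρ, ρ', d, d', a, hζ, hρ, ha, hρ', m₀, ⟨x, hx, hxd⟩, y, hy, hyd⟩ := hz
  have hf := hRK.analyticRational hbif.1
  have hrep := hbif.landingTime_spec.2
  have hc0 : c 0 = coord (R.crit 0) (R.crit 0) :=
    param_injective (R.crit 0) (by rw [← hcrit.self_of_nhds, param_coord_self])
  obtain ⟨e, hdeg⟩ := hbif.exists_eventually_hasDeg hRK hc hcrit
  have hq : ((p : ℂ_[p])⁻¹) ∈ K.toSubfield := inv_mem (natCast_mem _ _)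
  have hq1 : 1 < ‖(p : ℂ_[p])⁻¹‖ := by
    have h1 : ‖(p : ℂ_[p])‖ = (p : ℝ)⁻¹ := by
      rw [← map_natCast (algebraMap ℚ_[p] ℂ_[p]), norm_algebraMap', Padic.norm_p]
    rw [norm_inv, h1, inv_inv]
    exact_mod_cast (Fact.out : p.Prime).one_lt
  obtain ⟨haO, L, h1, h2, h3, h4, h5, h6⟩ := exists_dynamicalModel_of_homoclinic
    (isClosed_toSubfield K) hq hq1 hf hc hc0 ha.1 ha.2.1 ha.2.2 hrep
    (crit_ne_of_repelling hRK hbif.1 hrep) rfl hdeg hz hzK hζ hρ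
    (hρ'.congr (by
      filter_upwards [hcrit] with t ht
      rw [gap, ht]))
  refine ⟨a, haO, ha.2.1, L, m₀, x, y, hx, hy, ?_, ?_⟩
  · rw [h1, h2, h3, h5, hxd]
  · rw [h1, h2, h4, h6, hyd]

end MarkedFamily

end Landing

/-! ### Bifurcations at the parameters of the solutions -/

section Solutions

variable {p : ℕ} [Fact p.Prime] {R : MarkedFamily p} {K : IntermediateField ℚ_[p] ℂ_[p]}
  [FiniteDimensional ℚ_[p] K] {a₀ c₀ : OnePoint ℂ_[p]} {a c : ℂ_[p] → ℂ_[p]} {ℓ : ℕ}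
  {L : DynamicalModel K.toSubfield R.map a₀ c₀ a c ℓ} {μ : ℝ}

namespace LocalModel.Solution

/-- The landing time at the parameter of a solution. One step earlier the orbit is at a point close
to `R_0 ^ (ℓ - 1) (c_0)`, which is not the fixed point. -/
theorem landingTime_eq (s : L.Solution (L.d - 1) μ) (hRK : R.DefinedOver K) (hℓ : 1 ≤ ℓ)
    (hμ : μ ≤ L.δ) (hB : s.t ∈ R.B) (hcrit : R.crit s.t = param c₀ (c s.t))
    (hne : (R.map s.t)^[ℓ - 1] (param c₀ (c s.t + s.ω 0 s.t)) ≠ param a₀ (a s.t)) :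
    R.landingTime s.t = s.time ∧ R.landingPt s.t = param a₀ (a s.t) := by
  have hrep := L.isRepelling ((s.t_le hμ).trans L.δ_le) (hRK.analyticRational hB)
  have h1 : R.landingTime s.t = s.time :=
    MarkedFamily.landingTime_eq (by rw [time]; omega) (by rw [hcrit, s.iterate_time hμ]) hrep
      (by rwa [hcrit, s.iterate_time_sub_one hμ hℓ])
  refine ⟨h1, ?_⟩
  rw [MarkedFamily.landingPt, h1, hcrit, s.iterate_time hμ]

/-- The parameters at which the critical point makes `d` returns before it lands on the fixed point
have all the required properties. -/
theorem hasTransversalMisiurewiczBifurcation (s : L.Solution (L.d - 1) μ)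
    (hRK : R.DefinedOver K) (hℓ : 1 ≤ ℓ)
    (hμ : μ ≤ L.δ) (hμ0 : 0 < μ) (hμρ : L.M * μ ≤ ‖(L.d : ℂ_[p])‖ ^ 2 / 2 * ‖L.rho‖)
    (hB : s.t ∈ R.B) (ha : AnalyticOver K.toSubfield s.t a) (hc : AnalyticOver K.toSubfield s.t c)
    (hcrit : ∀ᶠ t in 𝓝 s.t, R.crit t = param c₀ (c t))
    (hne : (R.map s.t)^[ℓ - 1] (param c₀ (c s.t + s.ω 0 s.t)) ≠ param a₀ (a s.t)) :
    R.HasTransversalMisiurewiczBifurcation s.t ∧ ∃ z, R.IsAdmissibleHomoclinic K s.t z := by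
  have hK := isClosed_toSubfield K
  have hf := hRK.analyticRational hB
  have htδ := s.t_le hμ
  have htδ₁ := htδ.trans L.δ_le
  have hc1 := hcrit.self_of_nhds
  obtain ⟨hT, hP⟩ := s.landingTime_eq hRK hℓ hμ hB hc1 hne
  have hrep := L.isRepelling htδ₁ hf
  have htime := s.iterate_time hμ
  obtain ⟨γ, hγK, hγ, hmove⟩ := s.exists_gap hK hμ hμ0 hf ha hc
  have hcont := L.continuation ha.analyticAt htδ
  set a' : ℂ_[p] → ℂ_[p] := fun t' => coord (param a₀ (a s.t)) (param a₀ (a t')) with ha'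
  have hcont' : R.IsContinuation s.t (R.landingPt s.t) a' := by
    rw [hP]
    exact ⟨hcont.1, rfl, hcont.2⟩
  have hgap : HasLeadingTerm (R.gap s.t a') s.t 1 γ := by
    refine hγ.congr ?_
    filter_upwards [hcrit] with t ht
    rw [MarkedFamily.gap, hT, hP, ht]
  refine ⟨⟨⟨hB, s.time, ?_, ?_, ?_, ?_, L.d, ?_⟩, a', hcont', ?_⟩, L.orbit s.t, ?_, ?_, ?_⟩
  · rw [time]; omega
  · rwa [hc1, htime]
  · rw [hc1]; exact L.isUnramified hf s.t_mem htδ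
  · obtain ⟨t, h1, h2, h3⟩ := (hmove.and (((hcrit.and (R.isBall.isOpen.mem_nhds hB))).filter_mono
      nhdsWithin_le_nhds)).exists
    exact ⟨t, h3, by rwa [h2]⟩
  · filter_upwards [hcrit, R.isBall.isOpen.mem_nhds hB,
      s.eventually_hasDeg hμ hμ0 hμρ hf ha hc] with t h1 h2 h3
    rwa [h1, (chartAnalyticAt_iterate (hRK.analyticRational h2) _ _).localDegree_eq_iff]
  · rw [hgap.hasDerivAt.deriv]
    exact hgap.1
  · rw [hP, hc1]
    exact L.isCriticalHomoclinic_orbit hf s.t_mem htδ htime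
  · exact L.isPointOver_orbit hf ha s.t_mem htδ
  · have hk := L.multiplier_eq htδ₁ hf
    have hkK := L.k_mem s.t s.t_mem htδ₁
    have haK := ha.mem.self_of_nhds s.t_mem
    have hcK := hc.mem.self_of_nhds s.t_mem
    obtain ⟨ζ, hζ, hζc⟩ := L.exists_tendsto_zeta s.t_mem (zero_mem _) htδ L.zero_le_δ
    have hζK : ζ ∈ K.toSubfield := hK.mem_of_tendsto hζ (by
      filter_upwards [eventually_ge_atTop L.i₀] with i hi
      exact mul_mem (pow_mem hkK i) (L.S_mem i hi s.t s.t_mem 0 (zero_mem _) htδ L.zero_le_δ))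
    obtain ⟨ρ, hρ, hρc, hρK⟩ := s.exists_hasLeadingTerm hK hμ hμ0 hμρ hf ha hc
    obtain ⟨m, x, hx, hxd⟩ := s.exists_pow_eq hK hμ hζK hρK hζc hρc
    have hκa := chartFactor_ne_zero a₀ (a s.t)
    have hκc := chartFactor_ne_zero c₀ (c s.t)
    refine ⟨ζ * chartFactor a₀ (a s.t),
      chartFactor a₀ (a s.t) * ρ * ((chartFactor c₀ (c s.t))⁻¹) ^ L.d, γ, L.d, 1, a',
      ?_, ?_, hcont', hgap, m, ?_, ?_⟩
    · rw [hP]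
      exact L.isAsymptoticPosition_orbit hf s.t_mem htδ hζ
    · rw [hT, hP, hc1]
      exact hρ
    · -- the coordinate change at `a₀` cancels, and the one at `c₀` contributes a `d`-th power
      refine ⟨x * chartFactor c₀ (c s.t), mul_mem hx (chartFactor_mem _ hcK), ?_⟩
      rw [hP, hk, mul_pow, hxd, zpow_natCast, inv_pow]
      have hρ0 : ρ ≠ 0 := right_ne_zero_of_mul (left_ne_zero_of_mul hρ.1)
      field_simp
    · refine ⟨L.k s.t 0 ^ m * (ζ * chartFactor a₀ (a s.t)) / γ, div_mem (mul_mem (pow_mem hkK m)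
        (mul_mem hζK (chartFactor_mem _ haK))) hγK, ?_⟩
      rw [hP, hk, pow_one, zpow_natCast]

/-- At the time `n + ℓ` the critical point is at the distance `‖v₀‖` from itself, in the chart at
`c₀`. -/
theorem iInf_chordal_le (s : L.Solution (L.d - 1) μ) (hμ : μ ≤ L.δ)
    (hcrit : R.crit s.t = param c₀ (c s.t)) (hT : R.landingTime s.t = s.time) (hℓ : 1 ≤ ℓ) :
    ⨅ i : Set.Icc 1 (R.landingTime s.t),
      chordal (R.crit s.t) ((R.map s.t)^[(i : ℕ)] (R.crit s.t)) ≤ μ := by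
  have hbdd : BddBelow (Set.range fun i : Set.Icc 1 (R.landingTime s.t) =>
      chordal (R.crit s.t) ((R.map s.t)^[(i : ℕ)] (R.crit s.t))) :=
    ⟨0, by rintro _ ⟨i, rfl⟩; exact chordal_nonneg _ _⟩
  refine (ciInf_le hbdd ⟨s.n + ℓ, by omega, by rw [hT, time]; omega⟩).trans ?_
  simp only [hcrit]
  rw [s.iterate_return hμ]
  refine (chordal_param_le _ _ _).trans ?_
  rw [sub_add_cancel_left, norm_neg, s.norm_ω _ s.t_mem s.t_near]
  exact s.norm_v₀

end LocalModel.Solution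

/-- All parameters close to `0` at which the critical point makes `d` returns before it lands on the
fixed point are as required. -/
theorem DynamicalModel.exists_forall_solution (L : DynamicalModel K.toSubfield R.map a₀ c₀ a c ℓ)
    (hRK : R.DefinedOver K) (hℓ : 1 ≤ ℓ) (hB : 0 ∈ R.B) (ha : AnalyticOver K.toSubfield 0 a)
    (hc : AnalyticOver K.toSubfield 0 c) (hcrit : ∀ᶠ t in 𝓝 0, R.crit t = param c₀ (c t))
    (hne : (R.map 0)^[ℓ - 1] (param c₀ (c 0)) ≠ param a₀ (a 0)) :
    ∃ μ₀, 0 < μ₀ ∧ ∀ μ, 0 < μ → μ ≤ μ₀ → ∀ s : L.Solution (L.d - 1) μ,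
      (R.HasTransversalMisiurewiczBifurcation s.t ∧ ∃ z, R.IsAdmissibleHomoclinic K s.t z) ∧
      ⨅ i : Set.Icc 1 (R.landingTime s.t),
        chordal (R.crit s.t) ((R.map s.t)^[(i : ℕ)] (R.crit s.t)) ≤ μ := by
  set y := (R.map 0)^[ℓ - 1] (param c₀ (c 0)) with hy
  obtain ⟨Φ, hΦ, hΦ1, hΦg⟩ := exists_chart (hRK.analyticRational hB) hc (b := c₀) (e := y)
    (k := ℓ - 1) (v₁ := 0) (x₁ := coord y y) (by rw [add_zero, param_coord_self])
  have hfst : Tendsto (Prod.fst : ℂ_[p] × ℂ_[p] → ℂ_[p]) (𝓝 (0, 0)) (𝓝 0) :=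
    continuous_fst.tendsto _
  have hΦt : Tendsto (fun z => param y (Φ z)) (𝓝 (0, 0)) (pnhds y) := by
    have h1 := (tendsto_param y (Φ (0, 0))).comp hΦ.analyticAt.continuousAt.tendsto
    rwa [hΦ1, param_coord_self] at h1
  have hat := ((tendsto_param a₀ (a 0)).comp ha.analyticAt.continuousAt.tendsto).comp hfst
  obtain ⟨U, hU, V, hV, hUV⟩ := Filter.disjoint_iff.mp (disjoint_pnhds hne)
  have hev : ∀ᶠ z in 𝓝 ((0 : ℂ_[p]), (0 : ℂ_[p])),
      (R.map z.1)^[ℓ - 1] (param c₀ (c z.1 + z.2)) ≠ param a₀ (a z.1) := by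
    filter_upwards [hΦg, hΦt hU, hat hV] with z h1 h2 h3
    rw [h1]
    exact hUV.ne_of_mem h2 h3
  have hBev : ∀ᶠ t in 𝓝 0, t ∈ R.B := R.isBall.isOpen.mem_nhds hB
  obtain ⟨r, hr, hbox⟩ := exists_box_of_eventually (hev.and (hfst.eventually
    ((hBev.and hcrit.eventually_nhds).and (ha.eventually.and hc.eventually))))
  have hM := L.M_nonneg
  have hρ : 0 < ‖(L.d : ℂ_[p])‖ ^ 2 / 2 * ‖L.rho‖ := by
    have h1 := L.norm_d_pos
    have h2 := norm_pos_iff.mpr L.rho_ne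
    positivity
  refine ⟨min (min r L.δ) (‖(L.d : ℂ_[p])‖ ^ 2 / 2 * ‖L.rho‖ / (L.M + 1)),
    lt_min (lt_min hr L.δ_pos) (by positivity), fun μ hμ0 hμ s => ?_⟩
  obtain ⟨hμ', hμρ⟩ := le_min_iff.mp hμ
  obtain ⟨hμr, hμδ⟩ := le_min_iff.mp hμ'
  rw [le_div_iff₀ (by positivity)] at hμρ
  have hω : ‖s.ω 0 s.t‖ ≤ r := by
    rw [s.norm_ω 0 s.t_mem s.t_near]
    exact s.norm_v₀.trans hμr
  obtain ⟨h1, ⟨h2, h3⟩, h4, h5⟩ := hbox s.t (s.ω 0 s.t) (by simpa using s.norm_t.trans hμr)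
    (by simpa using hω)
  have h6 := s.landingTime_eq hRK hℓ hμδ h2 h3.self_of_nhds h1
  exact ⟨s.hasTransversalMisiurewiczBifurcation hRK hℓ hμδ hμ0 (by nlinarith) h2 h4 h5 h3 h1,
    s.iInf_chordal_le hμδ h3.self_of_nhds h6.1 hℓ⟩

end Solutions

end MisBif

theorem propositionA (p : ℕ) [Fact p.Prime]
    (K : IntermediateField ℚ_[p] ℂ_[p]) [FiniteDimensional ℚ_[p] K]
    (R : MisBif.MarkedFamily p) (hRK : R.DefinedOver K)
    (hbif : R.HasMisiurewiczBifurcation 0)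
    (hadm : ∃ z : ℤ → OnePoint ℂ_[p], R.IsAdmissibleHomoclinic K 0 z) :
    ∃ t : ℕ → ℂ_[p],
      (∀ r, t r ∈ K) ∧
      Tendsto t atTop (𝓝 0) ∧
      (∀ r, R.HasTransversalMisiurewiczBifurcation (t r) ∧
        ∃ z : ℤ → OnePoint ℂ_[p], R.IsAdmissibleHomoclinic K (t r) z) ∧
      Tendsto
        (fun r => ⨅ i : Set.Icc 1 (R.landingTime (t r)),
          MisBif.chordal (R.crit (t r)) ((R.map (t r))^[(i : ℕ)] (R.crit (t r))))
        atTop (𝓝 0) := by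
  obtain ⟨z, hz⟩ := hadm
  obtain ⟨c, hc, hcrit⟩ := hRK.exists_crit hbif.1
  obtain ⟨a, ha, ha0, L, m₀, x, y, hx, hy, hxd, hyd⟩ := hz.exists_dynamicalModel hRK hbif hc hcrit
  obtain ⟨μ₀, hμ₀, h⟩ := L.exists_forall_solution hRK hbif.landingTime_spec.1 hbif.1 ha hc hcrit (by
    rw [← hcrit.self_of_nhds, ha0, MisBif.param_coord_self]
    exact hbif.iterate_landingTime_sub_one_ne hRK)
  set μ : ℕ → ℝ := fun r => min μ₀ (1 / ((r : ℝ) + 1)) with hμ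
  have hμ0 : ∀ r, 0 < μ r := fun r => lt_min hμ₀ Nat.one_div_pos_of_nat
  have hμt : Tendsto μ atTop (𝓝 0) :=
    squeeze_zero (fun r => (hμ0 r).le) (fun r => min_le_right _ _)
      tendsto_one_div_add_atTop_nhds_zero_nat
  -- `d` returns, with coordinates `ω (d - 1), …, ω 0`, so that admissibility persists
  have s : ∀ r, L.Solution (L.d - 1) (μ r) := fun r =>
    (L.nonempty_solution (MisBif.isClosed_toSubfield K) (L.d - 1) hx hy hxd hyd
      (hμ0 r)).some
  have hs := fun r => h (μ r) (hμ0 r) (min_le_left _ _) (s r)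
  exact ⟨fun r => (s r).t, fun r => (s r).t_mem, squeeze_zero_norm (fun r => (s r).norm_t) hμt,
    fun r => (hs r).1, squeeze_zero (fun r => Real.iInf_nonneg fun i => MisBif.chordal_nonneg _ _)
      (fun r => (hs r).2) hμt⟩
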